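/- For $\tau\in\mathcal H$ (the upper half-plane) and $z\in\mathbb C\setminus(\mathbb Z\oplus\mathbb Z\tau)$ let $$\wp(\tau,z)=\frac1{z^2}+\sum_{w\in(\mathbb Z\oplus\mathbb Z\tau)\setminus\{0\}}\Big(\frac1{(z-w)^2}-\frac1{w^2}\Big),\qquad e_4(\tau)=\sum_{w\in(\mathbb Z\oplus\mathbb Z\tau)\setminus\{0\}}w^{-4},$$ $$E_1(\tau,z)=\lim_{N\to\infty}\sum_{n=-N}^{N}\Big(\lim_{M\to\infty}\sum_{m=-M}^{M}\frac1{z+m+n\tau}\Big).$$ Functions of $\tau$ alone are regarded as functions of $(\tau,z)$. Put $\partial_z=\partial/\partial z$, $\partial_\tau=\frac{\pi}{2i}\,\partial/\partial\tau$ and $d=\partial_\tau+\frac14E_1\partial_z$. Let $\mathrm{JS}=\mathbb C[\wp,\partial_z\wp,e_4]$ be the algebra of elliptic forms and, for $k\in\mathbb N$, let $\mathrm{JS}_k$ be the linear span of the monomials $\wp^a(\partial_z\wp)^be_4^c$ with $2a+3b+4c=k$. For $n,k,l\in\mathbb N$, $f\in\mathrm{JS}_k$ and $g\in\mathrm{JS}_l$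 set $$\llbracket f,g\rrbracket_n=\sum_{r=0}^n(-1)^r\binom{k+n-1}{n-r}\binom{l+n-1}{r}\,d^r(f)\,d^{\,n-r}(g).$$ Then: 1. $\mathrm{JS}$ is stable under these brackets: $\llbracket f,g\rrbracket_n\in\mathrm{JS}$ for all $n,k,l\in\mathbb N$, $f\in\mathrm{JS}_k$, $g\in\mathrm{JS}_l$; and they extend, in one and only one way, to a sequence of $\mathbb C$-bilinear maps $\llbracket\cdot,\cdot\rrbracket_n:\mathrm{JS}\times\mathrm{JS}\to\mathrm{JS}$ $(n\ge0)$. 2. This sequence is a formal deformation of $\mathrm{JS}$: $\llbracket f,g\rrbracket_0=fg$, and the product on $\mathrm{JS}[[\hbar]]$ given by $$\Big(\sum_iF_i\hbar^i\Big)\star\Big(\sum_jG_j\hbar^j\Big)=\sum_{i,j,m}\llbracket F_i,G_j\rrbracket_m\,\hbar^{i+j+m}$$ is associative. 3. It extends the classical Rankin–Cohen brackets on the algebra $M$ of modular forms for $\mathrm{SL}(2,\mathbb Z)$: if $f$ and $g$ are modular forms of weights $k,l\in\mathbb N$, then $f\in\mathrm{JS}_k$, $g\in\mathrm{JS}_l$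 and, for all $n\ge0$, $$\llbracket f,g\rrbracket_n=\sum_{r=0}^n(-1)^r\binom{k+n-1}{n-r}\binom{l+n-1}{r}\,\partial_\tau^r(f)\,\partial_\tau^{\,n-r}(g),$$ which is a modular form of weight $k+l+2n$. -/

import Mathlib

open UpperHalfPlane hiding I
open SummationFilter
open scoped MatrixGroups ModularForm

noncomputable section

namespace EllipticForms

/-! ### The functions `℘`, `∂_z ℘`, `e₄`, `E₁` -/

/-- The period pair `(1, τ)`; its lattice is `ℤ ⊕ ℤ τ`. -/
def periodPair (τ : ℍ) : PeriodPair where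
  ω₁ := 1
  ω₂ := (τ : ℂ)
  indep := by
    rw [LinearIndependent.pair_iff]
    intro s t h
    have him := congrArg Complex.im h
    have hre := congrArg Complex.re h
    simp only [Complex.real_smul, Complex.add_im, Complex.mul_im, Complex.ofReal_re,
      Complex.ofReal_im, Complex.one_im, Complex.one_re, Complex.zero_im, mul_zero, zero_mul,
      add_zero, zero_add, mul_eq_zero] at him
    have ht : t = 0 := him.resolve_right τ.im_pos.ne'
    subst ht
    simpa using hre

/-- The pairs `(τ, z)` in `ℍ × ℂ` with `z` not in the lattice `ℤ ⊕ ℤ τ`: the common domain of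
holomorphy of the forms considered here, whose only poles in `z` are the lattice points. -/
def domain : Set (ℍ × ℂ) := {p | p.2 ∉ (periodPair p.1).lattice}

/-- Complex functions on the complement of the lattice points, with pointwise operations. -/
abbrev Fun : Type := domain → ℂ

/-- The Weierstrass function `(τ, z) ↦ ℘(τ, z)` of the lattice `ℤ ⊕ ℤ τ`. -/
def wp : Fun := fun p => (periodPair p.1.1).weierstrassP p.1.2

/-- The Eisenstein series `e₄(τ) = ∑ w⁻⁴` over the nonzero `w` in `ℤ ⊕ ℤ τ`, as a function of
`(τ, z)`. (The term of `w = 0` in `PeriodPair.G` is `0⁻¹ = 0`.) -/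
def e4 : Fun := fun p => (periodPair p.1.1).G 4

/-- The first shifted Eisenstein function
`E₁(τ, z) = lim_{N → ∞} ∑_{n = -N}^{N} lim_{M → ∞} ∑_{m = -M}^{M} 1 / (z + m + n τ)`
(Eisenstein summation). -/
def E1 : Fun := fun p =>
  ∑'[symmetricIcc ℤ] n : ℤ, ∑'[symmetricIcc ℤ] m : ℤ,
    1 / (p.1.2 + (m : ℂ) + (n : ℂ) * (p.1.1 : ℂ))

/-! ### Derivations -/

/-- Extension by `0` to `ℍ × ℂ`. The domain is open, so the partial derivatives at a point of the
domain do not see the values outside. -/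
def extendZero (f : Fun) : ℍ × ℂ → ℂ := Function.extend Subtype.val f 0

/-- The elliptic derivation `∂_z = ∂/∂z`. -/
def dz (f : Fun) : Fun := fun p => deriv (fun w : ℂ => extendZero f (p.1.1, w)) p.1.2

/-- The modular derivation `∂_τ = (π / 2i) ∂/∂τ`. -/
def dtau (f : Fun) : Fun := fun p =>
  (Real.pi : ℂ) / (2 * Complex.I) *
    deriv (fun t : ℂ => extendZero f (ofComplex t, p.1.2)) (p.1.1 : ℂ)

/-- The derivation `d = ∂_τ + (1/4) E₁ ∂_z`. -/
def d (f : Fun) : Fun := dtau f + (1 / 4 : ℂ) • (E1 * dz f)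

/-! ### The algebra of elliptic forms and its grading by the weight -/

/-- The algebra `JS = ℂ[℘, ∂_z ℘, e₄]` of elliptic forms. -/
def JS : Subalgebra ℂ Fun := Algebra.adjoin ℂ {wp, dz wp, e4}

/-- `JS_k`: the linear combinations of the monomials `℘ ^ a (∂_z ℘) ^ b e₄ ^ c` with
`2 a + 3 b + 4 c = k`. -/
def JSweight (k : ℕ) : Submodule ℂ Fun :=
  Submodule.span ℂ {f | ∃ a b c : ℕ, 2 * a + 3 * b + 4 * c = k ∧ f = wp ^ a * dz wp ^ b * e4 ^ c}

theorem mem_JS_of_mem_JSweight {k : ℕ} {f : Fun} (hf : f ∈ JSweight k) : f ∈ JS := by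
  have hle : JSweight k ≤ Subalgebra.toSubmodule JS := by
    refine Submodule.span_le.2 ?_
    rintro _ ⟨a, b, c, -, rfl⟩
    have h1 : wp ∈ JS := Algebra.subset_adjoin (by simp)
    have h2 : dz wp ∈ JS := Algebra.subset_adjoin (by simp)
    have h3 : e4 ∈ JS := Algebra.subset_adjoin (by simp)
    exact JS.mul_mem (JS.mul_mem (JS.pow_mem h1 a) (JS.pow_mem h2 b)) (JS.pow_mem h3 c)
  exact hle hf

/-! ### Rankin–Cohen brackets -/

/-- The Rankin–Cohen expression of order `n` for a map `D` in the weights `k` and `l`: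
`∑_{r = 0}^{n} (-1)^r C(k+n-1, n-r) C(l+n-1, r) D^r(f) D^{n-r}(g)`.
(For `n = 0` the only binomials are `C(k-1, 0) = C(l-1, 0) = 1`, also when `k` or `l` is `0`.) -/
def rankinCohen {X : Type*} (D : (X → ℂ) → X → ℂ) (k l n : ℕ) (f g : X → ℂ) : X → ℂ :=
  ∑ r ∈ Finset.range (n + 1),
    ((-1 : ℂ) ^ r * ((k + n - 1).choose (n - r) : ℂ) * ((l + n - 1).choose r : ℂ)) •
      (D^[r] f * D^[n - r] g)

/-- `B` is the sequence of bilinear extensions to `JS` of the brackets `⟦f, g⟧_n` given for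
`f ∈ JS_k` and `g ∈ JS_l` by the Rankin–Cohen expression for the derivation `d`. -/
def IsBracketSequence (B : ℕ → JS →ₗ[ℂ] JS →ₗ[ℂ] JS) : Prop :=
  ∀ (n k l : ℕ) (f g : JS), (f : Fun) ∈ JSweight k → (g : Fun) ∈ JSweight l →
    (B n f g : Fun) = rankinCohen d k l n f g

/-! ### Formal deformations -/

/-- The product `F ⋆ G = ∑_{i, j, m} μ_m(F_i, G_j) ħ^(i + j + m)` on `A⟦ħ⟧`, which extends
`f ⋆ g = ∑_m μ_m(f, g) ħ^m`. -/
def starProduct {A : Type*} [CommRing A] [Algebra ℂ A] (μ : ℕ → A →ₗ[ℂ] A →ₗ[ℂ] A)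
    (F G : PowerSeries A) : PowerSeries A :=
  PowerSeries.mk fun n =>
    ∑ p ∈ Finset.HasAntidiagonal.antidiagonal n, ∑ q ∈ Finset.HasAntidiagonal.antidiagonal p.2,
      μ p.1 (PowerSeries.coeff q.1 F) (PowerSeries.coeff q.2 G)

/-- The sequence `μ` of bilinear maps is a formal deformation of the commutative algebra `A`:
`μ₀` is the product of `A`, and the star product on `A⟦ħ⟧` is associative. -/
def IsFormalDeformation {A : Type*} [CommRing A] [Algebra ℂ A]
    (μ : ℕ → A →ₗ[ℂ] A →ₗ[ℂ] A) : Prop :=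
  (∀ f g : A, μ 0 f g = f * g) ∧
    ∀ F G H : PowerSeries A,
      starProduct μ (starProduct μ F G) H = starProduct μ F (starProduct μ G H)

/-! ### Modular forms -/

/-- The derivation `∂_τ = (π / 2i) d/dτ` on functions of `τ` alone. -/
def modularDeriv (f : ℍ → ℂ) : ℍ → ℂ := fun τ =>
  (Real.pi : ℂ) / (2 * Complex.I) * deriv (fun t : ℂ => f (ofComplex t)) (τ : ℂ)

/-- A function of `τ`, seen as a function of `(τ, z)`. -/
def ofTau (f : ℍ → ℂ) : Fun := fun p => f p.1.1

end EllipticForms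

end

/-! The theorem combines an algebraic construction of associative brackets with differential
equations for the generators.

Algebra. Let `D` be a derivation raising the weight by two on a graded polynomial ring. Adjoin a
variable `u`, recording the weight through `f ↦ u ^ k * f`, and a formal time `t` with `D t = 1`.
Then `X = u D` and `Y = - u ^ 2 ∂_u - u t D` commute, so their Moyal product is associative
(`moyal_assoc`). Its brackets preserve independence of `t` and, computed at `t = 0`, are the
Rankin–Cohen brackets times `u ^ (k + l + 2 n)` (`moyal_lift_eq`). Hence the latter form an
associative star product (`polyBracket_assoc`). If there is a variable `φ` of weight two such that
`[∂_φ, D]` is the Euler derivation, then brackets of elements free of `φ` are free of `φ`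
(`pderiv_polyRankinCohen`). So the subring without `φ` carries the brackets although `D` need not
preserve it (`quasiBracket_assoc`).

Analysis. The derivation `d` has this shape on polynomials in `℘`, `∂_z ℘`, `e₄` and `φ = e₂ / 4`
(`d_ellEvalPhi`). The source is the equation `∂_τ E₁ = - E₁ ∂_z E₁ / 4 - ∂_z² E₁ / 8` (`burgers`):
the difference of its sides is elliptic without poles, hence constant by Liouville, and odd, hence
zero. Its `z`-derivatives, with `∂_z E₁ = -℘ - e₂` and `℘'' = 6 ℘² - 30 e₄`, yield `d ℘`, `d (∂_z
℘)` and Ramanujan's formulas for `e₂` and `e₄`.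

Transfer. The brackets descend from polynomials to `JS` because the kernel of the evaluation is
homogeneous (`ellEval_weightedHomogeneousComponent_eq_zero`): under `τ ↦ τ / (c τ + 1)`, with `z`
rescaled, weight `k` is seen as the factor `(c τ + 1) ^ k`. Modular forms are polynomials in `e₄`
and `e₆` (`exists_modEval_eq`), `e₆` lies in `JS` by the Weierstrass equation, and `d` is `∂_τ` on
functions of `τ`. The same algebra for the generators `e₄`, `e₆` shows that the brackets of modular
forms are modular. -/

namespace EllipticForms

/-! ### The Moyal product of two commuting derivations. -/

section Moyal

open TensorProduct Finset

variable {R : Type*} [CommRing R] [Algebra ℂ R]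

/-- The bidifferential operator `X ⊗ Y - Y ⊗ X` of two derivations. -/
noncomputable def poissonOp (X Y : Derivation ℂ R R) : Module.End ℂ (R ⊗[ℂ] R) :=
  TensorProduct.map X.toLinearMap Y.toLinearMap - TensorProduct.map Y.toLinearMap X.toLinearMap

/-- The bidifferential operators `m ∘ (X ⊗ Y - Y ⊗ X) ^ n / n!` of the Moyal product. -/
noncomputable def moyal (X Y : Derivation ℂ R R) (n : ℕ) : R →ₗ[ℂ] R →ₗ[ℂ] R :=
  TensorProduct.curry ((n.factorial : ℂ)⁻¹ • (LinearMap.mul' ℂ R ∘ₗ poissonOp X Y ^ n))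

theorem moyal_apply (X Y : Derivation ℂ R R) (n : ℕ) (F G : R) :
    moyal X Y n F G = (n.factorial : ℂ)⁻¹ • LinearMap.mul' ℂ R ((poissonOp X Y ^ n) (F ⊗ₜ G)) := rfl

/-- The operator `X ⊗ Y - Y ⊗ X` on the first two factors of a triple tensor product. -/
noncomputable def poissonOp₁₂ (X Y : Derivation ℂ R R) : Module.End ℂ (R ⊗[ℂ] (R ⊗[ℂ] R)) :=
  map X.toLinearMap (map Y.toLinearMap .id) - map Y.toLinearMap (map X.toLinearMap .id)

/-- The operator `X ⊗ Y - Y ⊗ X` on the outer factors of a triple tensor product. -/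
noncomputable def poissonOp₁₃ (X Y : Derivation ℂ R R) : Module.End ℂ (R ⊗[ℂ] (R ⊗[ℂ] R)) :=
  map X.toLinearMap (map .id Y.toLinearMap) - map Y.toLinearMap (map .id X.toLinearMap)

/-- The operator `X ⊗ Y - Y ⊗ X` on the last two factors of a triple tensor product. -/
noncomputable def poissonOp₂₃ (X Y : Derivation ℂ R R) : Module.End ℂ (R ⊗[ℂ] (R ⊗[ℂ] R)) :=
  map .id (poissonOp X Y)

/-- Multiplication of the first two factors. -/
noncomputable def mul₁₂ : R ⊗[ℂ] (R ⊗[ℂ] R) →ₗ[ℂ] R ⊗[ℂ] R :=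
  map (LinearMap.mul' ℂ R) .id ∘ₗ (TensorProduct.assoc ℂ R R R).symm.toLinearMap

/-- Multiplication of the last two factors. -/
noncomputable def mul₂₃ : R ⊗[ℂ] (R ⊗[ℂ] R) →ₗ[ℂ] R ⊗[ℂ] R :=
  map .id (LinearMap.mul' ℂ R)

theorem poissonOp_tmul (X Y : Derivation ℂ R R) (F G : R) :
    poissonOp X Y (F ⊗ₜ G) = X F ⊗ₜ Y G - Y F ⊗ₜ X G := rfl

theorem poissonOp₁₂_tmul (X Y : Derivation ℂ R R) (F G H : R) :
    poissonOp₁₂ X Y (F ⊗ₜ (G ⊗ₜ H)) = X F ⊗ₜ (Y G ⊗ₜ H) - Y F ⊗ₜ (X G ⊗ₜ H) := rfl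

theorem poissonOp₁₃_tmul (X Y : Derivation ℂ R R) (F G H : R) :
    poissonOp₁₃ X Y (F ⊗ₜ (G ⊗ₜ H)) = X F ⊗ₜ (G ⊗ₜ Y H) - Y F ⊗ₜ (G ⊗ₜ X H) := rfl

theorem poissonOp₂₃_tmul (X Y : Derivation ℂ R R) (F G H : R) :
    poissonOp₂₃ X Y (F ⊗ₜ (G ⊗ₜ H)) = F ⊗ₜ (X G ⊗ₜ Y H) - F ⊗ₜ (Y G ⊗ₜ X H) := by
  simp [poissonOp₂₃, poissonOp_tmul, tmul_sub]

theorem mul₁₂_tmul (F G H : R) : mul₁₂ (F ⊗ₜ[ℂ] (G ⊗ₜ[ℂ] H)) = (F * G) ⊗ₜ H := rfl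

theorem mul₂₃_tmul (F G H : R) : mul₂₃ (F ⊗ₜ[ℂ] (G ⊗ₜ[ℂ] H)) = F ⊗ₜ (G * H) := rfl

theorem ext_triple {M : Type*} [AddCommGroup M] [Module ℂ M]
    {f g : R ⊗[ℂ] (R ⊗[ℂ] R) →ₗ[ℂ] M}
    (h : ∀ F G H : R, f (F ⊗ₜ (G ⊗ₜ H)) = g (F ⊗ₜ (G ⊗ₜ H))) : f = g := by
  ext F G H
  exact h F G H

/-- The Leibniz rule: a derivation of a product of the first two factors acts on one or the other of
them. -/
theorem poissonOp_comp_mul₁₂ (X Y : Derivation ℂ R R) :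
    poissonOp X Y ∘ₗ mul₁₂ = mul₁₂ ∘ₗ (poissonOp₁₃ X Y + poissonOp₂₃ X Y) := by
  refine ext_triple fun F G H => ?_
  simp only [LinearMap.comp_apply, LinearMap.add_apply, mul₁₂_tmul, poissonOp_tmul,
    poissonOp₁₃_tmul, poissonOp₂₃_tmul, map_add, map_sub, Derivation.leibniz, smul_eq_mul,
    add_tmul]
  simp only [mul_comm G]
  abel

theorem poissonOp_comp_mul₂₃ (X Y : Derivation ℂ R R) :
    poissonOp X Y ∘ₗ mul₂₃ = mul₂₃ ∘ₗ (poissonOp₁₂ X Y + poissonOp₁₃ X Y) := by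
  refine ext_triple fun F G H => ?_
  simp only [LinearMap.comp_apply, LinearMap.add_apply, mul₂₃_tmul, poissonOp_tmul,
    poissonOp₁₃_tmul, poissonOp₁₂_tmul, map_add, map_sub, Derivation.leibniz, smul_eq_mul,
    tmul_add]
  simp only [mul_comm H]
  abel

theorem pow_comp_of_comp {M N : Type*} [AddCommGroup M] [Module ℂ M] [AddCommGroup N] [Module ℂ N]
    {P : Module.End ℂ N} {Q : Module.End ℂ M} {m : M →ₗ[ℂ] N} (h : P ∘ₗ m = m ∘ₗ Q) (n : ℕ)
    (t : M) : (P ^ n) (m t) = m ((Q ^ n) t) := by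
  induction n generalizing t with
  | zero => simp
  | succ n ih =>
    rw [pow_succ, pow_succ, Module.End.mul_apply, Module.End.mul_apply, ← ih]
    exact congrArg _ (LinearMap.congr_fun h t)

variable {X Y : Derivation ℂ R R}

theorem commute_poissonOp₁₂_₁₃ (h : ∀ F, X (Y F) = Y (X F)) :
    Commute (poissonOp₁₂ X Y) (poissonOp₁₃ X Y) := by
  refine ext_triple fun F G H => ?_
  simp only [Module.End.mul_apply, poissonOp₁₂_tmul, poissonOp₁₃_tmul, map_sub, h]
  abel

theorem commute_poissonOp₁₂_₂₃ (h : ∀ F, X (Y F) = Y (X F)) :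
    Commute (poissonOp₁₂ X Y) (poissonOp₂₃ X Y) := by
  refine ext_triple fun F G H => ?_
  simp only [Module.End.mul_apply, poissonOp₁₂_tmul, poissonOp₂₃_tmul, map_sub, h]
  abel

theorem commute_poissonOp₁₃_₂₃ (h : ∀ F, X (Y F) = Y (X F)) :
    Commute (poissonOp₁₃ X Y) (poissonOp₂₃ X Y) := by
  refine ext_triple fun F G H => ?_
  simp only [Module.End.mul_apply, poissonOp₁₃_tmul, poissonOp₂₃_tmul, map_sub, h]
  abel

theorem moyal_moyal_left (i j : ℕ) (F G H : R) :
    moyal X Y i (moyal X Y j F G) H = ((i.factorial : ℂ)⁻¹ * (j.factorial : ℂ)⁻¹) •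
      LinearMap.mul' ℂ R (mul₁₂ (((poissonOp₁₃ X Y + poissonOp₂₃ X Y) ^ i)
        ((poissonOp₁₂ X Y ^ j) (F ⊗ₜ (G ⊗ₜ H))))) := by
  -- Stated for arbitrary tensors, since `poissonOp` does not preserve pure tensors.
  have key : ∀ t : R ⊗[ℂ] R, (LinearMap.mul' ℂ R ((poissonOp X Y ^ j) t)) ⊗ₜ[ℂ] H =
      mul₁₂ ((poissonOp₁₂ X Y ^ j) (TensorProduct.assoc ℂ R R R (t ⊗ₜ[ℂ] H))) := by
    have h : poissonOp₁₂ X Y ∘ₗ (TensorProduct.assoc ℂ R R R).toLinearMap =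
        (TensorProduct.assoc ℂ R R R).toLinearMap ∘ₗ map (poissonOp X Y) .id := by
      refine TensorProduct.ext_threefold fun F G H => ?_
      simp [poissonOp₁₂_tmul, poissonOp_tmul, sub_tmul]
    intro t
    have h2 := pow_comp_of_comp h j (t ⊗ₜ[ℂ] H)
    simp only [LinearEquiv.coe_coe] at h2
    rw [h2, TensorProduct.map_pow]
    simp [mul₁₂]
  rw [moyal_apply, moyal_apply, ← TensorProduct.smul_tmul', map_smul, map_smul, smul_smul, key,
    pow_comp_of_comp (poissonOp_comp_mul₁₂ X Y), TensorProduct.assoc_tmul]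

theorem moyal_moyal_right (i j : ℕ) (F G H : R) :
    moyal X Y i F (moyal X Y j G H) = ((i.factorial : ℂ)⁻¹ * (j.factorial : ℂ)⁻¹) •
      LinearMap.mul' ℂ R (mul₂₃ (((poissonOp₁₂ X Y + poissonOp₁₃ X Y) ^ i)
        ((poissonOp₂₃ X Y ^ j) (F ⊗ₜ (G ⊗ₜ H))))) := by
  have key : ∀ t : R ⊗[ℂ] R, F ⊗ₜ[ℂ] (LinearMap.mul' ℂ R ((poissonOp X Y ^ j) t)) =
      mul₂₃ ((poissonOp₂₃ X Y ^ j) (F ⊗ₜ[ℂ] t)) := by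
    intro t
    rw [poissonOp₂₃, TensorProduct.map_pow]
    simp [mul₂₃]
  rw [moyal_apply, moyal_apply, TensorProduct.tmul_smul, map_smul, map_smul, smul_smul, key,
    pow_comp_of_comp (poissonOp_comp_mul₂₃ X Y)]

/-- The binomial theorem in divided powers: the part of degree `n` of `exp A * exp B = exp (A + B)`.
-/
theorem sum_antidiagonal_pow_mul_pow {M : Type*} [AddCommGroup M] [Module ℂ M]
    {A B : Module.End ℂ M} (h : Commute A B) (n : ℕ) :
    ∑ p ∈ antidiagonal n, ((p.1.factorial : ℂ)⁻¹ * (p.2.factorial : ℂ)⁻¹) • (A ^ p.1 * B ^ p.2) =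
      (n.factorial : ℂ)⁻¹ • (A + B) ^ n := by
  rw [h.add_pow', smul_sum]
  refine sum_congr rfl fun p hp => ?_
  rw [← Nat.cast_smul_eq_nsmul ℂ, smul_smul, ← mem_antidiagonal.1 hp]
  congr 1
  have := Nat.add_choose_mul_factorial_mul_factorial p.1 p.2
  rw [mul_assoc, mul_comm, ← Nat.choose_symm_add] at this
  have h3 : ((p.1 + p.2).factorial : ℂ) ≠ 0 := mod_cast Nat.factorial_ne_zero _
  have h1 : ((p.1).factorial : ℂ) ≠ 0 := mod_cast Nat.factorial_ne_zero _
  have h2 : ((p.2).factorial : ℂ) ≠ 0 := mod_cast Nat.factorial_ne_zero _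
  field_simp
  exact_mod_cast this.symm

/-- The Moyal product of two commuting derivations is associative. -/
theorem moyal_assoc (h : ∀ F, X (Y F) = Y (X F)) (n : ℕ) (F G H : R) :
    ∑ p ∈ antidiagonal n, moyal X Y p.1 (moyal X Y p.2 F G) H =
      ∑ p ∈ antidiagonal n, moyal X Y p.1 F (moyal X Y p.2 G H) := by
  -- Both sides become the triple product of `(P₁₂ + P₁₃ + P₂₃) ^ n / n!`, where `Pᵢⱼ` acts on the
  -- factors `i` and `j`: the left side groups it as `(P₁₃ + P₂₃) + P₁₂`, the right side as `(P₁₂ +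
  -- P₁₃) + P₂₃`.
  have h1 := congrArg (fun A => LinearMap.mul' ℂ R (mul₁₂ (A (F ⊗ₜ[ℂ] (G ⊗ₜ[ℂ] H)))))
    (sum_antidiagonal_pow_mul_pow (n := n)
    ((commute_poissonOp₁₂_₁₃ h).symm.add_left (commute_poissonOp₁₂_₂₃ h).symm))
  have h2 := congrArg (fun A => LinearMap.mul' ℂ R (mul₂₃ (A (F ⊗ₜ[ℂ] (G ⊗ₜ[ℂ] H)))))
    (sum_antidiagonal_pow_mul_pow (n := n)
    ((commute_poissonOp₁₂_₂₃ h).add_left (commute_poissonOp₁₃_₂₃ h)))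
  simp only [LinearMap.sum_apply, LinearMap.smul_apply, Module.End.mul_apply, map_sum,
    map_smul] at h1 h2
  simp only [moyal_moyal_left, moyal_moyal_right, h1, h2]
  have hm : ∀ t : R ⊗[ℂ] (R ⊗[ℂ] R), LinearMap.mul' ℂ R (mul₁₂ t) = LinearMap.mul' ℂ R (mul₂₃ t) := by
    intro t
    refine LinearMap.congr_fun (f := LinearMap.mul' ℂ R ∘ₗ mul₁₂)
      (g := LinearMap.mul' ℂ R ∘ₗ mul₂₃) (ext_triple fun F G H => ?_) t
    simp [mul₁₂_tmul, mul₂₃_tmul, mul_assoc]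
  rw [hm, add_right_comm, add_comm (poissonOp₁₃ X Y), add_right_comm]

/-- The iterates of `X` are applied first because, in the lift below, they keep elements `u ^ m * f`
free of `t`, while `Y` does not. -/
theorem moyal_eq_sum (h : ∀ F, X (Y F) = Y (X F)) (n : ℕ) (F G : R) :
    moyal X Y n F G = ∑ r ∈ range (n + 1), ((-1 : ℂ) ^ (n - r) * (r.factorial : ℂ)⁻¹ *
      ((n - r).factorial : ℂ)⁻¹) • (Y^[n - r] (X^[r] F) * Y^[r] (X^[n - r] G)) := by
  have hc : Commute (TensorProduct.map X.toLinearMap Y.toLinearMap)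
      ((-1 : ℂ) • TensorProduct.map Y.toLinearMap X.toLinearMap) := by
    refine TensorProduct.ext' fun F G => ?_
    simp [h]
  have hit : ∀ (Z : Derivation ℂ R R) (r : ℕ) (F : R), (Z.toLinearMap ^ r) F = Z^[r] F :=
    fun Z r F => Module.End.pow_apply _ _ _
  have hcom : ∀ (i j : ℕ) (F : R), X^[i] (Y^[j] F) = Y^[j] (X^[i] F) := fun i j F =>
    (Function.Commute.iterate_iterate (f := X) (g := Y) h i j) F
  have hP : poissonOp X Y = TensorProduct.map X.toLinearMap Y.toLinearMap +
      (-1 : ℂ) • TensorProduct.map Y.toLinearMap X.toLinearMap := by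
    refine TensorProduct.ext' fun F G => ?_
    simp [poissonOp, sub_eq_add_neg]
  have hs := sum_antidiagonal_pow_mul_pow hc n
  rw [← hP] at hs
  have := congrArg (fun A => LinearMap.mul' ℂ R (A (F ⊗ₜ[ℂ] G))) hs
  simp only [LinearMap.smul_apply, map_smul, ← moyal_apply] at this
  rw [← this, Nat.sum_antidiagonal_eq_sum_range_succ_mk]
  simp only [LinearMap.sum_apply, map_sum]
  refine sum_congr rfl fun r _ => ?_
  simp only [smul_pow, TensorProduct.map_pow, LinearMap.smul_apply, Module.End.mul_apply,
    TensorProduct.map_tmul, map_smul, LinearMap.mul'_apply, hit, smul_smul, hcom]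
  congr 1
  ring

end Moyal

/-! ### Rankin–Cohen brackets as Moyal brackets in two more variables. -/

section Lift

open MvPolynomial Finset

variable {σ : Type*}

/-- The Rankin–Cohen bracket of polynomials for a derivation `D`, in the weights `k` and `l`. -/
noncomputable def polyRankinCohen (D : Derivation ℂ (MvPolynomial σ ℂ) (MvPolynomial σ ℂ))
    (k l n : ℕ) (f g : MvPolynomial σ ℂ) : MvPolynomial σ ℂ :=
  ∑ r ∈ range (n + 1),
    ((-1 : ℂ) ^ r * ((k + n - 1).choose (n - r) : ℂ) * ((l + n - 1).choose r : ℂ)) •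
      (D^[r] f * D^[n - r] g)

/-- Polynomials in the variables of `σ` and two further variables `u` and `t`. -/
abbrev LiftRing (σ : Type*) := MvPolynomial (σ ⊕ Fin 2) ℂ

/-- The variable `u`, which keeps track of the weight. -/
noncomputable def liftU : LiftRing σ := X (.inr 0)

/-- The variable `t`, a formal time for the derivation `D`. -/
noncomputable def liftT : LiftRing σ := X (.inr 1)

/-- The inclusion of the polynomials in the variables of `σ`. -/
noncomputable def liftIncl : MvPolynomial σ ℂ →ₐ[ℂ] LiftRing σ := rename .inl

/-- The homomorphism `f ↦ u ^ k * f` for `f` of weight `k`. -/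
noncomputable def liftWt (w : σ → ℕ) : MvPolynomial σ ℂ →ₐ[ℂ] LiftRing σ :=
  aeval fun i => liftU ^ w i * liftIncl (X i)

/-- The specialization `u = 1`, `t = 0`. -/
noncomputable def liftSpec : LiftRing σ →ₐ[ℂ] MvPolynomial σ ℂ :=
  aeval (Sum.elim X ![1, 0])

/-- The specialization `t = 0`. -/
noncomputable def liftZero : LiftRing σ →ₐ[ℂ] LiftRing σ :=
  aeval (Sum.elim (fun i => liftIncl (X i)) ![liftU, 0])

theorem liftSpec_liftIncl (f : MvPolynomial σ ℂ) : liftSpec (liftIncl f) = f := by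
  have : (liftSpec (σ := σ)).comp liftIncl = AlgHom.id ℂ _ := by
    ext i : 1
    simp [liftSpec, liftIncl]
  exact DFunLike.congr_fun this f

theorem liftSpec_liftU : liftSpec (σ := σ) liftU = 1 := by simp [liftSpec, liftU]

theorem liftZero_liftIncl (f : MvPolynomial σ ℂ) : liftZero (liftIncl f) = liftIncl f := by
  have : (liftZero (σ := σ)).comp liftIncl = liftIncl := by
    ext i : 1
    simp [liftZero, liftIncl]
  exact DFunLike.congr_fun this f

theorem liftZero_liftU : liftZero (σ := σ) liftU = liftU := by simp [liftZero, liftU]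

theorem liftZero_liftT : liftZero (σ := σ) liftT = 0 := by simp [liftZero, liftT]

theorem liftSpec_liftWt (w : σ → ℕ) (f : MvPolynomial σ ℂ) : liftSpec (liftWt w f) = f := by
  have : (liftSpec (σ := σ)).comp (liftWt w) = AlgHom.id ℂ _ := by
    ext i : 1
    simp [liftWt, liftSpec_liftIncl, liftSpec_liftU]
  exact DFunLike.congr_fun this f

theorem liftWt_of_isWeightedHomogeneous {w : σ → ℕ} {k : ℕ} {f : MvPolynomial σ ℂ}
    (hf : IsWeightedHomogeneous w f k) : liftWt w f = liftU ^ k * liftIncl f := by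
  induction hf using IsWeightedHomogeneous.induction_on with
  | zero => simp
  | add p q _ _ hp hq => rw [map_add, map_add, hp, hq, mul_add]
  | monomial d r hr =>
    rw [← hr, liftWt, aeval_monomial, liftIncl, rename_monomial]
    simp only [mul_pow, Finsupp.prod_mul, ← pow_mul, Finsupp.weight_apply, smul_eq_mul]
    rw [monomial_eq (s := Finsupp.mapDomain _ d), Finsupp.prod_mapDomain_index_inj Sum.inl_injective]
    simp only [rename_X, Finsupp.prod, Finsupp.sum, ← prod_pow_eq_pow_sum, mul_comm (w _),
      algebraMap_eq]
    ring

/-- A polynomial killed by a partial derivative does not involve that variable. -/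
theorem notMem_vars_of_pderiv_eq_zero {i : σ} {f : MvPolynomial σ ℂ} (h : pderiv i f = 0) :
    i ∉ f.vars := by
  intro hi
  obtain ⟨d, hd, hid⟩ := (mem_vars_iff_mem_support i).1 hi
  have hc := coeff_pderiv (i := i) f (d - Finsupp.single i 1)
  have hd1 : d - Finsupp.single i 1 + Finsupp.single i 1 = d :=
    tsub_add_cancel_of_le (Finsupp.single_le_iff.2
      (Nat.one_le_iff_ne_zero.2 (Finsupp.mem_support_iff.1 hid)))
  rw [h, hd1, coeff_zero, zero_eq_mul] at hc
  refine hc.elim (MvPolynomial.mem_support_iff.1 hd) fun h0 => ?_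
  exact Nat.cast_add_one_ne_zero _ h0

variable (D : Derivation ℂ (MvPolynomial σ ℂ) (MvPolynomial σ ℂ))

/-- The derivation `u D`, where `D t = 1`. -/
noncomputable def liftX : Derivation ℂ (LiftRing σ) (LiftRing σ) :=
  mkDerivation ℂ (Sum.elim (fun i => liftU * liftIncl (D (X i))) ![0, liftU])

/-- The derivation `- u ^ 2 ∂_u - u t D`, where `D t = 1`. -/
noncomputable def liftY : Derivation ℂ (LiftRing σ) (LiftRing σ) :=
  mkDerivation ℂ (Sum.elim (fun i => -(liftU * liftT * liftIncl (D (X i))))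
    ![-liftU ^ 2, -(liftU * liftT)])

theorem liftX_liftU : liftX D liftU = 0 := by simp [liftX, liftU]
theorem liftX_liftT : liftX D liftT = liftU := by simp [liftX, liftT]
theorem liftY_liftU : liftY D liftU = -liftU ^ 2 := by simp [liftY, liftU]
theorem liftY_liftT : liftY D liftT = -(liftU * liftT) := by simp [liftY, liftT]

theorem liftX_liftIncl (f : MvPolynomial σ ℂ) : liftX D (liftIncl f) = liftU * liftIncl (D f) := by
  induction f using MvPolynomial.induction_on with
  | C a => simp [liftIncl]
  | add p q hp hq => simp only [map_add, hp, hq, mul_add]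
  | mul_X p i hp =>
    have : liftX D (liftIncl (X i)) = liftU * liftIncl (D (X i)) := by simp [liftX, liftIncl]
    simp only [map_mul, Derivation.leibniz, smul_eq_mul, map_add, hp, this]
    ring

theorem liftY_liftIncl (f : MvPolynomial σ ℂ) :
    liftY D (liftIncl f) = -(liftU * liftT * liftIncl (D f)) := by
  induction f using MvPolynomial.induction_on with
  | C a => simp [liftIncl]
  | add p q hp hq => simp only [map_add, hp, hq, mul_add, neg_add]
  | mul_X p i hp =>
    have : liftY D (liftIncl (X i)) = -(liftU * liftT * liftIncl (D (X i))) := by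
      simp [liftY, liftIncl]
    simp only [map_mul, Derivation.leibniz, smul_eq_mul, map_add, hp, this]
    ring

/-- Two derivations of the lifted ring agree if they do on `liftIncl f`, `u` and `t`. -/
theorem lift_derivation_ext {Z Z' : Derivation ℂ (LiftRing σ) (LiftRing σ)}
    (h : ∀ f, Z (liftIncl f) = Z' (liftIncl f)) (hu : Z liftU = Z' liftU)
    (ht : Z liftT = Z' liftT) : Z = Z' := by
  refine MvPolynomial.derivation_ext fun i => ?_
  rcases i with i | i
  · simpa [liftIncl] using h (X i)
  · fin_cases i
    · exact hu
    · exact ht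

/-- The term `- u t D` of `liftY` serves this purpose: `[u D, - u ^ 2 ∂_u] = u ^ 2 D`, while `[u D,
- u t D] = - u ^ 2 D` because `D t = 1`. -/
theorem liftX_liftY_comm (F : LiftRing σ) : liftX D (liftY D F) = liftY D (liftX D F) := by
  have : ⁅liftX D, liftY D⁆ = 0 := by
    refine lift_derivation_ext (fun f => ?_) ?_ ?_ <;>
    simp only [Derivation.commutator_apply, liftX_liftIncl, liftY_liftIncl, liftX_liftU,
      liftY_liftU, liftX_liftT, liftY_liftT, map_neg, Derivation.leibniz, Derivation.leibniz_pow,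
      smul_eq_mul, map_zero, Derivation.coe_zero, Pi.zero_apply, nsmul_eq_mul] <;>
    ring
  exact sub_eq_zero.1 (by simpa [Derivation.commutator_apply] using DFunLike.congr_fun this F)

theorem pderiv_liftIncl (f : MvPolynomial σ ℂ) : pderiv (.inr (1 : Fin 2)) (liftIncl f) = 0 := by
  refine pderiv_eq_zero_of_notMem_vars fun h => ?_
  obtain ⟨i, -, hi⟩ := mem_vars_rename _ _ h
  cases hi

theorem pderiv_liftU : pderiv (.inr 1) (liftU (σ := σ)) = 0 := pderiv_X_of_ne (by simp)

theorem pderiv_liftT : pderiv (.inr 1) (liftT (σ := σ)) = 1 := pderiv_X_self _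

theorem pderiv_liftX_comm (F : LiftRing σ) :
    pderiv (.inr 1) (liftX D F) = liftX D (pderiv (.inr 1) F) := by
  have : ⁅pderiv (R := ℂ) (Sum.inr (1 : Fin 2) : σ ⊕ Fin 2), liftX D⁆ = 0 := by
    refine lift_derivation_ext (fun f => ?_) ?_ ?_ <;>
    simp [Derivation.commutator_apply, liftX_liftIncl, liftX_liftU, liftX_liftT,
      Derivation.leibniz, pderiv_liftIncl, pderiv_liftU, pderiv_liftT]
  exact sub_eq_zero.1 (by simpa [Derivation.commutator_apply] using DFunLike.congr_fun this F)

/-- The coefficients of `Y` depend on `t` only through `- u t D`, so `[∂_t, Y] = -X`. This defect is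
harmless because the Poisson operator is antisymmetric in `X` and `Y`. -/
theorem pderiv_liftY (F : LiftRing σ) :
    pderiv (.inr 1) (liftY D F) = liftY D (pderiv (.inr 1) F) - liftX D F := by
  have : ⁅pderiv (R := ℂ) (Sum.inr (1 : Fin 2) : σ ⊕ Fin 2), liftY D⁆ = -liftX D := by
    refine lift_derivation_ext (fun f => ?_) ?_ ?_ <;>
    simp [Derivation.commutator_apply, liftX_liftIncl, liftX_liftU, liftX_liftT, liftY_liftIncl,
      liftY_liftU, liftY_liftT, Derivation.leibniz, Derivation.leibniz_pow,
      pderiv_liftIncl, pderiv_liftU, pderiv_liftT,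
      mul_comm (liftIncl _) liftU]
  have h := DFunLike.congr_fun this F
  rw [Derivation.commutator_apply, Derivation.neg_apply] at h
  linear_combination h

/-- `∂_t` annihilates the Moyal brackets of functions that it annihilates. -/
theorem pderiv_moyal_lift (n : ℕ) {F G : LiftRing σ} (hF : pderiv (.inr 1) F = 0)
    (hG : pderiv (.inr 1) G = 0) : pderiv (.inr 1) (moyal (liftX D) (liftY D) n F G) = 0 := by
  open TensorProduct in
  set T : Module.End ℂ (LiftRing σ) := (pderiv (R := ℂ) (Sum.inr (1 : Fin 2))).toLinearMap with hT
  set T₂ : Module.End ℂ (LiftRing σ ⊗[ℂ] LiftRing σ) :=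
    TensorProduct.map T .id + TensorProduct.map .id T with hT₂
  have h1 : T ∘ₗ LinearMap.mul' ℂ (LiftRing σ) = LinearMap.mul' ℂ _ ∘ₗ T₂ := by
    refine TensorProduct.ext' fun F G => ?_
    simp [hT, hT₂, Derivation.leibniz]
    ring
  have hX : ∀ F, T (liftX D F) = liftX D (T F) := pderiv_liftX_comm D
  have hY : ∀ F, T (liftY D F) = liftY D (T F) - liftX D F := pderiv_liftY D
  -- The defects `-X` of `Y` contribute `- X ⊗ X` and `+ X ⊗ X`, which cancel.
  have h2 : Commute T₂ (poissonOp (liftX D) (liftY D)) := by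
    refine TensorProduct.ext' fun F G => ?_
    simp only [Module.End.mul_apply, poissonOp_tmul, map_sub, hT₂, LinearMap.add_apply,
      TensorProduct.map_tmul, LinearMap.id_apply, hX, hY, map_add, TensorProduct.sub_tmul,
      TensorProduct.tmul_sub]
    abel
  have h3 := h2.pow_right n
  have h4 : T₂ (F ⊗ₜ G) = 0 := by
    have hF' : T F = 0 := hF
    have hG' : T G = 0 := hG
    simp [hT₂, hF', hG']
  have h5 := LinearMap.congr_fun h1 ((poissonOp (liftX D) (liftY D) ^ n) (F ⊗ₜ G))
  have h6 := LinearMap.congr_fun h3 (F ⊗ₜ G)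
  rw [Module.End.mul_apply, Module.End.mul_apply, h4, map_zero] at h6
  rw [LinearMap.comp_apply, LinearMap.comp_apply, h6, map_zero] at h5
  rw [moyal_apply, Derivation.map_smul]
  exact (congrArg _ h5).trans (smul_zero _)

theorem liftZero_eq_self {F : LiftRing σ} (hF : pderiv (.inr 1) F = 0) : liftZero F = F := by
  have h := notMem_vars_of_pderiv_eq_zero hF
  refine hom_congr_vars (f₁ := (liftZero : LiftRing σ →ₐ[ℂ] LiftRing σ).toRingHom)
    (f₂ := RingHom.id _) (by ext; simp [liftZero]) (fun i hi _ => ?_) rfl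
  rcases i with i | i
  · simp [liftZero, liftIncl]
  · fin_cases i
    · exact liftZero_liftU
    · exact absurd hi h

theorem liftX_iterate (m a : ℕ) (f : MvPolynomial σ ℂ) :
    (liftX D)^[a] (liftU ^ m * liftIncl f) = liftU ^ (m + a) * liftIncl (D^[a] f) := by
  induction a generalizing m f with
  | zero => simp
  | succ a ih =>
    have : liftX D (liftU ^ m * liftIncl f) = liftU ^ (m + 1) * liftIncl (D f) := by
      simp only [Derivation.leibniz, Derivation.leibniz_pow, liftX_liftU, liftX_liftIncl,
        smul_eq_mul, smul_zero, mul_zero, add_zero]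
      ring
    rw [Function.iterate_succ_apply, this, ih, Function.iterate_succ_apply, add_right_comm,
      add_assoc]

/-- `Y t = - u t`, so `Y` preserves the ideal generated by `t` and one may reduce modulo `t` before
applying it. -/
theorem liftZero_liftY (F : LiftRing σ) :
    liftZero (liftY D F) = liftZero (liftY D (liftZero F)) := by
  induction F using MvPolynomial.induction_on with
  | C a => simp [liftZero]
  | add p q hp hq => simp only [map_add, hp, hq]
  | mul_X p i hp =>
    have hX : liftZero (liftY D (X i)) = liftZero (liftY D (liftZero (X i))) := by
      rcases i with i | i
      · have : liftZero (X (.inl i)) = (X (.inl i) : LiftRing σ) := by simp [liftZero, liftIncl]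
        rw [this]
      · fin_cases i
        · exact congrArg (fun z => liftZero (liftY D z)) liftZero_liftU.symm
        · change liftZero (liftY D liftT) = liftZero (liftY D (liftZero liftT))
          rw [liftZero_liftT, liftY_liftT]
          simp [liftZero_liftT]
    have hidem : ∀ F : LiftRing σ, liftZero (liftZero F) = liftZero F := by
      intro F
      have : (liftZero (σ := σ)).comp liftZero = liftZero := by
        ext i : 1
        rcases i with i | i
        · simp [liftZero, liftIncl]
        · fin_cases i <;> simp [liftZero, liftU]
      exact DFunLike.congr_fun this F
    simp only [map_mul, Derivation.leibniz, smul_eq_mul, map_add, hp, hX, hidem]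

/-- Modulo `t`, `Y` acts as `- u ^ 2 ∂_u`. The product `m (m + 1) ⋯ (m + b - 1)` that arises is `b!`
times the binomial; this is where the Rankin–Cohen coefficients come from. -/
theorem liftZero_liftY_iterate (m b : ℕ) (f : MvPolynomial σ ℂ) :
    liftZero ((liftY D)^[b] (liftU ^ m * liftIncl f)) =
      ((-1 : ℂ) ^ b * (b.factorial : ℂ) * ((m + b - 1).choose b : ℂ)) •
        (liftU ^ (m + b) * liftIncl f) := by
  induction b with
  | zero => simp [liftZero_liftU, liftZero_liftIncl]
  | succ b ih =>
    rw [Function.iterate_succ_apply', liftZero_liftY, ih, Derivation.map_smul, map_smul]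
    have : liftZero (liftY D (liftU ^ (m + b) * liftIncl f)) =
        (-((m + b : ℕ) : ℂ)) • (liftU ^ (m + (b + 1)) * liftIncl f) := by
      simp only [Derivation.leibniz, Derivation.leibniz_pow, liftY_liftU, liftY_liftIncl,
        smul_eq_mul, map_add, map_mul, map_neg, liftZero_liftT, liftZero_liftU, liftZero_liftIncl,
        map_pow, nsmul_eq_mul, map_natCast]
      rcases Nat.eq_zero_or_pos (m + b) with h0 | h0
      · simp [h0]
      · obtain ⟨j, hj⟩ := Nat.exists_eq_add_of_le' h0
        rw [← add_assoc, hj, Algebra.smul_def]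
        simp
        ring
    rw [this, smul_smul]
    congr 1
    have hch : ((m + b - 1).choose b : ℂ) * ((m + b : ℕ) : ℂ) =
        ((b + 1 : ℕ) : ℂ) * ((m + (b + 1) - 1).choose (b + 1) : ℂ) := by
      norm_cast
      -- For `m = b = 0` the subtraction is truncated, and both sides vanish.
      rcases Nat.eq_zero_or_pos (m + b) with h0 | h0
      · have : m = 0 := by omega
        have : b = 0 := by omega
        subst_vars
        simp
      · obtain ⟨j, hj⟩ := Nat.exists_eq_add_of_le' h0
        have := Nat.add_one_mul_choose_eq j b
        rw [← add_assoc, hj]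
        simp only [Nat.add_sub_cancel]
        rw [mul_comm, this, mul_comm]
    rw [Nat.factorial_succ, pow_succ]
    push_cast at hch ⊢
    linear_combination (-(-1 : ℂ) ^ b * (b.factorial : ℂ)) * hch

/-- On lifts of weighted homogeneous polynomials, the Moyal brackets are the
Rankin–Cohen brackets. -/
theorem moyal_lift_eq {k l n : ℕ} (f g : MvPolynomial σ ℂ) :
    moyal (liftX D) (liftY D) n (liftU ^ k * liftIncl f) (liftU ^ l * liftIncl g) =
      liftU ^ (k + l + 2 * n) * liftIncl (polyRankinCohen D k l n f g) := by
  have h0 : ∀ (k : ℕ) (f : MvPolynomial σ ℂ),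
      pderiv (.inr (1 : Fin 2)) (liftU ^ k * liftIncl f) = 0 := fun k f => by
    simp [Derivation.leibniz, Derivation.leibniz_pow, pderiv_liftU, pderiv_liftIncl]
  -- The bracket does not involve `t`, so its value at `t = 0` determines it.
  rw [← liftZero_eq_self (pderiv_moyal_lift D n (h0 k f) (h0 l g)),
    moyal_eq_sum (liftX_liftY_comm D), polyRankinCohen, map_sum, map_sum, mul_sum]
  refine sum_congr rfl fun r hr => ?_
  obtain ⟨s, rfl⟩ := Nat.exists_eq_add_of_le (Nat.lt_succ_iff.1 (mem_range.1 hr))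
  rw [map_smul, map_mul, liftX_iterate, liftX_iterate, liftZero_liftY_iterate,
    liftZero_liftY_iterate]
  simp only [Nat.add_sub_cancel_left, map_smul, map_mul, smul_mul_assoc, smul_smul,
    mul_smul_comm]
  have hr0 : (r.factorial : ℂ) ≠ 0 := mod_cast Nat.factorial_ne_zero r
  have hs0 : (s.factorial : ℂ) ≠ 0 := mod_cast Nat.factorial_ne_zero s
  congr 1
  · rw [show l + s + r = l + (r + s) by ring, show k + r + s = k + (r + s) by ring]
    -- With `n = r + s`, the sign `(-1) ^ s` of the Moyal sum cancels that of `Y ^ s`; the sign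
    -- `(-1) ^ r` of `Y ^ r` remains.
    have h1 : ((-1 : ℂ) ^ s) * (-1) ^ s = 1 := by rw [← mul_pow]; simp
    field_simp
    linear_combination (((k + (r + s) - 1).choose s : ℂ) * ((l + (r + s) - 1).choose r : ℂ)) * h1
  · ring

end Lift

/-! ### Brackets on weighted polynomial rings, and independence of a variable. -/

section PolyBracket

open MvPolynomial Finset

variable {σ : Type*} (w : σ → ℕ) (D : Derivation ℂ (MvPolynomial σ ℂ) (MvPolynomial σ ℂ))

/-- The bilinear extension of the Rankin–Cohen brackets to all polynomials. -/
noncomputable def polyBracket (n : ℕ) :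
    MvPolynomial σ ℂ →ₗ[ℂ] MvPolynomial σ ℂ →ₗ[ℂ] MvPolynomial σ ℂ :=
  ((moyal (liftX D) (liftY D) n).compl₁₂ (liftWt w).toLinearMap (liftWt w).toLinearMap).compr₂
    liftSpec.toLinearMap

theorem polyBracket_apply (n : ℕ) (f g : MvPolynomial σ ℂ) : polyBracket w D n f g =
    liftSpec (moyal (liftX D) (liftY D) n (liftWt w f) (liftWt w g)) := rfl

variable {w D}

theorem polyBracket_eq {k l n : ℕ} {f g : MvPolynomial σ ℂ} (hf : IsWeightedHomogeneous w f k)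
    (hg : IsWeightedHomogeneous w g l) : polyBracket w D n f g = polyRankinCohen D k l n f g := by
  rw [polyBracket_apply, liftWt_of_isWeightedHomogeneous hf, liftWt_of_isWeightedHomogeneous hg,
    moyal_lift_eq]
  simp [liftSpec_liftU, liftSpec_liftIncl]

theorem isWeightedHomogeneous_derivation (hD : ∀ i, IsWeightedHomogeneous w (D (X i)) (w i + 2))
    {k : ℕ} {f : MvPolynomial σ ℂ} (hf : IsWeightedHomogeneous w f k) :
    IsWeightedHomogeneous w (D f) (k + 2) := by
  induction hf using IsWeightedHomogeneous.induction_on with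
  | zero => simpa using isWeightedHomogeneous_zero ℂ w (k + 2)
  | add p q _ _ hp hq => simpa using hp.add hq
  | monomial d r hr =>
    have hDe : D = mkDerivation ℂ fun i => D (X i) := by
      refine MvPolynomial.derivation_ext fun i => ?_
      rw [mkDerivation_X]
    rw [hDe, mkDerivation_monomial, smul_eq_C_mul]
    refine IsWeightedHomogeneous.C_mul (IsWeightedHomogeneous.sum _ _ _ fun i hi => ?_) _
    have h1 : Finsupp.weight w (d - Finsupp.single i 1) + w i = k := by
      have hd1 : d - Finsupp.single i 1 + Finsupp.single i 1 = d :=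
        tsub_add_cancel_of_le (Finsupp.single_le_iff.2
          (Nat.one_le_iff_ne_zero.2 (Finsupp.mem_support_iff.1 hi)))
      rw [← hr]
      conv_rhs => rw [← hd1]
      simp [Finsupp.weight_single]
    rw [← h1, add_assoc]
    exact (isWeightedHomogeneous_monomial w _ _ rfl).mul (hD i)

theorem isWeightedHomogeneous_derivation_iterate
    (hD : ∀ i, IsWeightedHomogeneous w (D (X i)) (w i + 2))
    {k : ℕ} {f : MvPolynomial σ ℂ} (hf : IsWeightedHomogeneous w f k) (r : ℕ) :
    IsWeightedHomogeneous w (D^[r] f) (k + 2 * r) := by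
  induction r with
  | zero => exact hf
  | succ r ih =>
    rw [Function.iterate_succ_apply']
    exact isWeightedHomogeneous_derivation hD ih

theorem isWeightedHomogeneous_polyRankinCohen
    (hD : ∀ i, IsWeightedHomogeneous w (D (X i)) (w i + 2)) {k l : ℕ} (n : ℕ)
    {f g : MvPolynomial σ ℂ} (hf : IsWeightedHomogeneous w f k)
    (hg : IsWeightedHomogeneous w g l) :
    IsWeightedHomogeneous w (polyRankinCohen D k l n f g) (k + l + 2 * n) := by
  refine IsWeightedHomogeneous.sum _ _ _ fun r hr => ?_
  rw [smul_eq_C_mul]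
  refine IsWeightedHomogeneous.C_mul ?_ _
  have h := (isWeightedHomogeneous_derivation_iterate hD hf r).mul
    (isWeightedHomogeneous_derivation_iterate hD hg (n - r))
  convert h using 1
  have := mem_range.1 hr
  omega

/-- On homogeneous elements the bracket has weight `k + l + 2 n`, exactly the power of `u` in the
Moyal bracket of the lifts. So brackets may be iterated after lifting, and associativity transfers.
-/
theorem liftWt_polyBracket (hD : ∀ i, IsWeightedHomogeneous w (D (X i)) (w i + 2)) (n : ℕ)
    (f g : MvPolynomial σ ℂ) : liftWt w (polyBracket w D n f g) =
      moyal (liftX D) (liftY D) n (liftWt w f) (liftWt w g) := by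
  induction f using MvPolynomial.induction_on' with
  | add p q hp hq => simp only [map_add, LinearMap.add_apply, hp, hq]
  | monomial d a =>
    induction g using MvPolynomial.induction_on' with
    | add p q hp hq => simp only [map_add, hp, hq]
    | monomial e b =>
      have hf := isWeightedHomogeneous_monomial w d a rfl
      have hg := isWeightedHomogeneous_monomial w e b rfl
      rw [polyBracket_eq hf hg, liftWt_of_isWeightedHomogeneous hf,
        liftWt_of_isWeightedHomogeneous hg, moyal_lift_eq,
        liftWt_of_isWeightedHomogeneous (isWeightedHomogeneous_polyRankinCohen hD n hf hg)]

/-- The Rankin–Cohen brackets of polynomials define an associative star product. -/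
theorem polyBracket_assoc (hD : ∀ i, IsWeightedHomogeneous w (D (X i)) (w i + 2)) (n : ℕ)
    (f g h : MvPolynomial σ ℂ) :
    ∑ p ∈ antidiagonal n, polyBracket w D p.1 (polyBracket w D p.2 f g) h =
      ∑ p ∈ antidiagonal n, polyBracket w D p.1 f (polyBracket w D p.2 g h) := by
  have h := moyal_assoc (liftX_liftY_comm D) n (liftWt w f) (liftWt w g) (liftWt w h)
  simp only [← liftWt_polyBracket hD, ← map_sum] at h
  simpa only [liftSpec_liftWt] using congrArg liftSpec h

theorem polyBracket_zero (f g : MvPolynomial σ ℂ) : polyBracket w D 0 f g = f * g := by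
  have h : moyal (liftX D) (liftY D) 0 (liftWt w f) (liftWt w g) = liftWt w (f * g) := by
    rw [moyal_eq_sum (liftX_liftY_comm D)]
    simp
  rw [polyBracket_apply, h, liftSpec_liftWt]

/-- The Euler derivation, which multiplies polynomials of weight `k` by `k`. -/
noncomputable def eulerDerivation (w : σ → ℕ) :
    Derivation ℂ (MvPolynomial σ ℂ) (MvPolynomial σ ℂ) :=
  mkDerivation ℂ fun i => (w i : ℂ) • X i

theorem eulerDerivation_apply {k : ℕ} {f : MvPolynomial σ ℂ}
    (hf : IsWeightedHomogeneous w f k) : eulerDerivation w f = (k : ℂ) • f := by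
  induction hf using IsWeightedHomogeneous.induction_on with
  | zero => simp
  | add p q _ _ hp hq => rw [map_add, hp, hq, smul_add]
  | monomial d r hr =>
    rw [eulerDerivation, mkDerivation_monomial, ← hr, Finsupp.weight_apply, Finsupp.sum,
      Finsupp.sum, Nat.cast_sum, sum_smul, smul_sum]
    refine sum_congr rfl fun i hi => ?_
    have hd1 : d - Finsupp.single i 1 + Finsupp.single i 1 = d :=
      tsub_add_cancel_of_le (Finsupp.single_le_iff.2
        (Nat.one_le_iff_ne_zero.2 (Finsupp.mem_support_iff.1 hi)))
    rw [smul_eq_mul, mul_smul_comm, X, monomial_mul, hd1, smul_monomial, smul_monomial,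
      smul_monomial]
    congr 1
    simp only [smul_eq_mul]
    push_cast
    ring

variable {i : σ}

/-- Moving the partial derivative past each `D` produces the weight of the current iterate; the
factor is `k + (k + 2) + ⋯ + (k + 2 r)`. -/
theorem pderiv_derivation_iterate (hD : ∀ i, IsWeightedHomogeneous w (D (X i)) (w i + 2))
    (hi : ⁅pderiv (R := ℂ) i, D⁆ = eulerDerivation w) {k : ℕ} {f : MvPolynomial σ ℂ}
    (hf : IsWeightedHomogeneous w f k) (h0 : pderiv i f = 0) (r : ℕ) :
    pderiv i (D^[r + 1] f) = ((r + 1) * (r + k) : ℂ) • D^[r] f := by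
  have hc : ∀ {k : ℕ} {f : MvPolynomial σ ℂ}, IsWeightedHomogeneous w f k →
      pderiv i (D f) = D (pderiv i f) + (k : ℂ) • f := by
    intro k f hf
    have := DFunLike.congr_fun hi f
    rw [eulerDerivation_apply hf, Derivation.commutator_apply] at this
    rw [← this]
    ring
  induction r with
  | zero => simp [hc hf, h0]
  | succ r ih =>
    rw [Function.iterate_succ_apply', hc (isWeightedHomogeneous_derivation_iterate hD hf (r + 1)),
      ih, Derivation.map_smul, ← Function.iterate_succ_apply' D, ← add_smul]
    congr 1
    push_cast
    ring

/-- The Rankin–Cohen brackets do not involve the variable `i` if their arguments do not. -/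
theorem pderiv_polyRankinCohen (hD : ∀ i, IsWeightedHomogeneous w (D (X i)) (w i + 2))
    (hi : ⁅pderiv (R := ℂ) i, D⁆ = eulerDerivation w) {k l : ℕ} (n : ℕ) {f g : MvPolynomial σ ℂ}
    (hf : IsWeightedHomogeneous w f k) (hg : IsWeightedHomogeneous w g l)
    (hf0 : pderiv i f = 0) (hg0 : pderiv i g = 0) :
    pderiv i (polyRankinCohen D k l n f g) = 0 := by
  cases n with
  | zero => simp [polyRankinCohen, Derivation.leibniz, hf0, hg0]
  | succ N =>
    simp only [polyRankinCohen, map_sum, Derivation.map_smul, Derivation.leibniz, smul_eq_mul,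
      smul_add, sum_add_distrib]
    -- The end terms vanish because `f` and `g` do not involve the variable. What is left of index
    -- `r` where `g` is differentiated and of index `r + 1` where `f` is differentiated are
    -- multiples of the same product `D^r f * D^(N - r) g`, and cancel.
    rw [sum_range_succ, sum_range_succ' (n := N + 1)]
    simp only [Nat.sub_self, Function.iterate_zero_apply, hf0, hg0, mul_zero, smul_zero, add_zero]
    rw [← sum_add_distrib]
    refine sum_eq_zero fun r hr => ?_
    obtain ⟨s, rfl⟩ := Nat.exists_eq_add_of_le (Nat.lt_succ_iff.1 (mem_range.1 hr))
    rw [show r + s + 1 - r = s + 1 by omega, show r + s + 1 - (r + 1) = s by omega,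
      pderiv_derivation_iterate hD hi hf hf0, pderiv_derivation_iterate hD hi hg hg0,
      mul_smul_comm, mul_smul_comm, smul_smul, smul_smul, mul_comm (D^[s] g), ← add_smul]
    refine smul_eq_zero_of_left ?_ _
    have h1 : ((l + (r + s)).choose (r + 1) : ℂ) * (r + 1) = (l + (r + s)).choose r * (l + s) := by
      have := Nat.choose_succ_right_eq (l + (r + s)) r
      rw [show l + (r + s) - r = l + s by omega] at this
      exact_mod_cast this
    have h2 : ((k + (r + s)).choose (s + 1) : ℂ) * (s + 1) = (k + (r + s)).choose s * (k + r) := by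
      have := Nat.choose_succ_right_eq (k + (r + s)) s
      rw [show k + (r + s) - s = k + r by omega] at this
      exact_mod_cast this
    rw [show k + (r + s + 1) - 1 = k + (r + s) by omega,
      show l + (r + s + 1) - 1 = l + (r + s) by omega, pow_succ]
    linear_combination (-1 : ℂ) ^ r * ((l + (r + s)).choose r : ℂ) * (s + l) * h2 -
      (-1 : ℂ) ^ r * ((k + (r + s)).choose s : ℂ) * (r + k) * h1

end PolyBracket

/-! ### Associativity on power series from associativity in each order. -/

section Deformation

open Finset

variable {A : Type*} [CommRing A] [Algebra ℂ A]

theorem coeff_starProduct (μ : ℕ → A →ₗ[ℂ] A →ₗ[ℂ] A) (F G : PowerSeries A) (n : ℕ) :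
    PowerSeries.coeff n (starProduct μ F G) =
      ∑ p ∈ antidiagonal n, ∑ q ∈ antidiagonal p.2,
        μ p.1 (PowerSeries.coeff q.1 F) (PowerSeries.coeff q.2 G) := by
  rw [starProduct, PowerSeries.coeff_mk]

/-- A sequence of bilinear maps is a formal deformation if its associativity relations hold. -/
theorem isFormalDeformation_of_sum_eq {μ : ℕ → A →ₗ[ℂ] A →ₗ[ℂ] A}
    (h0 : ∀ f g : A, μ 0 f g = f * g)
    (h : ∀ (n : ℕ) (f g h : A), ∑ p ∈ antidiagonal n, μ p.1 (μ p.2 f g) h =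
      ∑ p ∈ antidiagonal n, μ p.1 f (μ p.2 g h)) : IsFormalDeformation μ := by
  refine ⟨h0, fun F G H => PowerSeries.ext fun n => ?_⟩
  -- The reindexing collects the orders of the inner and outer bracket into `p.1` and the degrees of
  -- the three coefficients into `p.2`; for fixed coefficients the sum over `s` is then the
  -- hypothesis.
  trans ∑ p ∈ antidiagonal n, ∑ q ∈ antidiagonal p.2, ∑ r ∈ antidiagonal q.2,
      ∑ s ∈ antidiagonal p.1, μ s.1 (μ s.2 (PowerSeries.coeff q.1 F) (PowerSeries.coeff r.1 G))
        (PowerSeries.coeff r.2 H)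
  · simp only [coeff_starProduct, map_sum, LinearMap.sum_apply]
    simp only [Finset.sum_sigma']
    refine sum_nbij'
      (fun ⟨⟨m, _⟩, ⟨_, c⟩, ⟨m', _⟩, ⟨a, b⟩⟩ =>
        ⟨(m + m', a + (b + c)), (a, b + c), (b, c), (m, m')⟩)
      (fun ⟨_, ⟨a, _⟩, ⟨b, c⟩, ⟨m, m'⟩⟩ =>
        ⟨(m, m' + (a + b) + c), (m' + (a + b), c), (m', a + b), (a, b)⟩) ?_ ?_ ?_ ?_ ?_
    all_goals rintro ⟨⟨_, _⟩, ⟨_, _⟩, ⟨_, _⟩, ⟨_, _⟩⟩ hx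
    · simp only [mem_sigma, HasAntidiagonal.mem_antidiagonal] at hx ⊢
      obtain ⟨rfl, rfl, rfl, rfl⟩ := hx
      refine ⟨?_, ?_, ?_, ?_⟩ <;> first | trivial | ring
    · simp only [mem_sigma, HasAntidiagonal.mem_antidiagonal] at hx ⊢
      obtain ⟨rfl, rfl, rfl, rfl⟩ := hx
      refine ⟨?_, ?_, ?_, ?_⟩ <;> first | trivial | ring
    · simp only [mem_sigma, HasAntidiagonal.mem_antidiagonal] at hx
      obtain ⟨rfl, rfl, rfl, rfl⟩ := hx
      rfl
    · simp only [mem_sigma, HasAntidiagonal.mem_antidiagonal] at hx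
      obtain ⟨rfl, rfl, rfl, rfl⟩ := hx
      rfl
    · rfl
  · simp only [h]
    simp only [coeff_starProduct, map_sum]
    simp only [Finset.sum_sigma']
    symm
    refine sum_nbij'
      (fun ⟨⟨m, _⟩, ⟨a, _⟩, ⟨m', _⟩, ⟨b, c⟩⟩ =>
        ⟨(m + m', a + (b + c)), (a, b + c), (b, c), (m, m')⟩)
      (fun ⟨_, ⟨a, _⟩, ⟨b, c⟩, ⟨m, m'⟩⟩ =>
        ⟨(m, a + (m' + (b + c))), (a, m' + (b + c)), (m', b + c), (b, c)⟩) ?_ ?_ ?_ ?_ ?_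
    all_goals rintro ⟨⟨_, _⟩, ⟨_, _⟩, ⟨_, _⟩, ⟨_, _⟩⟩ hx
    · simp only [mem_sigma, HasAntidiagonal.mem_antidiagonal] at hx ⊢
      obtain ⟨rfl, rfl, rfl, rfl⟩ := hx
      refine ⟨?_, ?_, ?_, ?_⟩ <;> first | trivial | ring
    · simp only [mem_sigma, HasAntidiagonal.mem_antidiagonal] at hx ⊢
      obtain ⟨rfl, rfl, rfl, rfl⟩ := hx
      refine ⟨?_, ?_, ?_, ?_⟩ <;> first | trivial | ring
    · simp only [mem_sigma, HasAntidiagonal.mem_antidiagonal] at hx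
      obtain ⟨rfl, rfl, rfl, rfl⟩ := hx
      rfl
    · simp only [mem_sigma, HasAntidiagonal.mem_antidiagonal] at hx
      obtain ⟨rfl, rfl, rfl, rfl⟩ := hx
      rfl
    · rfl

end Deformation

/-! ### Series over `z + n t` and their termwise derivatives. -/

section TermwiseDerivatives

open Filter Topology

/-- Termwise differentiation of a series of holomorphic functions, of which only almost all terms
need to be dominated near the point in question. -/
theorem hasDerivAt_tsum_of_eventually_le {F : ℕ → ℂ → ℂ} {u : ℕ → ℝ} {s₀ : ℂ} (hu : Summable u)
    (N : ℕ) (hlt : ∀ n < N, DifferentiableAt ℂ (F n) s₀)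
    (hge : ∀ᶠ s in 𝓝 s₀, ∀ n ≥ N, DifferentiableAt ℂ (F n) s ∧ ‖F n s‖ ≤ u n) :
    (Summable fun n => F n s₀) ∧ (Summable fun n => deriv (F n) s₀) ∧
      HasDerivAt (fun s => ∑' n, F n s) (∑' n, deriv (F n) s₀) s₀ := by
  obtain ⟨r, hr, hball⟩ := Metric.eventually_nhds_iff_ball.1 hge
  have hu' : Summable fun n => u (n + N) := (summable_nat_add_iff N).2 hu
  have hd : ∀ n, DifferentiableOn ℂ (F (n + N)) (Metric.ball s₀ r) := fun n s hs =>
    (hball s hs (n + N) (Nat.le_add_left _ _)).1.differentiableWithinAt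
  have hle : ∀ (n : ℕ) (s : ℂ), s ∈ Metric.ball s₀ r → ‖F (n + N) s‖ ≤ u (n + N) := fun n s hs =>
    (hball s hs (n + N) (Nat.le_add_left _ _)).2
  have hs₀ : s₀ ∈ Metric.ball s₀ r := Metric.mem_ball_self hr
  have hsum : ∀ s ∈ Metric.ball s₀ r, Summable fun n => F n s := fun s hs =>
    (summable_nat_add_iff N).1 (Summable.of_norm_bounded hu' fun n => hle n s hs)
  have hD := Complex.hasSum_deriv_of_summable_norm hu' hd Metric.isOpen_ball hle hs₀
  have hdiff := (Complex.differentiableOn_tsum_of_summable_norm hu' hd Metric.isOpen_ball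
    hle).differentiableAt (Metric.isOpen_ball.mem_nhds hs₀)
  have hsD : Summable fun n => deriv (F n) s₀ := (summable_nat_add_iff N).1 hD.summable
  refine ⟨hsum s₀ hs₀, hsD, ?_⟩
  have h1 : HasDerivAt (fun s => ∑ n ∈ Finset.range N, F n s + ∑' n, F (n + N) s)
      (∑ n ∈ Finset.range N, deriv (F n) s₀ + ∑' n, deriv (F (n + N)) s₀) s₀ := by
    refine (HasDerivAt.fun_sum fun n hn =>
      (hlt n (Finset.mem_range.1 hn)).hasDerivAt).add ?_
    rw [hD.tsum_eq]
    exact hdiff.hasDerivAt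
  rw [hsD.sum_add_tsum_nat_add N] at h1
  refine h1.congr_of_eventuallyEq ?_
  filter_upwards [Metric.isOpen_ball.mem_nhds hs₀] with s hs
  exact ((hsum s hs).sum_add_tsum_nat_add N).symm

/-- Holomorphic functions on `ℂ ∖ ℤ` that decay exponentially at `i ∞`. -/
def ExpDecay (φ : ℂ → ℂ) : Prop :=
  DifferentiableOn ℂ φ Complex.integerComplement ∧
    ∃ C B : ℝ, ∀ w : ℂ, B ≤ w.im → ‖φ w‖ ≤ C * Real.exp (-w.im)

theorem isOpen_integerComplement : IsOpen Complex.integerComplement :=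
  Complex.isOpen_compl_range_intCast

theorem mem_integerComplement_of_im_ne_zero {w : ℂ} (hw : w.im ≠ 0) :
    w ∈ Complex.integerComplement := by
  rintro ⟨n, rfl⟩
  simp at hw

theorem ExpDecay.differentiableAt {φ : ℂ → ℂ} (h : ExpDecay φ) {w : ℂ}
    (hw : w ∈ Complex.integerComplement) : DifferentiableAt ℂ φ w :=
  h.1.differentiableAt (isOpen_integerComplement.mem_nhds hw)

theorem ExpDecay.deriv {φ : ℂ → ℂ} (h : ExpDecay φ) : ExpDecay (deriv φ) := by
  refine ⟨h.1.deriv isOpen_integerComplement, ?_⟩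
  obtain ⟨C, B, hC⟩ := h.2
  -- Cauchy's estimate on the unit disc around `w`: the imaginary part drops by at most one there,
  -- which costs the factor `exp 1`, and the threshold keeps the disc above height `B` and off the
  -- real axis.
  refine ⟨C * Real.exp 1, max B 1 + 1, fun w hw => ?_⟩
  have him : ∀ v ∈ Metric.closedBall w 1, w.im - 1 ≤ v.im := fun v hv => by
    have h1 := (Complex.abs_im_le_norm (v - w)).trans (mem_closedBall_iff_norm.1 hv)
    rw [Complex.sub_im] at h1
    linarith [(abs_le.1 h1).1]
  have hB := le_max_left B 1
  have h1 := le_max_right B 1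
  have hC0 : 0 ≤ C := by
    have := (norm_nonneg _).trans (hC w (by linarith))
    exact nonneg_of_mul_nonneg_left this (Real.exp_pos _)
  rw [← div_one (C * Real.exp 1 * _)]
  refine Complex.norm_deriv_le_of_forall_mem_sphere_norm_le one_pos ?_ fun v hv => ?_
  · refine DifferentiableOn.diffContOnCl ?_
    rw [closure_ball w one_ne_zero]
    intro v hv
    have := him v hv
    exact (h.differentiableAt (mem_integerComplement_of_im_ne_zero
      (by linarith : v.im > 0).ne')).differentiableWithinAt
  · have := him v (Metric.sphere_subset_closedBall hv)
    refine (hC v (by linarith)).trans ?_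
    rw [mul_assoc, ← Real.exp_add]
    gcongr
    linarith

/-- The series `∑_{n ≥ 1} n ^ a φ(z + n t)`. -/
noncomputable def halfSum (a : ℕ) (φ : ℂ → ℂ) (t z : ℂ) : ℂ :=
  ∑' n : ℕ, ((n : ℂ) + 1) ^ a * φ (z + (n + 1) * t)

/-- The derivative along the complex line through `(t, z)` with direction `(β, α)`; the directions
`(0, 1)` and `(1, 0)` give both partial derivatives. -/
theorem hasDerivAt_halfSum_aux {φ : ℂ → ℂ} (h : ExpDecay φ) (a : ℕ) (α β : ℂ) {t z : ℂ}
    (ht : 0 < t.im) (hz : ∀ n : ℕ, z + (n + 1) * t ∈ Complex.integerComplement) :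
    (Summable fun n : ℕ => ((n : ℂ) + 1) ^ a * φ (z + (n + 1) * t)) ∧
    HasDerivAt (fun s : ℂ => halfSum a φ (t + β * s) (z + α * s))
      (∑' n : ℕ, ((n : ℂ) + 1) ^ a * ((α + (n + 1) * β) * deriv φ (z + (n + 1) * t))) 0 := by
  obtain ⟨C, B, hC⟩ := h.2
  set g : ℕ → ℂ → ℂ := fun n s => (z + α * s) + (n + 1) * (t + β * s) with hg
  have hg' : ∀ n s, HasDerivAt (g n) (α + (n + 1) * β) s := fun n s => by
    have h1 : HasDerivAt (fun s : ℂ => z + α * s) α s := by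
      simpa using ((hasDerivAt_id s).const_mul α).const_add z
    have h2 : HasDerivAt (fun s : ℂ => t + β * s) β s := by
      simpa using ((hasDerivAt_id s).const_mul β).const_add t
    exact h1.add (h2.const_mul _)
  have hg0 : ∀ n, g n 0 = z + (n + 1) * t := fun n => by simp [hg]
  -- the imaginary parts of the arguments grow linearly
  have him : ∀ᶠ s in 𝓝 (0 : ℂ), ∀ n : ℕ, (n + 1) * (t.im / 2) - (‖z‖ + 1) ≤ (g n s).im := by
    have h1 : ∀ᶠ s in 𝓝 (0 : ℂ), t.im / 2 < (t + β * s).im := by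
      refine ContinuousAt.eventually_lt continuousAt_const (by fun_prop) ?_
      simpa using half_lt_self ht
    have h2 : ∀ᶠ s in 𝓝 (0 : ℂ), ‖z + α * s‖ < ‖z‖ + 1 := by
      refine ContinuousAt.eventually_lt (by fun_prop) continuousAt_const ?_
      simp
    filter_upwards [h1, h2] with s hs1 hs2 n
    have h3 := Complex.abs_im_le_norm (z + α * s)
    have h4 := (abs_le.1 h3).1
    have h5 : (g n s).im = (z + α * s).im + (n + 1) * (t + β * s).im := by
      simp only [hg, Complex.add_im, Complex.mul_im, Complex.add_re, Complex.natCast_re,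
        Complex.one_re, Complex.natCast_im, Complex.one_im]
      ring
    rw [h5]
    have h6 : ((n : ℝ) + 1) * (t.im / 2) ≤ (n + 1) * (t + β * s).im := by gcongr
    linarith
  set u : ℕ → ℝ := fun n =>
    ((n : ℝ) + 1) ^ a * (C * Real.exp (-((n + 1) * (t.im / 2) - (‖z‖ + 1)))) with hu_def
  have hu : Summable u := by
    have h1 : Summable fun n : ℕ => (n : ℝ) ^ a * Real.exp (-(t.im / 2) * n) :=
      Real.summable_pow_mul_exp_neg_nat_mul a (by linarith)
    have h2 := ((summable_nat_add_iff 1).2 h1).mul_left (C * Real.exp (‖z‖ + 1))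
    refine h2.congr fun n => ?_
    simp only [hu_def]
    push_cast
    rw [show -(((n : ℝ) + 1) * (t.im / 2) - (‖z‖ + 1)) =
      (‖z‖ + 1) + -(t.im / 2) * (n + 1) by ring, Real.exp_add (‖z‖ + 1)]
    ring
  -- From `N` on, the arguments lie above the poles and in the region where the decay estimate
  -- holds, uniformly near the base point; the earlier terms need only be differentiable there.
  obtain ⟨N, hN⟩ : ∃ N : ℕ, ∀ n ≥ N, max B 1 ≤ (n + 1) * (t.im / 2) - (‖z‖ + 1) := by
    have hlim : Tendsto (fun n : ℕ => ((n : ℝ) + 1) * (t.im / 2) - (‖z‖ + 1)) atTop atTop :=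
      tendsto_atTop_add_const_right _ _ ((tendsto_atTop_add_const_right _ _
        tendsto_natCast_atTop_atTop).atTop_mul_const (half_pos ht))
    exact eventually_atTop.1 (hlim.eventually_ge_atTop (max B 1))
  have hderiv : ∀ n s, g n s ∈ Complex.integerComplement →
      HasDerivAt (fun s => ((n : ℂ) + 1) ^ a * φ (g n s))
        (((n : ℂ) + 1) ^ a * ((α + (n + 1) * β) * deriv φ (g n s))) s := fun n s hs => by
    have h1 := (h.differentiableAt hs).hasDerivAt.comp s (hg' n s)
    rw [mul_comm (deriv φ _)] at h1
    exact h1.const_mul _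
  have key := hasDerivAt_tsum_of_eventually_le (F := fun n s => ((n : ℂ) + 1) ^ a * φ (g n s))
    (s₀ := 0) hu N (fun n _ => (hderiv n 0 (by rw [hg0]; exact hz n)).differentiableAt) ?_
  · refine ⟨by simpa only [hg0] using key.1, ?_⟩
    have hd : ∀ n : ℕ, deriv (fun s => ((n : ℂ) + 1) ^ a * φ (g n s)) 0 =
        ((n : ℂ) + 1) ^ a * ((α + (n + 1) * β) * deriv φ (z + (n + 1) * t)) := fun n => by
      rw [(hderiv n 0 (by rw [hg0]; exact hz n)).deriv, hg0]
    have h2 := key.2.2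
    simp only [hd] at h2
    exact h2
  · filter_upwards [him] with s hs n hn
    have h1 := (hN n hn).trans (hs n)
    have hB := le_max_left B 1
    have h1' := le_max_right B 1
    refine ⟨(hderiv n s (mem_integerComplement_of_im_ne_zero
      (by linarith : (g n s).im > 0).ne')).differentiableAt, ?_⟩
    have hC0 : 0 ≤ C := by
      have := (norm_nonneg _).trans (hC (g n s) (hB.trans h1))
      exact nonneg_of_mul_nonneg_left this (Real.exp_pos _)
    rw [norm_mul, norm_pow]
    have h3 : ‖(n : ℂ) + 1‖ = n + 1 := by
      rw [← Nat.cast_add_one, Complex.norm_natCast, Nat.cast_add_one]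
    rw [h3, hu_def]
    refine mul_le_mul_of_nonneg_left ((hC _ (hB.trans h1)).trans ?_) (by positivity)
    gcongr
    exact hs n

variable {φ : ℂ → ℂ} {t z : ℂ}

theorem summable_halfSum (h : ExpDecay φ) (a : ℕ)
    (ht : 0 < t.im) (hz : ∀ n : ℕ, z + (n + 1) * t ∈ Complex.integerComplement) :
    Summable fun n : ℕ => ((n : ℂ) + 1) ^ a * φ (z + (n + 1) * t) :=
  (hasDerivAt_halfSum_aux h a 0 0 ht hz).1

theorem hasDerivAt_halfSum_right (h : ExpDecay φ) (a : ℕ)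
    (ht : 0 < t.im) (hz : ∀ n : ℕ, z + (n + 1) * t ∈ Complex.integerComplement) :
    HasDerivAt (halfSum a φ t) (halfSum a (deriv φ) t z) z := by
  have h1 := (hasDerivAt_halfSum_aux h a 1 0 ht hz).2
  simp only [zero_mul, mul_zero, add_zero, one_mul] at h1
  have h2 : HasDerivAt (fun s => halfSum a φ t (z + s)) (halfSum a (deriv φ) t z) 0 := h1
  have h3 := HasDerivAt.comp_sub_const z z ((sub_self z).symm ▸ h2)
  exact h3.congr_of_eventuallyEq (.of_forall fun x => by simp only [add_sub_cancel])

theorem hasDerivAt_halfSum_left (h : ExpDecay φ) (a : ℕ)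
    (ht : 0 < t.im) (hz : ∀ n : ℕ, z + (n + 1) * t ∈ Complex.integerComplement) :
    HasDerivAt (fun t => halfSum a φ t z) (halfSum (a + 1) (deriv φ) t z) t := by
  have h1 := (hasDerivAt_halfSum_aux h a 0 1 ht hz).2
  simp only [zero_mul, add_zero, zero_add, mul_one, one_mul] at h1
  have h2 : HasDerivAt (fun s => halfSum a φ (t + s) z) (halfSum (a + 1) (deriv φ) t z) 0 := by
    refine h1.congr_deriv (tsum_congr fun n => ?_)
    rw [pow_succ, mul_assoc]
  have h3 := HasDerivAt.comp_sub_const t t ((sub_self t).symm ▸ h2)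
  exact h3.congr_of_eventuallyEq (.of_forall fun x => by simp only [add_sub_cancel])

end TermwiseDerivatives

/-! ### The cotangent: exponential decay and partial fractions. -/

section Cotangent

open Filter Topology Finset
open Complex (integerComplement)

/-- The function `π cot(π w)`. -/
noncomputable def cotPi (w : ℂ) : ℂ := Real.pi * Complex.cot (Real.pi * w)

/-- The function `π cot(π w) + π i`, which decays at `i ∞`. -/
noncomputable def kappa (w : ℂ) : ℂ := cotPi w + Real.pi * Complex.I

theorem cotPi_add_one (w : ℂ) : cotPi (w + 1) = cotPi w := by
  simp only [cotPi, Complex.cot, mul_add, mul_one, Complex.cos_add_pi, Complex.sin_add_pi,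
    neg_div_neg_eq]

theorem cotPi_neg (w : ℂ) : cotPi (-w) = -cotPi w := by
  simp only [cotPi, Complex.cot, mul_neg, Complex.cos_neg, Complex.sin_neg, div_neg]

theorem differentiableAt_cotPi {w : ℂ} (hw : w ∈ integerComplement) :
    DifferentiableAt ℂ cotPi w := by
  unfold cotPi Complex.cot
  have := sin_pi_mul_ne_zero hw
  fun_prop (disch := assumption)

theorem deriv_kappa : deriv kappa = deriv cotPi := by
  ext w
  exact deriv_add_const _

/-- With `q = exp (2 π i w)` one has `kappa w = - 2 π i q / (1 - q)`, and `‖q‖ ≤ 1 / 2` as soon as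
`w.im ≥ 1`. -/
theorem expDecay_kappa : ExpDecay kappa := by
  refine ⟨fun w hw => ((differentiableAt_cotPi hw).add_const _).differentiableWithinAt,
    4 * Real.pi, 1, fun w hw => ?_⟩
  set q := Complex.exp (2 * Real.pi * Complex.I * w) with hq
  have hqn : ‖q‖ = Real.exp (-(2 * Real.pi * w.im)) := by
    rw [hq, Complex.norm_exp]
    congr 1
    simp
  have h1 : ‖q‖ ≤ Real.exp (-w.im) := by
    rw [hqn]
    refine Real.exp_le_exp.2 ?_
    nlinarith [Real.pi_gt_three]
  have h2 : ‖q‖ ≤ 1 / 2 := by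
    refine h1.trans ((Real.exp_le_exp.2 (neg_le_neg hw)).trans ?_)
    rw [Real.exp_neg, one_div]
    exact inv_anti₀ two_pos (by linarith [Real.add_one_le_exp (1 : ℝ)])
  have h3 : 1 / 2 ≤ ‖1 - q‖ := by
    have := norm_sub_norm_le (1 : ℂ) q
    rw [norm_one] at this
    linarith
  have h4 : (1 - q) ≠ 0 := norm_pos_iff.1 (by linarith)
  have h5 : kappa w = 2 * Real.pi * q / (Complex.I * (1 - q)) := by
    rw [kappa, cotPi, Complex.cot_pi_eq_exp_ratio, ← hq]
    field_simp
    rw [Complex.I_sq]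
    ring
  rw [h5, norm_div, norm_mul, norm_mul, norm_mul, Complex.norm_I, one_mul, Complex.norm_real,
    Complex.norm_ofNat, Real.norm_of_nonneg Real.pi_pos.le, div_le_iff₀ (by linarith)]
  have h6 : 0 < Real.exp (-w.im) := Real.exp_pos _
  have h7 := Real.pi_pos
  calc 2 * Real.pi * ‖q‖ ≤ 2 * Real.pi * Real.exp (-w.im) := by gcongr
    _ = 4 * Real.pi * Real.exp (-w.im) * (1 / 2) := by ring
    _ ≤ _ := by gcongr

theorem sum_Icc_neg_eq {α : Type*} [AddCommGroup α] (f : ℤ → α) (N : ℕ) :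
    ∑ n ∈ Icc (-(N : ℤ)) N, f n = f 0 + ∑ n ∈ range N, (f (n + 1) + f (-(n + 1))) := by
  induction N with
  | zero => simp
  | succ N ih =>
    have h : Icc (-((N + 1 : ℕ) : ℤ)) ((N + 1 : ℕ) : ℤ) =
        insert ((N : ℤ) + 1) (insert (-((N : ℤ) + 1)) (Icc (-(N : ℤ)) N)) := by
      ext x
      simp only [mem_Icc, mem_insert]
      push_cast
      omega
    rw [h, sum_insert, sum_insert, ih, sum_range_succ]
    · abel
    · simp only [mem_Icc]
      omega
    · simp only [mem_Icc, mem_insert]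
      omega

/-- The partial fractions of the cotangent, by Eisenstein summation. -/
theorem hasSum_cotPi {w : ℂ} (hw : w ∈ integerComplement) :
    HasSum (fun m : ℤ => 1 / (w + m)) (cotPi w) (symmetricIcc ℤ) := by
  rw [hasSum_symmetricIcc_iff]
  have h := (tendsto_logDeriv_euler_cot_sub hw).const_add (1 / w)
  rw [add_sub_cancel] at h
  refine h.congr fun N => ?_
  rw [sum_Icc_neg_eq]
  simp only [cotTerm, Int.cast_zero, add_zero]
  congr 1
  refine sum_congr rfl fun n _ => ?_
  push_cast
  rw [add_comm, ← sub_eq_add_neg]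

end Cotangent

/-! ### Liouville's theorem for elliptic functions. -/

section Liouville

open Filter Topology

theorem mem_periodPair_lattice {τ : ℍ} {x : ℂ} :
    x ∈ (periodPair τ).lattice ↔ ∃ m n : ℤ, (m : ℂ) + n * τ = x := by
  rw [PeriodPair.mem_lattice]
  simp [periodPair]

/-- An elliptic function without poles is constant. -/
theorem eq_of_periodic_of_removable (L : PeriodPair) {f g : ℂ → ℂ}
    (hf : DifferentiableOn ℂ f (L.lattice : Set ℂ)ᶜ)
    (h₁ : ∀ z ∉ L.lattice, f (z + L.ω₁) = f z) (h₂ : ∀ z ∉ L.lattice, f (z + L.ω₂) = f z)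
    (hg : DifferentiableAt ℂ g 0) (hfg : ∀ᶠ z in 𝓝[≠] 0, f z = g z) {z : ℂ}
    (hz : z ∉ L.lattice) : f z = g 0 := by
  classical
  -- Filling in the value `g 0` at every lattice point gives an entire function with the same
  -- periods, bounded by compactness of a fundamental cell.
  set F : ℂ → ℂ := fun z => if z ∈ L.lattice then g 0 else f z with hF
  have hmem : ∀ {z l : ℂ}, l ∈ L.lattice → (z + l ∈ L.lattice ↔ z ∈ L.lattice) := fun hl =>
    L.lattice.toAddSubgroup.add_mem_cancel_right hl
  have hper₁ : ∀ z l, l ∈ L.lattice → F (z + l) = F z := by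
    intro z l hl
    refine Submodule.span_induction (p := fun l _ => ∀ z, F (z + l) = F z) ?_ (by simp)
      (fun x y _ _ hx hy z => ?_) (fun n x _ hx z => ?_) hl z
    · intro w hw z
      have hwL : w ∈ L.lattice := Submodule.subset_span hw
      simp only [hF, hmem hwL]
      split_ifs with h
      · rfl
      · rcases hw with rfl | rfl
        exacts [h₁ z h, h₂ z h]
    · rw [← add_assoc, hy, hx]
    · have hx' : Function.Periodic F x := fun z => hx z
      rw [zsmul_eq_mul]
      exact hx'.int_mul n z
  have hdiff₀ : DifferentiableAt ℂ F 0 := by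
    refine hg.congr_of_eventuallyEq ?_
    rw [eventually_nhdsWithin_iff] at hfg
    filter_upwards [hfg, L.compl_lattice_sdiff_singleton_mem_nhds 0] with x hx hxL
    by_cases h0 : x = 0
    · simp [hF, h0]
    · have hx0 : x ∉ L.lattice := by simp_all
      simp [hF, hx0, hx h0]
  have hdiff : Differentiable ℂ F := fun x => by
    by_cases hx : x ∈ L.lattice
    · have h : F = fun y => F (y - x) := by
        ext y
        rw [← hper₁ (y - x) x hx, sub_add_cancel]
      rw [h]
      rw [← sub_self x] at hdiff₀
      exact DifferentiableAt.comp (g := F) (f := fun y => y - x) x hdiff₀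
        (differentiableAt_id.sub_const x)
    · refine (hf.differentiableAt (L.isClosed_lattice.isOpen_compl.mem_nhds hx)).congr_of_eventuallyEq
        ?_
      filter_upwards [L.isClosed_lattice.isOpen_compl.mem_nhds hx] with y hy
      exact if_neg hy
  have hb := (IsZLattice.isCompact_range_of_periodic L.lattice F hdiff.continuous
    fun z w hw => hper₁ z w hw).isBounded
  have := hdiff.apply_eq_apply_of_bounded hb z 0
  simpa [hF, hz] using this

end Liouville

/-! ### `E₁` and its derivatives as cotangent series, with their quasi-periods. -/

section EisensteinSeries

open Filter Topology
open Complex (integerComplement)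

theorem kappa_add_one (w : ℂ) : kappa (w + 1) = kappa w := by
  rw [kappa, cotPi_add_one, kappa]

theorem deriv_iterate_add_one {f : ℂ → ℂ} (hf : ∀ w, f (w + 1) = f w) (j : ℕ) (w : ℂ) :
    deriv^[j] f (w + 1) = deriv^[j] f w := by
  induction j generalizing w with
  | zero => exact hf w
  | succ j ih =>
    rw [Function.iterate_succ_apply', ← deriv_comp_add_const]
    exact congrArg (deriv · w) (funext ih)

theorem deriv_iterate_neg {f : ℂ → ℂ} {c : ℂ} (hf : ∀ w, f (-w) = c * f w) (j : ℕ) (w : ℂ) :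
    deriv^[j] f (-w) = (-1) ^ j * c * deriv^[j] f w := by
  induction j generalizing w with
  | zero => simpa using hf w
  | succ j ih =>
    have h := deriv_comp_neg (f := deriv^[j] f) (x := w)
    rw [funext ih, deriv_const_mul_field, ← neg_eq_iff_eq_neg] at h
    rw [Function.iterate_succ_apply', ← h]
    ring

theorem ExpDecay.iterate_deriv {φ : ℂ → ℂ} (h : ExpDecay φ) (j : ℕ) : ExpDecay (_root_.deriv^[j] φ) := by
  induction j with
  | zero => exact h
  | succ j ih =>
    rw [Function.iterate_succ_apply']
    exact ih.deriv

theorem iterate_deriv_kappa (j : ℕ) : deriv^[j + 1] kappa = deriv^[j + 1] cotPi := by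
  rw [Function.iterate_succ_apply, deriv_kappa, ← Function.iterate_succ_apply]

theorem differentiableAt_iterate_deriv_cotPi (j : ℕ) {w : ℂ} (hw : w ∈ integerComplement) :
    DifferentiableAt ℂ (deriv^[j] cotPi) w := by
  cases j with
  | zero => exact differentiableAt_cotPi hw
  | succ j =>
    rw [← iterate_deriv_kappa]
    exact (expDecay_kappa.iterate_deriv _).differentiableAt hw

theorem halfSum_add_one {φ : ℂ → ℂ} (hφ : ∀ w, φ (w + 1) = φ w) (a : ℕ) (t z : ℂ) :
    halfSum a φ t (z + 1) = halfSum a φ t z := by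
  simp only [halfSum, add_right_comm z 1, hφ]

section Shift

variable {φ : ℂ → ℂ} {t z : ℂ} (h : ExpDecay φ) (ht : 0 < t.im)
  (hz : ∀ n : ℕ, z + (n + 1) * t ∈ integerComplement)

include h ht hz

theorem halfSum_zero_add : halfSum 0 φ t (z + t) = halfSum 0 φ t z - φ (z + t) := by
  have h1 := (summable_halfSum h 0 ht hz).tsum_eq_zero_add
  rw [halfSum, halfSum, h1]
  simp only [pow_zero, one_mul, Nat.cast_zero, zero_add, add_sub_cancel_left]
  refine tsum_congr fun n => ?_
  push_cast
  ring_nf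

theorem halfSum_one_add : halfSum 1 φ t (z + t) = halfSum 1 φ t z - halfSum 0 φ t z := by
  have hs1 := summable_halfSum h 1 ht hz
  have hs0 := summable_halfSum h 0 ht hz
  rw [halfSum, halfSum, halfSum, ← hs1.tsum_sub hs0, (hs1.sub hs0).tsum_eq_zero_add]
  simp only [Nat.cast_zero, zero_add, pow_zero, pow_one, sub_self, zero_add]
  refine tsum_congr fun n => ?_
  push_cast
  ring_nf

/-- At `z - t` the first argument is `z`, which may be an integer, so `summable_halfSum` does not
apply. Dropping that term and expanding `(n + 2) ^ a` in powers of `n + 1` reduces to the series at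
`z`. -/
theorem summable_halfSum_sub (a : ℕ) :
    Summable fun n : ℕ => ((n : ℂ) + 1) ^ a * φ (z - t + (n + 1) * t) := by
  have hs1 := summable_halfSum h 1 ht hz
  have hs0 := summable_halfSum h 0 ht hz
  rw [← summable_nat_add_iff 1]
  have e : ∀ n : ℕ, z - t + (((n + 1 : ℕ) : ℂ) + 1) * t = z + (n + 1) * t := fun n => by
    push_cast
    ring
  simp only [e]
  have ha := summable_halfSum h a ht hz
  rcases a with _ | a
  · simpa using hs0
  · have hN : ∀ b : ℕ, Summable fun n : ℕ => ((n : ℂ) + 1) ^ b * φ (z + (n + 1) * t) :=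
      fun b => summable_halfSum h b ht hz
    have : ∀ n : ℕ, (((n + 1 : ℕ) : ℂ) + 1) ^ (a + 1) * φ (z + (n + 1) * t) =
        ∑ k ∈ Finset.range (a + 2), ((a + 1).choose k : ℂ) *
          (((n : ℂ) + 1) ^ k * φ (z + (n + 1) * t)) := fun n => by
      push_cast
      rw [add_pow, Finset.sum_mul]
      refine Finset.sum_congr rfl fun k _ => ?_
      rw [one_pow]
      ring
    simp only [this]
    exact summable_sum fun k _ => (hN k).mul_left _

theorem halfSum_zero_sub : halfSum 0 φ t (z - t) = halfSum 0 φ t z + φ z := by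
  rw [halfSum, halfSum, (summable_halfSum_sub h ht hz 0).tsum_eq_zero_add]
  simp only [pow_zero, one_mul, Nat.cast_zero, zero_add, sub_add_cancel]
  rw [add_comm]
  congr 1
  refine tsum_congr fun n => ?_
  push_cast
  ring_nf

theorem halfSum_one_sub :
    halfSum 1 φ t (z - t) = halfSum 1 φ t z + halfSum 0 φ t z + φ z := by
  have hs1 := summable_halfSum h 1 ht hz
  have hs0 := summable_halfSum h 0 ht hz
  rw [halfSum, halfSum, halfSum, (summable_halfSum_sub h ht hz 1).tsum_eq_zero_add,
    ← hs1.tsum_add hs0]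
  simp only [pow_zero, one_mul, Nat.cast_zero, zero_add, sub_add_cancel, pow_one]
  rw [add_comm]
  congr 1
  refine tsum_congr fun n => ?_
  push_cast
  ring_nf

end Shift

/-- The `j`-th derivative with respect to `z` of the Eisenstein series `E₁`. -/
noncomputable def eisE (j : ℕ) (t z : ℂ) : ℂ :=
  deriv^[j] cotPi z + halfSum 0 (deriv^[j] kappa) t z -
    (-1) ^ j * halfSum 0 (deriv^[j] kappa) t (-z)

/-- The derivative with respect to `τ` of `eisE j`. -/
noncomputable def eisR (j : ℕ) (t z : ℂ) : ℂ :=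
  halfSum 1 (deriv^[j + 1] kappa) t z - (-1) ^ j * halfSum 1 (deriv^[j + 1] kappa) t (-z)

variable {τ : ℍ} {z : ℂ}

theorem add_mul_mem_integerComplement (hz : z ∉ (periodPair τ).lattice) (n : ℤ) :
    z + n * τ ∈ integerComplement := by
  rintro ⟨m, hm⟩
  refine hz (mem_periodPair_lattice.2 ⟨m, -n, ?_⟩)
  push_cast
  rw [hm]
  ring

theorem neg_notMem_lattice (hz : z ∉ (periodPair τ).lattice) : -z ∉ (periodPair τ).lattice :=
  fun h => hz (neg_mem_iff.1 h)

theorem mem_integerComplement_of_notMem (hz : z ∉ (periodPair τ).lattice) :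
    z ∈ integerComplement := by
  simpa using add_mul_mem_integerComplement hz 0

theorem add_succ_mul_mem_integerComplement (hz : z ∉ (periodPair τ).lattice) (n : ℕ) :
    z + (n + 1) * τ ∈ integerComplement := by
  exact_mod_cast add_mul_mem_integerComplement hz ((n : ℤ) + 1)

theorem add_succ_mul_mem_integerComplement_of_norm_lt (hz : ‖z‖ < τ.im) (n : ℕ) :
    z + (n + 1) * τ ∈ integerComplement := by
  refine mem_integerComplement_of_im_ne_zero (ne_of_gt ?_)
  have h1 := (abs_le.1 (Complex.abs_im_le_norm z)).1
  have h2 : (z + (n + 1) * (τ : ℂ)).im = z.im + (n + 1) * τ.im := by simp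
  rw [h2]
  have : 0 ≤ (n : ℝ) * τ.im := by positivity [τ.im_pos]
  linarith

section

variable {a : ℕ} {φ : ℂ → ℂ} (h : ExpDecay φ)

include h

theorem hasDerivAt_halfSum_neg (c : ℂ) (hz : ∀ n : ℕ, -z + (n + 1) * (τ : ℂ) ∈ integerComplement) :
    HasDerivAt (fun z => c * halfSum a φ τ (-z)) (-c * halfSum a (deriv φ) τ (-z)) z := by
  have h1 := (hasDerivAt_halfSum_right h a τ.im_pos hz).comp z (hasDerivAt_neg z)
  exact (h1.const_mul c).congr_deriv (by ring)

end

theorem hasDerivAt_eisE (hz : z ∉ (periodPair τ).lattice) (j : ℕ) :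
    HasDerivAt (eisE j τ) (eisE (j + 1) τ z) z := by
  have hφ := expDecay_kappa.iterate_deriv j
  have h1 := (differentiableAt_iterate_deriv_cotPi j (mem_integerComplement_of_notMem hz)).hasDerivAt
  have h2 := hasDerivAt_halfSum_right hφ 0 τ.im_pos (add_succ_mul_mem_integerComplement hz)
  have h3 := hasDerivAt_halfSum_neg hφ (a := 0) ((-1) ^ j)
    (add_succ_mul_mem_integerComplement (neg_notMem_lattice hz))
  refine ((h1.add h2).sub h3).congr_deriv ?_
  simp only [eisE, Function.iterate_succ_apply', pow_succ]
  ring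

theorem hasDerivAt_eisE_left (hz : z ∉ (periodPair τ).lattice) (j : ℕ) :
    HasDerivAt (fun t => eisE j t z) (eisR j τ z) τ := by
  have hφ := expDecay_kappa.iterate_deriv j
  have h2 := hasDerivAt_halfSum_left hφ 0 τ.im_pos (add_succ_mul_mem_integerComplement hz)
  have h3 := hasDerivAt_halfSum_left hφ 0 τ.im_pos
    (add_succ_mul_mem_integerComplement (neg_notMem_lattice hz))
  refine ((h2.const_add _).sub (h3.const_mul ((-1) ^ j))).congr_deriv ?_
  simp only [eisR, Function.iterate_succ_apply', zero_add]

theorem hasDerivAt_eisR (hz : ∀ n : ℕ, z + (n + 1) * (τ : ℂ) ∈ integerComplement)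
    (hz' : ∀ n : ℕ, -z + (n + 1) * (τ : ℂ) ∈ integerComplement) (j : ℕ) :
    HasDerivAt (eisR j τ) (eisR (j + 1) τ z) z := by
  have hφ := expDecay_kappa.iterate_deriv (j + 1)
  have h2 := hasDerivAt_halfSum_right hφ 1 τ.im_pos hz
  have h3 := hasDerivAt_halfSum_neg hφ (a := 1) ((-1) ^ j) hz'
  refine (h2.sub h3).congr_deriv ?_
  rw [eisR, ← Function.iterate_succ_apply' deriv, pow_succ]
  ring

theorem eisE_add_one (j : ℕ) : eisE j τ (z + 1) = eisE j τ z := by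
  have hc := deriv_iterate_add_one cotPi_add_one j
  have hk := deriv_iterate_add_one kappa_add_one j
  have h3 : halfSum 0 (deriv^[j] kappa) τ (-(z + 1)) = halfSum 0 (deriv^[j] kappa) τ (-z) := by
    rw [← halfSum_add_one hk, neg_add_rev, neg_add_cancel_comm]
  rw [eisE, hc, halfSum_add_one hk, h3, eisE]

theorem eisR_add_one (j : ℕ) : eisR j τ (z + 1) = eisR j τ z := by
  have hk := deriv_iterate_add_one kappa_add_one (j + 1)
  have h3 : halfSum 1 (deriv^[j + 1] kappa) τ (-(z + 1)) =
      halfSum 1 (deriv^[j + 1] kappa) τ (-z) := by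
    rw [← halfSum_add_one hk, neg_add_rev, neg_add_cancel_comm]
  rw [eisR, halfSum_add_one hk, h3, eisR]

/-- The shift moves one term between the cotangent and each half-sum; the cotangents match, and each
move leaves the constant `- π i` by which `kappa` differs from `cotPi`. -/
theorem eisE_zero_add (hz : z ∉ (periodPair τ).lattice) :
    eisE 0 τ (z + τ) = eisE 0 τ z - 2 * Real.pi * Complex.I := by
  simp only [eisE, Function.iterate_zero, id, pow_zero, one_mul]
  rw [neg_add, ← sub_eq_add_neg, halfSum_zero_add expDecay_kappa τ.im_pos
    (add_succ_mul_mem_integerComplement hz), halfSum_zero_sub expDecay_kappa τ.im_pos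
    (add_succ_mul_mem_integerComplement (neg_notMem_lattice hz)), kappa, kappa, cotPi_neg]
  ring

theorem deriv_iterate_cotPi_neg (j : ℕ) (w : ℂ) :
    deriv^[j] cotPi (-w) = -(-1) ^ j * deriv^[j] cotPi w := by
  rw [deriv_iterate_neg (c := -1) (fun w => by rw [cotPi_neg]; ring)]
  ring

theorem eisE_succ_add (hz : z ∉ (periodPair τ).lattice) (j : ℕ) :
    eisE (j + 1) τ (z + τ) = eisE (j + 1) τ z := by
  have hφ := expDecay_kappa.iterate_deriv (j + 1)
  rw [eisE, neg_add, ← sub_eq_add_neg, halfSum_zero_add hφ τ.im_pos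
    (add_succ_mul_mem_integerComplement hz), halfSum_zero_sub hφ τ.im_pos
    (add_succ_mul_mem_integerComplement (neg_notMem_lattice hz)), iterate_deriv_kappa,
    deriv_iterate_cotPi_neg, eisE, iterate_deriv_kappa]
  have : ((-1 : ℂ) ^ (j + 1)) * (-1) ^ (j + 1) = 1 := by
    rw [← mul_pow]
    norm_num
  linear_combination (deriv^[j + 1] cotPi z) * this

/-- This is the relation that differentiating `eisE_zero_add` in `τ` suggests: the shift itself
depends on `τ`, which brings in the `z`-derivative. -/
theorem eisR_zero_add (hz : z ∉ (periodPair τ).lattice) :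
    eisR 0 τ (z + τ) = eisR 0 τ z - eisE 1 τ z := by
  have hφ := expDecay_kappa.iterate_deriv 1
  rw [eisR, neg_add, ← sub_eq_add_neg, halfSum_one_add hφ τ.im_pos
    (add_succ_mul_mem_integerComplement hz), halfSum_one_sub hφ τ.im_pos
    (add_succ_mul_mem_integerComplement (neg_notMem_lattice hz)), iterate_deriv_kappa,
    deriv_iterate_cotPi_neg, eisE, eisR, iterate_deriv_kappa]
  ring

theorem eisE_neg (j : ℕ) : eisE j τ (-z) = -(-1) ^ j * eisE j τ z := by
  have : ((-1 : ℂ) ^ j) * (-1) ^ j = 1 := by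
    rw [← mul_pow]
    norm_num
  rw [eisE, eisE, deriv_iterate_cotPi_neg, neg_neg]
  linear_combination (-halfSum 0 (deriv^[j] kappa) τ (-z)) * this

theorem eisR_zero_neg : eisR 0 τ (-z) = -eisR 0 τ z := by
  rw [eisR, eisR, neg_neg]
  ring

/-- `E₁` is the Eisenstein series `eisE 0`. -/
theorem E1_apply (p : domain) : E1 p = eisE 0 p.1.1 p.1.2 := by
  obtain ⟨⟨τ, z⟩, hp⟩ := p
  have hz : z ∉ (periodPair τ).lattice := hp
  have hinner : ∀ n : ℤ, ∑'[symmetricIcc ℤ] m : ℤ, 1 / (z + (m : ℂ) + (n : ℂ) * (τ : ℂ)) =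
      cotPi (z + n * τ) := fun n => by
    refine ((hasSum_cotPi (add_mul_mem_integerComplement hz n)).congr_fun ?_).tsum_eq
    intro m
    rw [add_right_comm]
  simp only [E1, hinner]
  refine HasSum.tsum_eq ?_
  rw [hasSum_symmetricIcc_iff]
  have h1 := (summable_halfSum expDecay_kappa 0 τ.im_pos
    (add_succ_mul_mem_integerComplement hz)).hasSum.tendsto_sum_nat
  have h2 := (summable_halfSum expDecay_kappa 0 τ.im_pos
    (add_succ_mul_mem_integerComplement (neg_notMem_lattice hz))).hasSum.tendsto_sum_nat
  have h3 := (h1.const_add (cotPi z)).sub h2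
  simp only [eisE, halfSum, Function.iterate_zero, id, pow_zero, one_mul] at h3 ⊢
  refine h3.congr fun N => ?_
  rw [sum_Icc_neg_eq, add_sub_assoc, ← Finset.sum_sub_distrib]
  simp only [Int.cast_zero, zero_mul, add_zero]
  congr 1
  refine Finset.sum_congr rfl fun n _ => ?_
  -- In the pair of rows `n + 1` and `-(n + 1)`, oddness of the cotangent makes the constants `π i`
  -- cancel, so `cotPi` may be replaced by the decaying `kappa`.
  have : z + ((-((n : ℤ) + 1) : ℤ) : ℂ) * (τ : ℂ) = -(-z + (n + 1) * τ) := by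
    push_cast
    ring
  rw [this, cotPi_neg, kappa, kappa]
  push_cast
  ring

end EisensteinSeries

/-! ### The principal part of `E₁` and its differential equation. -/

section Burgers

open Filter Topology
open Complex (integerComplement)

theorem analyticAt_dslope {f : ℂ → ℂ} {x : ℂ} (hf : AnalyticAt ℂ f x) :
    AnalyticAt ℂ (dslope f x) x := by
  obtain ⟨p, hp⟩ := hf
  exact ⟨_, hp.has_fpower_series_dslope_fslope⟩

theorem eq_add_mul_dslope (f : ℂ → ℂ) (x y : ℂ) : f y = f x + (y - x) * dslope f x y := by
  have := sub_smul_dslope f x y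
  rw [smul_eq_mul] at this
  rw [this]
  ring

/-- The principal part of `π cot(π z)` at the origin is `1 / z`. -/
theorem exists_cotPi_eq :
    ∃ c : ℂ → ℂ, AnalyticAt ℂ c 0 ∧ ∀ᶠ z in 𝓝[≠] 0, cotPi z = 1 / z + c z := by
  have hsin : AnalyticAt ℂ (fun z : ℂ => Complex.sin (Real.pi * z)) 0 := by fun_prop
  set s := dslope (fun z : ℂ => Complex.sin (Real.pi * z)) 0 with hs
  have hs_eq : ∀ z, Complex.sin (Real.pi * z) = z * s z := fun z => by
    have := eq_add_mul_dslope (fun z : ℂ => Complex.sin (Real.pi * z)) 0 z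
    simpa using this
  have hs0 : s 0 = Real.pi := by
    rw [hs, dslope_same]
    have h1 : HasDerivAt (fun z : ℂ => (Real.pi : ℂ) * z) Real.pi 0 := by
      simpa using (hasDerivAt_id (0 : ℂ)).const_mul (Real.pi : ℂ)
    have h2 := h1.csin
    rw [h2.deriv]
    simp
  have hsA : AnalyticAt ℂ s 0 := analyticAt_dslope hsin
  have hs_ne : s 0 ≠ 0 := by
    rw [hs0]
    exact_mod_cast Real.pi_ne_zero
  set g : ℂ → ℂ := fun z => Real.pi * Complex.cos (Real.pi * z) / s z with hg
  have hgA : AnalyticAt ℂ g 0 := by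
    refine AnalyticAt.div ?_ hsA hs_ne
    fun_prop
  refine ⟨dslope g 0, analyticAt_dslope hgA, ?_⟩
  filter_upwards [self_mem_nhdsWithin, eventually_nhdsWithin_of_eventually_nhds
    (hsA.continuousAt.eventually_ne hs_ne)] with z hz hsz
  have hz0 : z ≠ 0 := hz
  have h0 : g 0 = 1 := by
    have : s 0 ≠ 0 := hs_ne
    simp only [hg, mul_zero, Complex.cos_zero, mul_one]
    rw [hs0] at this ⊢
    exact div_self this
  have h1 := eq_add_mul_dslope g 0 z
  rw [h0, sub_zero] at h1
  have h2 : cotPi z = g z / z := by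
    rw [cotPi, Complex.cot, hs_eq, hg]
    field_simp
  rw [h2, h1]
  field_simp

variable {τ : ℍ}

theorem eventually_notMem_lattice (L : PeriodPair) : ∀ᶠ z in 𝓝[≠] (0 : ℂ), z ∉ L.lattice := by
  filter_upwards [self_mem_nhdsWithin, mem_nhdsWithin_of_mem_nhds
    (L.compl_lattice_sdiff_singleton_mem_nhds 0)] with z hz hz'
  simp_all

theorem eventually_norm_lt (τ : ℍ) : ∀ᶠ z in 𝓝 (0 : ℂ), ‖z‖ < τ.im :=
  ContinuousAt.eventually_lt (by fun_prop) continuousAt_const (by simpa using τ.im_pos)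

/-- For `‖z‖ < τ.im` all arguments `z + (n + 1) τ` lie above the real axis, so the half-sums are
regular at the origin and the pole of `E₁` comes from `cotPi z` alone. -/
theorem analyticAt_halfSum {φ : ℂ → ℂ} (h : ExpDecay φ) (a : ℕ) :
    AnalyticAt ℂ (fun z => halfSum a φ τ z) 0 := by
  rw [Complex.analyticAt_iff_eventually_differentiableAt]
  filter_upwards [eventually_norm_lt τ] with z hz
  exact (hasDerivAt_halfSum_right h a τ.im_pos
    (add_succ_mul_mem_integerComplement_of_norm_lt hz)).differentiableAt

theorem analyticAt_halfSum_neg {φ : ℂ → ℂ} (h : ExpDecay φ) (a : ℕ) :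
    AnalyticAt ℂ (fun z => halfSum a φ τ (-z)) 0 := by
  have h1 := analyticAt_halfSum (τ := τ) h a
  rw [← neg_zero] at h1
  exact h1.comp (f := fun z => -z) (by fun_prop)

/-- The principal part of `E₁` at the origin is `1 / z`. The regular part is the sum of a function
independent of `τ` and of a function given by series. -/
theorem exists_eisE_eq : ∃ c : ℂ → ℂ, AnalyticAt ℂ c 0 ∧ ∀ τ : ℍ, ∀ᶠ z in 𝓝[≠] (0 : ℂ),
    eisE 0 τ z = 1 / z + (c z + halfSum 0 kappa τ z - halfSum 0 kappa τ (-z)) := by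
  obtain ⟨c, hc, h⟩ := exists_cotPi_eq
  refine ⟨c, hc, fun τ => ?_⟩
  filter_upwards [h] with z hz
  simp only [eisE, Function.iterate_zero, id, pow_zero, one_mul, hz]
  ring

theorem deriv_one_div_add {S : ℂ → ℂ} {z : ℂ} (hz : z ≠ 0) (hS : DifferentiableAt ℂ S z) :
    deriv (fun z => 1 / z + S z) z = -(1 / z ^ 2) + deriv S z := by
  have h := (hasDerivAt_inv hz).add hS.hasDerivAt
  simp only [one_div]
  rw [← h.deriv]
  rfl

theorem deriv_neg_one_div_sq_add {S : ℂ → ℂ} {z : ℂ} (hz : z ≠ 0) (hS : DifferentiableAt ℂ S z) :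
    deriv (fun z => -(1 / z ^ 2) + S z) z = 2 / z ^ 3 + deriv S z := by
  have h1 : HasDerivAt (fun z : ℂ => z ^ 2) (2 * z) z := by simpa using hasDerivAt_pow 2 z
  have h := (h1.fun_inv (pow_ne_zero 2 hz)).fun_neg.add hS.hasDerivAt
  simp only [one_div]
  have e : -(-(2 * z) / (z ^ 2) ^ 2) + deriv S z = 2 / z ^ 3 + deriv S z := by
    field_simp
  rw [← e, ← h.deriv]
  rfl

/-- Near the origin, `eisE 1` is the derivative of `eisE 0`. -/
theorem eventually_eisE_one {S : ℂ → ℂ} (hS : AnalyticAt ℂ S 0)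
    (h : ∀ᶠ z in 𝓝[≠] (0 : ℂ), eisE 0 τ z = 1 / z + S z) :
    ∀ᶠ z in 𝓝[≠] (0 : ℂ), eisE 1 τ z = -(1 / z ^ 2) + deriv S z := by
  have h1 := Filter.EventuallyEq.nhdsNE_deriv h
  filter_upwards [h1, eventually_notMem_lattice (periodPair τ), self_mem_nhdsWithin,
    eventually_nhdsWithin_of_eventually_nhds hS.eventually_analyticAt] with z hz hzL hz0 hSz
  rw [← deriv_one_div_add hz0 hSz.differentiableAt, ← hz, (hasDerivAt_eisE hzL 0).deriv]

theorem eventually_eisE_two {S : ℂ → ℂ} (hS : AnalyticAt ℂ S 0)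
    (h : ∀ᶠ z in 𝓝[≠] (0 : ℂ), eisE 0 τ z = 1 / z + S z) :
    ∀ᶠ z in 𝓝[≠] (0 : ℂ), eisE 2 τ z = 2 / z ^ 3 + deriv (deriv S) z := by
  have h1 := Filter.EventuallyEq.nhdsNE_deriv (eventually_eisE_one hS h)
  filter_upwards [h1, eventually_notMem_lattice (periodPair τ), self_mem_nhdsWithin,
    eventually_nhdsWithin_of_eventually_nhds hS.deriv.eventually_analyticAt] with z hz hzL hz0 hSz
  rw [← deriv_neg_one_div_sq_add hz0 hSz.differentiableAt, ← hz, (hasDerivAt_eisE hzL 1).deriv]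

theorem weierstrassPExcept_zero (L : PeriodPair) : L.weierstrassPExcept 0 0 = 0 := by
  rw [PeriodPair.weierstrassPExcept]
  convert tsum_zero with l
  split_ifs <;> simp

/-- The derivative of `E₁` is `-℘ - e₂` for a differentiable function `e₂` of `τ`. -/
theorem exists_e2 : ∃ e : ℂ → ℂ, ∀ τ : ℍ, DifferentiableAt ℂ e τ ∧
    ∀ z ∉ (periodPair τ).lattice, (periodPair τ).weierstrassP z = -eisE 1 τ z - e τ := by
  obtain ⟨c, hc, h⟩ := exists_eisE_eq
  -- The sum of `℘` and `∂_z E₁` is elliptic without poles, hence constant; its value is that at the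
  -- origin of the derivative of the regular part of `E₁`, because the regular part of `℘` vanishes
  -- there.
  refine ⟨fun t => -(deriv c 0 + 2 * halfSum 0 (deriv kappa) t 0), fun τ => ⟨?_, fun z hz => ?_⟩⟩
  · have h0 : ∀ n : ℕ, (0 : ℂ) + (n + 1) * τ ∈ integerComplement :=
      add_succ_mul_mem_integerComplement_of_norm_lt (by simpa using τ.im_pos)
    have := (hasDerivAt_halfSum_left expDecay_kappa.deriv 0 τ.im_pos h0).differentiableAt
    fun_prop
  · set L := periodPair τ
    set S : ℂ → ℂ := fun z => c z + halfSum 0 kappa τ z - halfSum 0 kappa τ (-z) with hS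
    have hSA : AnalyticAt ℂ S 0 :=
      (hc.add (analyticAt_halfSum expDecay_kappa 0)).sub (analyticAt_halfSum_neg expDecay_kappa 0)
    have hS' : deriv S 0 = deriv c 0 + 2 * halfSum 0 (deriv kappa) τ 0 := by
      have h0 : ∀ n : ℕ, (0 : ℂ) + (n + 1) * τ ∈ integerComplement :=
        add_succ_mul_mem_integerComplement_of_norm_lt (by simpa using τ.im_pos)
      have h1 := hasDerivAt_halfSum_right expDecay_kappa 0 τ.im_pos h0
      have h2 := hasDerivAt_halfSum_neg (τ := τ) (z := 0) (a := 0) expDecay_kappa 1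
        (by simpa using h0)
      simp only [one_mul] at h2
      have h3 := (hc.differentiableAt.hasDerivAt.add h1).sub h2
      refine (h3.congr_deriv ?_).deriv
      rw [neg_zero]
      ring
    have key := eq_of_periodic_of_removable L
      (f := fun z => L.weierstrassP z + eisE 1 τ z)
      (g := fun z => L.weierstrassPExcept 0 z + deriv S z) ?_ ?_ ?_ ?_ ?_ hz
    · simp only [weierstrassPExcept_zero, zero_add, hS'] at key
      linear_combination key
    · intro x hx
      refine DifferentiableAt.differentiableWithinAt (DifferentiableAt.add ?_
        (hasDerivAt_eisE hx 1).differentiableAt)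
      exact (L.analyticOnNhd_weierstrassP x hx).differentiableAt
    · intro x hx
      have h1 := L.periodic_weierstrassP ⟨_, L.ω₁_mem_lattice⟩ x
      have h2 : L.ω₁ = 1 := rfl
      simp only [h2] at h1 ⊢
      rw [h1, eisE_add_one]
    · intro x hx
      have h1 := L.periodic_weierstrassP ⟨_, L.ω₂_mem_lattice⟩ x
      have h2 : L.ω₂ = τ := rfl
      simp only [h2] at h1 ⊢
      rw [h1, eisE_succ_add hx]
    · exact (L.analyticAt_weierstrassPExcept 0).differentiableAt.add hSA.deriv.differentiableAt
    · filter_upwards [eventually_eisE_one hSA (h τ)] with x hx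
      have h1 := L.weierstrassPExcept_def 0 x
      simp only [ZeroMemClass.coe_zero, sub_zero, ne_eq, OfNat.ofNat_ne_zero, not_false_eq_true,
        zero_pow, div_zero, zero_sub] at h1
      rw [hx, h1]
      ring

/-- The differential equation of `E₁`. -/
theorem burgers {z : ℂ} (hz : z ∉ (periodPair τ).lattice) :
    (Real.pi : ℂ) / (2 * Complex.I) * eisR 0 τ z =
      -(1 / 4 * (eisE 0 τ z * eisE 1 τ z)) - 1 / 8 * eisE 2 τ z := by
  obtain ⟨c, hc, h⟩ := exists_eisE_eq
  set L := periodPair τ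
  set S : ℂ → ℂ := fun z => c z + halfSum 0 kappa τ z - halfSum 0 kappa τ (-z)
  replace h : ∀ᶠ z in 𝓝[≠] (0 : ℂ), eisE 0 τ z = 1 / z + S z := h τ
  have hSA : AnalyticAt ℂ S 0 :=
    (hc.add (analyticAt_halfSum expDecay_kappa 0)).sub (analyticAt_halfSum_neg expDecay_kappa 0)
  -- `E₁` is odd, so its regular part vanishes at the origin. Writing `S = z T` turns the remaining
  -- singular terms `S' / z - S / z ^ 2` into `T'`.
  have hS0 : S 0 = 0 := by
    have h1 : ∀ᶠ z in 𝓝[≠] (0 : ℂ), S (-z) = -S z := by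
      have hneg : Tendsto (fun z : ℂ => -z) (𝓝[≠] 0) (𝓝[≠] 0) := by
        refine tendsto_nhdsWithin_iff.2 ⟨?_, ?_⟩
        · refine Tendsto.mono_left ?_ nhdsWithin_le_nhds
          exact (continuous_neg (G := ℂ)).tendsto' 0 0 neg_zero
        · filter_upwards [self_mem_nhdsWithin] with z hz
          simpa using hz
      filter_upwards [h, hneg.eventually h] with z h1 h2
      have h3 := eisE_neg (τ := τ) (z := z) 0
      rw [h1, h2] at h3
      linear_combination h3 - one_div_neg_eq_neg_one_div z
    have hcont : ContinuousAt S 0 := hSA.continuousAt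
    have l1 : Tendsto S (𝓝[≠] 0) (𝓝 (S 0)) := hcont.tendsto.mono_left nhdsWithin_le_nhds
    have hneg : ContinuousAt (fun z => S (-z)) 0 :=
      ContinuousAt.comp (g := S) (f := fun z => -z) (by rwa [neg_zero]) continuousAt_neg
    have l2 : Tendsto (fun z => S (-z)) (𝓝[≠] 0) (𝓝 (S 0)) := by
      have := hneg.tendsto.mono_left (nhdsWithin_le_nhds (s := {0}ᶜ))
      rwa [neg_zero] at this
    have l3 := tendsto_nhds_unique_of_eventuallyEq l2 l1.neg h1
    exact self_eq_neg.1 l3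
  set T := dslope S 0 with hT
  have hTA : AnalyticAt ℂ T 0 := analyticAt_dslope hSA
  have hST : ∀ z, S z = z * T z := fun z => by
    rw [eq_add_mul_dslope S 0 z, hS0, sub_zero, zero_add]
  have hR : DifferentiableAt ℂ (eisR 0 τ) 0 := by
    have h0 : ∀ n : ℕ, (0 : ℂ) + (n + 1) * τ ∈ integerComplement :=
      add_succ_mul_mem_integerComplement_of_norm_lt (by simpa using τ.im_pos)
    exact (hasDerivAt_eisR h0 (by simpa using h0) 0).differentiableAt
  set f : ℂ → ℂ := fun z => (Real.pi : ℂ) / (2 * Complex.I) * eisR 0 τ z +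
    (1 / 4 * (eisE 0 τ z * eisE 1 τ z) + 1 / 8 * eisE 2 τ z) with hf
  set g : ℂ → ℂ := fun z => (Real.pi : ℂ) / (2 * Complex.I) * eisR 0 τ z +
    (1 / 4 * (deriv T z + S z * deriv S z) + 1 / 8 * deriv (deriv S) z) with hg
  have key : ∀ z ∉ L.lattice, f z = g 0 := fun z hz => by
    refine eq_of_periodic_of_removable L ?_ ?_ ?_ ?_ ?_ hz
    · intro x hx
      refine DifferentiableAt.differentiableWithinAt ?_
      have h0 := (hasDerivAt_eisE hx 0).differentiableAt
      have h1 := (hasDerivAt_eisE hx 1).differentiableAt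
      have h2 := (hasDerivAt_eisE hx 2).differentiableAt
      have h3 := (hasDerivAt_eisR (add_succ_mul_mem_integerComplement hx)
        (add_succ_mul_mem_integerComplement (neg_notMem_lattice hx)) 0).differentiableAt
      fun_prop
    · intro x _
      have h2 : L.ω₁ = 1 := rfl
      simp only [hf, h2, eisE_add_one, eisR_add_one]
    · intro x hx
      have h2 : L.ω₂ = τ := rfl
      -- The quasi-periods cancel: the change `- 2 π i / 4` in the coefficient of `∂_z E₁` is offset
      -- by `- π / (2 i)` from `eisR`. This ties the normalization of `∂_τ` to the factor `1 / 4` in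
      -- `d`.
      simp only [hf, h2, eisE_succ_add hx, eisR_zero_add hx, eisE_zero_add hx]
      field_simp
      linear_combination (-32 * Real.pi * eisE 1 τ x) * Complex.I_sq
    · have h1 := hSA.differentiableAt
      have h2 := hSA.deriv.differentiableAt
      have h3 := hSA.deriv.deriv.differentiableAt
      have h4 := hTA.deriv.differentiableAt
      fun_prop
    · filter_upwards [h, eventually_eisE_one hSA h, eventually_eisE_two hSA h, self_mem_nhdsWithin,
        eventually_nhdsWithin_of_eventually_nhds hTA.eventually_analyticAt] with x h0 h1 h2 hx hTx
      have hx0 : x ≠ 0 := hx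
      have h3 : deriv S x = T x + x * deriv T x := by
        rw [show S = fun x => x * T x from funext hST]
        have := (hasDerivAt_id x).mul hTx.differentiableAt.hasDerivAt
        rw [one_mul] at this
        exact this.deriv
      simp only [hf, hg, h0, h1, h2]
      rw [h3, hST x]
      field_simp
      ring
  have h1 := key z hz
  have h2 := key (-z) (neg_notMem_lattice hz)
  -- A constant odd function is zero.
  have h3 : f (-z) = -f z := by
    simp only [hf, eisE_neg, eisR_zero_neg]
    ring
  rw [h3, ← h1] at h2
  have h4 : f z = 0 := self_eq_neg.1 h2.symm
  linear_combination h4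

end Burgers

/-! ### Partial derivatives of functions on the domain. -/

section PartialDerivatives

open Filter Topology

theorem isClosed_range_intCast_real : IsClosed (Set.range ((↑) : ℤ → ℝ)) :=
  Int.isClosedEmbedding_coe_real.isClosed_range

/-- The coordinates of `z` in the real basis `1, t` are integers iff `z` is in the lattice. -/
theorem mem_lattice_iff_coords {τ : ℍ} {z : ℂ} : z ∈ (periodPair τ).lattice ↔
    z.im / (τ : ℂ).im ∈ Set.range ((↑) : ℤ → ℝ) ∧
      z.re - z.im / (τ : ℂ).im * (τ : ℂ).re ∈ Set.range ((↑) : ℤ → ℝ) := by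
  have hτ : (τ : ℂ).im ≠ 0 := τ.im_pos.ne'
  rw [mem_periodPair_lattice]
  constructor
  · rintro ⟨m, n, rfl⟩
    have h1 : ((m : ℂ) + n * τ).im / (τ : ℂ).im = n := by
      simp only [Complex.add_im, Complex.mul_im, Complex.intCast_im, Complex.intCast_re, zero_mul,
        add_zero, zero_add]
      field_simp
    rw [h1]
    exact ⟨⟨n, rfl⟩, ⟨m, by simp⟩⟩
  · rintro ⟨⟨n, hn⟩, ⟨m, hm⟩⟩
    rw [← hn] at hm
    rw [eq_div_iff hτ] at hn
    refine ⟨m, n, Complex.ext ?_ ?_⟩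
    · simp [hm]
    · simpa using hn

theorem eventually_mem_domain_right {τ : ℍ} {z : ℂ} (hz : (τ, z) ∈ domain) :
    ∀ᶠ w in 𝓝 z, (τ, w) ∈ domain :=
  (periodPair τ).isClosed_lattice.isOpen_compl.mem_nhds hz

/-- The real coordinates of `z` in the basis `1, t` depend continuously on `t`, and the integers are
closed in `ℝ`. -/
theorem eventually_mem_domain_left {τ : ℍ} {z : ℂ} (hz : (τ, z) ∈ domain) :
    ∀ᶠ t in 𝓝 (τ : ℂ), 0 < t.im ∧ (ofComplex t, z) ∈ domain := by
  have hτ : (τ : ℂ).im ≠ 0 := τ.im_pos.ne'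
  have hpos : ∀ᶠ t in 𝓝 (τ : ℂ), 0 < t.im :=
    Complex.continuous_im.continuousAt.eventually_const_lt τ.im_pos
  have key : ∀ᶠ t in 𝓝 (τ : ℂ), ¬(z.im / t.im ∈ Set.range ((↑) : ℤ → ℝ) ∧
      z.re - z.im / t.im * t.re ∈ Set.range ((↑) : ℤ → ℝ)) := by
    have h1 : ContinuousAt (fun t : ℂ => z.im / t.im) τ :=
      continuousAt_const.div Complex.continuous_im.continuousAt hτ
    have h2 : ContinuousAt (fun t : ℂ => z.re - z.im / t.im * t.re) τ :=
      continuousAt_const.sub (h1.mul Complex.continuous_re.continuousAt)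
    rcases not_and_or.1 (mem_lattice_iff_coords.not.1 hz) with h | h
    · filter_upwards [h1 (isClosed_range_intCast_real.isOpen_compl.mem_nhds h)] with t ht hc
      exact ht hc.1
    · filter_upwards [h2 (isClosed_range_intCast_real.isOpen_compl.mem_nhds h)] with t ht hc
      exact ht hc.2
  filter_upwards [hpos, key] with t ht hk
  refine ⟨ht, ?_⟩
  change z ∉ _
  rw [mem_lattice_iff_coords]
  simpa only [ofComplex_apply_of_im_pos ht] using hk

theorem extendZero_apply (f : Fun) {x : ℍ × ℂ} (hx : x ∈ domain) :
    extendZero f x = f ⟨x, hx⟩ :=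
  Subtype.val_injective.extend_apply f 0 (⟨x, hx⟩ : domain)

/-- At the point `p` the function `f` has the derivatives `a` in `z` and `b` in `τ`. -/
def HasPartials (f : Fun) (p : domain) (a b : ℂ) : Prop :=
  HasDerivAt (fun w : ℂ => extendZero f (p.1.1, w)) a p.1.2 ∧
    HasDerivAt (fun t : ℂ => extendZero f (ofComplex t, p.1.2)) b (p.1.1 : ℂ)

theorem hasPartials_of_forall {f : Fun} {F : ℂ → ℂ → ℂ} (hf : ∀ p : domain, f p = F p.1.1 p.1.2)
    {p : domain} {a b : ℂ} (ha : HasDerivAt (F p.1.1) a p.1.2)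
    (hb : HasDerivAt (fun t => F t p.1.2) b p.1.1) : HasPartials f p a b := by
  obtain ⟨⟨τ, z⟩, hp⟩ := p
  refine ⟨ha.congr_of_eventuallyEq ?_, hb.congr_of_eventuallyEq ?_⟩
  · filter_upwards [eventually_mem_domain_right hp] with w hw
    rw [extendZero_apply f hw, hf]
  · filter_upwards [eventually_mem_domain_left hp] with t ht
    rw [extendZero_apply f ht.2, hf]
    simp only [ofComplex_apply_of_im_pos ht.1]

namespace HasPartials

variable {f g : Fun} {p : domain} {a b a' b' : ℂ}

theorem dz_apply (h : HasPartials f p a b) : dz f p = a := h.1.deriv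

theorem dtau_apply (h : HasPartials f p a b) :
    dtau f p = (Real.pi : ℂ) / (2 * Complex.I) * b := by rw [dtau, h.2.deriv]

theorem d_apply (h : HasPartials f p a b) :
    d f p = (Real.pi : ℂ) / (2 * Complex.I) * b + 1 / 4 * (E1 p * a) := by
  rw [d, Pi.add_apply, h.dtau_apply, Pi.smul_apply, Pi.mul_apply, h.dz_apply, smul_eq_mul]

theorem add (h : HasPartials f p a b) (h' : HasPartials g p a' b') :
    HasPartials (f + g) p (a + a') (b + b') := by
  have e : extendZero (f + g) = extendZero f + extendZero g := by
    ext x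
    by_cases hx : x ∈ domain
    · simp [extendZero_apply _ hx]
    · have hx' : ¬∃ a : domain, a.1 = x := fun ⟨a, ha⟩ => hx (ha ▸ a.2)
      simp [extendZero, Function.extend_apply' _ _ _ hx']
  rw [HasPartials, e]
  exact ⟨h.1.add h'.1, h.2.add h'.2⟩

theorem mul (h : HasPartials f p a b) (h' : HasPartials g p a' b') :
    HasPartials (f * g) p (a * g p + f p * a') (b * g p + f p * b') := by
  have e : extendZero (f * g) = extendZero f * extendZero g := by
    ext x
    by_cases hx : x ∈ domain
    · simp [extendZero_apply _ hx]
    · have hx' : ¬∃ a : domain, a.1 = x := fun ⟨a, ha⟩ => hx (ha ▸ a.2)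
      simp [extendZero, Function.extend_apply' _ _ _ hx']
  have hp : ∀ f : Fun, extendZero f (p.1.1, p.1.2) = f p := fun f => extendZero_apply f p.2
  rw [HasPartials, e]
  have h1 := h.1.mul h'.1
  have h2 := h.2.mul h'.2
  simp only [ofComplex_apply, hp] at h1 h2
  exact ⟨h1, h2⟩

theorem algebraMap (p : domain) (c : ℂ) : HasPartials (algebraMap ℂ Fun c) p 0 0 :=
  hasPartials_of_forall (F := fun _ _ => c) (fun _ => rfl) (hasDerivAt_const _ _)
    (hasDerivAt_const _ _)

end HasPartials

end PartialDerivatives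

/-! ### The equations of `℘` and the `z`-derivatives of the equation of `E₁`. -/

section DifferentialEquations

open Filter Topology

/-- Otherwise the regular part of `℘'` at the origin would equal `2 / z ^ 3`. -/
theorem exists_derivWeierstrassP_ne_zero (L : PeriodPair) :
    ∃ z ∉ L.lattice, L.derivWeierstrassP z ≠ 0 := by
  by_contra! hcon
  have h1 : Tendsto (fun z => z ^ 3 * L.derivWeierstrassPExcept 0 z) (𝓝[≠] 0) (𝓝 0) := by
    have h2 : ContinuousAt (fun z => z ^ 3 * L.derivWeierstrassPExcept 0 z) 0 :=
      (continuousAt_id.pow 3).mul (L.analyticAt_derivWeierstrassPExcept 0).continuousAt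
    simpa using h2.tendsto.mono_left nhdsWithin_le_nhds
  have h2 : (fun z => z ^ 3 * L.derivWeierstrassPExcept 0 z) =ᶠ[𝓝[≠] 0] fun _ => (2 : ℂ) := by
    filter_upwards [eventually_notMem_lattice L, self_mem_nhdsWithin] with z hz hz0
    have h3 := L.derivWeierstrassPExcept_def 0 z
    have hz0' : z ≠ 0 := hz0
    simp only [ZeroMemClass.coe_zero, sub_zero, hcon z hz, zero_add] at h3
    rw [h3]
    field_simp
  exact two_ne_zero (tendsto_nhds_unique (h1.congr' h2) tendsto_const_nhds).symm

theorem hasDerivAt_weierstrassP (L : PeriodPair) {z : ℂ} (hz : z ∉ L.lattice) :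
    HasDerivAt L.weierstrassP (L.derivWeierstrassP z) z := by
  rw [← PeriodPair.deriv_weierstrassP]
  exact (L.analyticOnNhd_weierstrassP z hz).differentiableAt.hasDerivAt

theorem isPreconnected_compl_lattice (L : PeriodPair) :
    IsPreconnected ((L.lattice : Set ℂ)ᶜ) := by
  refine (Set.Countable.isPathConnected_compl_of_one_lt_rank ?_ ?_).isConnected.isPreconnected
  · rw [Complex.rank_real_complex]
    exact Cardinal.one_lt_two
  · have : Countable L.lattice := L.latticeEquivProd.toEquiv.countable_iff.2 inferInstance
    exact Set.countable_coe_iff.1 this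

/-- The second order differential equation `℘'' = 6 ℘² - g₂ / 2`. -/
theorem deriv_derivWeierstrassP (L : PeriodPair) {z : ℂ} (hz : z ∉ L.lattice) :
    deriv L.derivWeierstrassP z = 6 * L.weierstrassP z ^ 2 - 30 * L.G 4 := by
  set h : ℂ → ℂ := fun z =>
    deriv L.derivWeierstrassP z - (6 * L.weierstrassP z ^ 2 - 30 * L.G 4) with hh
  have hP := L.analyticOnNhd_weierstrassP
  have hQ := L.analyticOnNhd_derivWeierstrassP
  have hA : AnalyticOnNhd ℂ h (L.lattice : Set ℂ)ᶜ :=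
    hQ.deriv.sub ((analyticOnNhd_const.mul (hP.pow 2)).sub analyticOnNhd_const)
  -- Differentiating the Weierstrass equation gives the claim multiplied by `℘'`. The factor is
  -- removed by the identity theorem on the connected complement of the lattice.
  have hmul : ∀ x ∈ (L.lattice : Set ℂ)ᶜ, L.derivWeierstrassP x * h x = 0 := by
    intro x hx
    have h1 : HasDerivAt L.derivWeierstrassP (deriv L.derivWeierstrassP x) x :=
      (hQ x hx).differentiableAt.hasDerivAt
    have h2 := hasDerivAt_weierstrassP L hx
    have h3 := h1.fun_pow 2
    have h4 : HasDerivAt (fun z => 4 * L.weierstrassP z ^ 3 - L.g₂ * L.weierstrassP z - L.g₃) _ x :=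
      (((h2.fun_pow 3).const_mul 4).sub (h2.const_mul L.g₂)).sub_const L.g₃
    have h5 := h3.unique (h4.congr_of_eventuallyEq (by
      filter_upwards [L.isClosed_lattice.isOpen_compl.mem_nhds hx] with y hy
      exact L.derivWeierstrassP_sq y hy))
    simp only [hh]
    rw [PeriodPair.g₂] at h5
    norm_num at h5
    linear_combination h5 / 2
  rcases AnalyticOnNhd.eq_zero_or_eq_zero_of_smul_eq_zero hQ hA hmul
    (isPreconnected_compl_lattice L) with h0 | h0
  · obtain ⟨x, hx, hne⟩ := exists_derivWeierstrassP_ne_zero L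
    exact absurd (h0 x hx) hne
  · exact sub_eq_zero.1 (h0 z hz)

/-- The Eisenstein series `e₂` of weight two, in the sense that `∂_z E₁ = -℘ - e₂`. -/
noncomputable def e2 (t : ℂ) : ℂ := exists_e2.choose t

theorem differentiableAt_e2 (τ : ℍ) : DifferentiableAt ℂ e2 τ := (exists_e2.choose_spec τ).1

variable {τ : ℍ} {z : ℂ}

theorem weierstrassP_eq (hz : z ∉ (periodPair τ).lattice) :
    (periodPair τ).weierstrassP z = -eisE 1 τ z - e2 τ := (exists_e2.choose_spec τ).2 z hz

/-- Two functions that agree outside the lattice have the same derivative there. -/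
theorem unique_of_eqOn {F G : ℂ → ℂ} {a b : ℂ} (hz : z ∉ (periodPair τ).lattice)
    (h : ∀ w ∉ (periodPair τ).lattice, F w = G w) (hF : HasDerivAt F a z) (hG : HasDerivAt G b z) :
    a = b := by
  refine hF.unique (hG.congr_of_eventuallyEq ?_)
  filter_upwards [(periodPair τ).isClosed_lattice.isOpen_compl.mem_nhds hz] with y hy
  exact h y hy

theorem derivWeierstrassP_eq (hz : z ∉ (periodPair τ).lattice) :
    (periodPair τ).derivWeierstrassP z = -eisE 2 τ z :=
  unique_of_eqOn hz (fun _ hw => weierstrassP_eq hw) (hasDerivAt_weierstrassP _ hz)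
    ((hasDerivAt_eisE hz 1).neg.sub_const _)

/-- This is `℘'' = 6 ℘² - 30 e₄` in terms of `E₁`; the next two formulas are its `z`-derivatives. -/
theorem eisE_three (hz : z ∉ (periodPair τ).lattice) :
    eisE 3 τ z = -6 * (eisE 1 τ z + e2 τ) ^ 2 + 30 * (periodPair τ).G 4 := by
  have h1 : HasDerivAt (periodPair τ).derivWeierstrassP
      (6 * (periodPair τ).weierstrassP z ^ 2 - 30 * (periodPair τ).G 4) z := by
    rw [← deriv_derivWeierstrassP _ hz]
    exact ((periodPair τ).analyticOnNhd_derivWeierstrassP z hz).differentiableAt.hasDerivAt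
  have h2 := unique_of_eqOn hz (fun _ hw => derivWeierstrassP_eq hw) h1 (hasDerivAt_eisE hz 2).neg
  rw [weierstrassP_eq hz] at h2
  norm_num at h2
  linear_combination h2

theorem eisE_four (hz : z ∉ (periodPair τ).lattice) :
    eisE 4 τ z = -12 * (eisE 1 τ z + e2 τ) * eisE 2 τ z := by
  have h1 := (((hasDerivAt_eisE hz 1).add_const (e2 τ)).fun_pow 2).const_mul (-6 : ℂ)
  have h2 := unique_of_eqOn hz (fun _ hw => eisE_three hw) (hasDerivAt_eisE hz 3)
    (h1.add_const (30 * (periodPair τ).G 4))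
  norm_num at h2
  linear_combination h2

theorem eisE_five (hz : z ∉ (periodPair τ).lattice) :
    eisE 5 τ z = -12 * (eisE 2 τ z ^ 2 + (eisE 1 τ z + e2 τ) * eisE 3 τ z) := by
  have h1 := (((hasDerivAt_eisE hz 1).add_const (e2 τ)).const_mul (-12 : ℂ)).mul
    (hasDerivAt_eisE hz 2)
  have h2 := unique_of_eqOn hz (fun _ hw => eisE_four hw) (hasDerivAt_eisE hz 4) h1
  linear_combination h2

theorem hasDerivAt_eisR_of_notMem (hz : z ∉ (periodPair τ).lattice) (j : ℕ) :
    HasDerivAt (eisR j τ) (eisR (j + 1) τ z) z :=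
  hasDerivAt_eisR (add_succ_mul_mem_integerComplement hz)
    (add_succ_mul_mem_integerComplement (neg_notMem_lattice hz)) j

/-- The `z`-derivative of `burgers`. Mixed partials need no separate argument: `eisR j` is the
`τ`-derivative of `eisE j`, and its `z`-derivative is `eisR (j + 1)`. -/
theorem burgers_one (hz : z ∉ (periodPair τ).lattice) :
    (Real.pi : ℂ) / (2 * Complex.I) * eisR 1 τ z =
      -(1 / 4 * (eisE 1 τ z ^ 2 + eisE 0 τ z * eisE 2 τ z)) - 1 / 8 * eisE 3 τ z := by
  have h0 := hasDerivAt_eisE hz 0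
  have h1 := hasDerivAt_eisE hz 1
  have h2 := hasDerivAt_eisE hz 2
  rw [unique_of_eqOn hz (fun _ hw => burgers hw) ((hasDerivAt_eisR_of_notMem hz 0).const_mul _)
    (((h0.mul h1).const_mul (1 / 4)).neg.sub (h2.const_mul (1 / 8)))]
  ring

theorem burgers_two (hz : z ∉ (periodPair τ).lattice) :
    (Real.pi : ℂ) / (2 * Complex.I) * eisR 2 τ z =
      -(1 / 4 * (3 * eisE 1 τ z * eisE 2 τ z + eisE 0 τ z * eisE 3 τ z)) - 1 / 8 * eisE 4 τ z := by
  have h0 := hasDerivAt_eisE hz 0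
  have h1 := hasDerivAt_eisE hz 1
  have h2 := hasDerivAt_eisE hz 2
  have h3 := hasDerivAt_eisE hz 3
  rw [unique_of_eqOn hz (fun _ hw => burgers_one hw) ((hasDerivAt_eisR_of_notMem hz 1).const_mul _)
    ((((h1.fun_pow 2).add (h0.mul h2)).const_mul (1 / 4)).neg.sub (h3.const_mul (1 / 8)))]
  norm_num
  ring

theorem burgers_three (hz : z ∉ (periodPair τ).lattice) :
    (Real.pi : ℂ) / (2 * Complex.I) * eisR 3 τ z =
      -(1 / 4 * (3 * eisE 2 τ z ^ 2 + 4 * eisE 1 τ z * eisE 3 τ z + eisE 0 τ z * eisE 4 τ z)) -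
        1 / 8 * eisE 5 τ z := by
  have h0 := hasDerivAt_eisE hz 0
  have h1 := hasDerivAt_eisE hz 1
  have h2 := hasDerivAt_eisE hz 2
  have h3 := hasDerivAt_eisE hz 3
  have h4 := hasDerivAt_eisE hz 4
  rw [unique_of_eqOn hz (fun _ hw => burgers_two hw) ((hasDerivAt_eisR_of_notMem hz 2).const_mul _)
    (((((h1.const_mul 3).mul h2).add (h0.mul h3)).const_mul (1 / 4)).neg.sub (h4.const_mul (1 / 8)))]
  ring

end DifferentialEquations

/-! ### Ramanujan's formulas, and the action of `d` on the generators. -/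

section RamanujanFormulas

open Filter Topology

variable {τ : ℍ} {z : ℂ}

/-- The Eisenstein series `e₄` as a function of `τ`. -/
noncomputable def e4Fun (τ : ℍ) : ℂ := (periodPair τ).G 4

/-- The Eisenstein series `e₆` as a function of `τ`. -/
noncomputable def e6Fun (τ : ℍ) : ℂ := (periodPair τ).G 6

/-- The Eisenstein series `e₂` as a function of `τ`. -/
noncomputable def e2Fun (τ : ℍ) : ℂ := e2 τ

theorem exists_notMem_lattice (τ : ℍ) : ∃ z, z ∉ (periodPair τ).lattice :=
  ⟨_, (periodPair τ).ω₁_div_two_notMem_lattice⟩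

theorem hasDerivAt_e2Fun (τ : ℍ) :
    HasDerivAt (fun t : ℂ => e2Fun (ofComplex t)) (deriv e2 τ) τ := by
  refine (differentiableAt_e2 τ).hasDerivAt.congr_of_eventuallyEq ?_
  filter_upwards [Complex.continuous_im.continuousAt.eventually_const_lt τ.im_pos] with t ht
  rw [e2Fun, ofComplex_apply_of_im_pos ht]

/-- `eisE_three`, solved for `e₄`, is differentiated in `τ` at fixed `z`. -/
theorem hasDerivAt_e4Fun (hz : z ∉ (periodPair τ).lattice) :
    HasDerivAt (fun t : ℂ => e4Fun (ofComplex t))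
      ((12 * (eisE 1 τ z + e2 τ) * (eisR 1 τ z + deriv e2 τ) + eisR 3 τ z) / 30) τ := by
  have h1 := ((hasDerivAt_eisE_left hz 1).add (differentiableAt_e2 τ).hasDerivAt).fun_pow 2
  have h2 := ((h1.const_mul 6).add (hasDerivAt_eisE_left hz 3)).div_const 30
  refine (h2.congr_deriv (by norm_num; ring)).congr_of_eventuallyEq ?_
  filter_upwards [eventually_mem_domain_left hz] with t ht
  have h3 := eisE_three ht.2
  rw [ofComplex_apply_of_im_pos ht.1] at h3
  change (periodPair _).G 4 = (6 * (eisE 1 t z + e2 t) ^ 2 + eisE 3 t z) / 30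
  rw [ofComplex_apply_of_im_pos ht.1]
  rw [show eisE 3 t z = _ from h3]
  change _ = (6 * (eisE 1 t z + e2 t) ^ 2 + (-6 * (eisE 1 t z + e2 t) ^ 2 + 30 * _)) / 30
  ring

theorem eisE_two_sq (hz : z ∉ (periodPair τ).lattice) :
    eisE 2 τ z ^ 2 = -4 * (eisE 1 τ z + e2 τ) ^ 3 + 60 * e4Fun τ * (eisE 1 τ z + e2 τ) -
      140 * e6Fun τ := by
  have h := (periodPair τ).derivWeierstrassP_sq z hz
  rw [weierstrassP_eq hz, derivWeierstrassP_eq hz, PeriodPair.g₂, PeriodPair.g₃] at h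
  rw [e4Fun, e6Fun]
  linear_combination h

/-- The comparison of the derivatives of both sides of `℘'' = 6 ℘² - 30 e₄`. -/
theorem thirty_mul_modularDeriv_e4Fun (hz : z ∉ (periodPair τ).lattice) :
    30 * modularDeriv e4Fun τ =
      12 * ((Real.pi : ℂ) / (2 * Complex.I) * deriv e2 τ - e2 τ ^ 2 / 4 + 5 / 4 * e4Fun τ) *
        (eisE 1 τ z + e2 τ) - 105 * e6Fun τ + 30 * e2 τ * e4Fun τ := by
  have h1 := burgers_one hz
  have h3 := burgers_three hz
  rw [eisE_five hz, eisE_four hz] at h3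
  rw [eisE_three hz, ← e4Fun] at h1 h3
  rw [modularDeriv, (hasDerivAt_e4Fun hz).deriv]
  -- The terms with the factor `E₁` cancel between `h1` and `h3`; the remaining `3 / 4 * eisE 2 ^ 2`
  -- is eliminated by the Weierstrass equation.
  linear_combination 12 * (eisE 1 τ z + e2 τ) * h1 + h3 + (3 / 4 : ℂ) * eisE_two_sq hz

/-- In `thirty_mul_modularDeriv_e4Fun` only the factor `eisE 1 τ z + e2 τ = -℘` depends on `z`.
Since `℘` is not constant, its coefficient vanishes; the constant term then gives the derivative of
`e₄`. -/
theorem modularDeriv_e2Fun (τ : ℍ) :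
    modularDeriv e2Fun τ = e2Fun τ ^ 2 / 4 - 5 / 4 * e4Fun τ := by
  rw [modularDeriv, (hasDerivAt_e2Fun τ).deriv, e2Fun]
  set c := (Real.pi : ℂ) / (2 * Complex.I) * deriv e2 τ - e2 τ ^ 2 / 4 + 5 / 4 * e4Fun τ with hc
  obtain ⟨z, hz, hne⟩ := exists_derivWeierstrassP_ne_zero (periodPair τ)
  have h1 : HasDerivAt (fun w => 12 * c * (eisE 1 τ w + e2 τ)) (12 * c * eisE 2 τ z) z :=
    ((hasDerivAt_eisE hz 1).add_const _).const_mul _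
  have h2 := unique_of_eqOn hz (fun w hw => by
    have := thirty_mul_modularDeriv_e4Fun hw
    rw [← hc] at this
    show 12 * c * (eisE 1 τ w + e2 τ) =
      30 * modularDeriv e4Fun τ + 105 * e6Fun τ - 30 * e2 τ * e4Fun τ
    linear_combination -this) h1 (hasDerivAt_const z _)
  rw [derivWeierstrassP_eq hz, neg_ne_zero] at hne
  have h3 : c = 0 := by
    rcases mul_eq_zero.1 h2 with h | h
    · exact (mul_eq_zero.1 h).resolve_left (by norm_num)
    · exact absurd h hne
  linear_combination h3 - hc

theorem modularDeriv_e4Fun (τ : ℍ) :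
    modularDeriv e4Fun τ = -(7 / 2) * e6Fun τ + e2Fun τ * e4Fun τ := by
  obtain ⟨z, hz⟩ := exists_notMem_lattice τ
  have h1 := thirty_mul_modularDeriv_e4Fun hz
  have h2 := modularDeriv_e2Fun τ
  rw [modularDeriv, (hasDerivAt_e2Fun τ).deriv] at h2
  rw [e2Fun] at h2 ⊢
  linear_combination h1 / 30 + (2 / 5 : ℂ) * (eisE 1 τ z + e2 τ) * h2

theorem dz_wp_apply (p : domain) : dz wp p = -eisE 2 p.1.1 p.1.2 :=
  (hasPartials_of_forall (F := fun t z => -eisE 1 t z - e2 t) (fun p => weierstrassP_eq p.2)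
    ((hasDerivAt_eisE p.2 1).neg.sub_const _)
    ((hasDerivAt_eisE_left p.2 1).neg.sub (differentiableAt_e2 p.1.1).hasDerivAt)).dz_apply

theorem hasPartials_wp (p : domain) :
    HasPartials wp p (-eisE 2 p.1.1 p.1.2) (-eisR 1 p.1.1 p.1.2 - deriv e2 p.1.1) :=
  hasPartials_of_forall (F := fun t z => -eisE 1 t z - e2 t) (fun p => weierstrassP_eq p.2)
    ((hasDerivAt_eisE p.2 1).neg.sub_const _)
    ((hasDerivAt_eisE_left p.2 1).neg.sub (differentiableAt_e2 p.1.1).hasDerivAt)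

theorem hasPartials_dz_wp (p : domain) :
    HasPartials (dz wp) p (-eisE 3 p.1.1 p.1.2) (-eisR 2 p.1.1 p.1.2) :=
  hasPartials_of_forall (F := fun t z => -eisE 2 t z) dz_wp_apply
    (hasDerivAt_eisE p.2 2).neg (hasDerivAt_eisE_left p.2 2).neg

theorem hasPartials_ofTau {f : ℍ → ℂ} {p : domain} {b : ℂ}
    (hb : HasDerivAt (fun t : ℂ => f (ofComplex t)) b p.1.1) : HasPartials (ofTau f) p 0 b :=
  hasPartials_of_forall (F := fun t _ => f (ofComplex t)) (fun p => by simp [ofTau])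
    (hasDerivAt_const _ _) hb

theorem wp_apply (p : domain) : wp p = -eisE 1 p.1.1 p.1.2 - e2Fun p.1.1 := weierstrassP_eq p.2

theorem e4_eq_ofTau : e4 = ofTau e4Fun := rfl

/-- The term `E₁ ∂_z / 4` of `d` cancels the product `eisE 0 * eisE 2` of `burgers_one`, so that
`E₁` disappears from the result. -/
theorem d_wp (p : domain) :
    d wp p = -(1 / 2) * wp p ^ 2 + 5 * ofTau e4Fun p + 1 / 2 * ofTau e2Fun p * wp p := by
  have h1 := burgers_one p.2
  rw [eisE_three p.2, ← e4Fun] at h1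
  have h2 := modularDeriv_e2Fun p.1.1
  rw [modularDeriv, (hasDerivAt_e2Fun _).deriv] at h2
  rw [(hasPartials_wp p).d_apply, E1_apply, wp_apply, ofTau, ofTau]
  rw [e2Fun] at h2 ⊢
  linear_combination -h1 - h2

theorem d_dz_wp (p : domain) :
    d (dz wp) p = -(3 / 4) * wp p * dz wp p + 3 / 4 * ofTau e2Fun p * dz wp p := by
  have h1 := burgers_two p.2
  rw [eisE_four p.2] at h1
  rw [(hasPartials_dz_wp p).d_apply, E1_apply, wp_apply, dz_wp_apply, ofTau]
  rw [e2Fun] at ⊢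
  linear_combination -h1

/-- On functions of `τ` the derivation `d` is `∂_τ`. -/
theorem d_ofTau (f : ℍ → ℂ) : d (ofTau f) = ofTau (modularDeriv f) := by
  ext p
  obtain ⟨⟨τ, z⟩, hp⟩ := p
  have h1 : dz (ofTau f) ⟨(τ, z), hp⟩ = 0 := by
    refine HasDerivAt.deriv ((hasDerivAt_const z (f τ)).congr_of_eventuallyEq ?_)
    filter_upwards [eventually_mem_domain_right hp] with w hw
    rw [extendZero_apply _ hw, ofTau]
  have h2 : dtau (ofTau f) ⟨(τ, z), hp⟩ = modularDeriv f τ := by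
    rw [dtau, modularDeriv]
    congr 1
    refine Filter.EventuallyEq.deriv_eq ?_
    filter_upwards [eventually_mem_domain_left hp] with t ht
    rw [extendZero_apply _ ht.2, ofTau]
  rw [d, Pi.add_apply, h2, Pi.smul_apply, Pi.mul_apply, h1]
  simp [ofTau]

/-- The Weierstrass equation. -/
theorem ofTau_e6Fun (p : domain) : ofTau e6Fun p =
    1 / 140 * (4 * wp p ^ 3 - 60 * ofTau e4Fun p * wp p - dz wp p ^ 2) := by
  have h := eisE_two_sq p.2
  rw [wp_apply, dz_wp_apply, ofTau, ofTau, e2Fun]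
  linear_combination (1 / 140 : ℂ) * h

theorem hasPartials_ofTau_e4Fun (p : domain) : ∃ b, HasPartials (ofTau e4Fun) p 0 b :=
  ⟨_, hasPartials_ofTau (hasDerivAt_e4Fun p.2)⟩

theorem hasPartials_ofTau_e2Fun (p : domain) : ∃ b, HasPartials (ofTau e2Fun) p 0 b :=
  ⟨_, hasPartials_ofTau (hasDerivAt_e2Fun _)⟩

end RamanujanFormulas

/-! ### Brackets on a subring that the derivation need not preserve. -/

section QuasiModel

open MvPolynomial Finset

variable {σ : Type*} (w : σ → ℕ) (p : σ → MvPolynomial σ ℂ) (q : MvPolynomial σ ℂ)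

/-- Weights of the variables of `σ` and of a further variable of weight two. -/
def optionWt : Option σ → ℕ := fun i => i.elim 2 w

/-- The derivation of `ℂ[σ][φ]` with `D x = p x + (wt x) φ x` and `D φ = φ ^ 2 + q`. -/
noncomputable def quasiDerivation :
    Derivation ℂ (MvPolynomial (Option σ) ℂ) (MvPolynomial (Option σ) ℂ) :=
  mkDerivation ℂ fun i => i.elim (X none ^ 2 + rename some q)
    fun i => rename some (p i) + (w i : ℂ) • (X none * X (some i))

/-- The specialization of the additional variable to zero. -/
noncomputable def dropNone : MvPolynomial (Option σ) ℂ →ₐ[ℂ] MvPolynomial σ ℂ :=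
  aeval fun i => i.elim 0 X

theorem dropNone_rename (f : MvPolynomial σ ℂ) : dropNone (rename some f) = f := by
  rw [dropNone, aeval_rename]
  exact DFunLike.congr_fun aeval_X_left f

theorem pderiv_none_rename (f : MvPolynomial σ ℂ) :
    pderiv (R := ℂ) (none : Option σ) (rename some f) = 0 := by
  classical
  refine pderiv_eq_zero_of_notMem_vars fun h => ?_
  have := vars_rename some f h
  simp at this

theorem rename_dropNone {F : MvPolynomial (Option σ) ℂ} (hF : pderiv (R := ℂ) none F = 0) :
    rename some (dropNone F) = F := by
  obtain ⟨f, rfl⟩ := exists_rename_eq_of_vars_subset_range F some (Option.some_injective σ)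
    (fun i hi => by
      rcases i with _ | i
      · exact absurd hi (notMem_vars_of_pderiv_eq_zero hF)
      · exact ⟨i, rfl⟩)
  rw [dropNone_rename]

variable {w p q}

theorem weight_mapDomain_some (d : σ →₀ ℕ) :
    Finsupp.weight (optionWt w) (d.mapDomain some) = Finsupp.weight w d := by
  rw [Finsupp.weight_apply, Finsupp.weight_apply,
    Finsupp.sum_mapDomain_index (by simp) (fun i a b => add_smul a b _)]
  rfl

theorem isWeightedHomogeneous_rename_iff {f : MvPolynomial σ ℂ} {k : ℕ} :
    IsWeightedHomogeneous (optionWt w) (rename some f) k ↔ IsWeightedHomogeneous w f k := by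
  constructor
  · intro h d hd
    rw [← weight_mapDomain_some]
    exact h (by rwa [coeff_rename_mapDomain _ (Option.some_injective σ)])
  · intro h d hd
    obtain ⟨e, rfl, he⟩ := coeff_rename_ne_zero _ _ _ hd
    rw [weight_mapDomain_some]
    exact h he

/-- The brackets on `ℂ[σ]` for the derivation `quasiDerivation w p q`. -/
noncomputable def quasiBracket (w : σ → ℕ) (p : σ → MvPolynomial σ ℂ) (q : MvPolynomial σ ℂ)
    (n : ℕ) : MvPolynomial σ ℂ →ₗ[ℂ] MvPolynomial σ ℂ →ₗ[ℂ] MvPolynomial σ ℂ :=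
  ((polyBracket (optionWt w) (quasiDerivation w p q) n).compl₁₂ (rename some).toLinearMap
    (rename some).toLinearMap).compr₂ dropNone.toLinearMap

theorem quasiBracket_apply (n : ℕ) (f g : MvPolynomial σ ℂ) :
    quasiBracket w p q n f g = dropNone
      (polyBracket (optionWt w) (quasiDerivation w p q) n (rename some f) (rename some g)) := rfl

section

variable (hp : ∀ i, IsWeightedHomogeneous w (p i) (w i + 2)) (hq : IsWeightedHomogeneous w q 4)

include hp hq

theorem isWeightedHomogeneous_quasiDerivation (i : Option σ) :
    IsWeightedHomogeneous (optionWt w) (quasiDerivation w p q (X i)) (optionWt w i + 2) := by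
  have hX := fun i => isWeightedHomogeneous_X ℂ (optionWt w) i
  rw [quasiDerivation, mkDerivation_X]
  rcases i with _ | i
  · exact ((hX none).pow 2).add (isWeightedHomogeneous_rename_iff.2 hq)
  · refine (isWeightedHomogeneous_rename_iff.2 (hp i)).add ?_
    rw [smul_eq_C_mul]
    have := ((hX none).mul (hX (some i))).C_mul (w i : ℂ)
    rwa [add_comm] at this

omit hp hq in
-- The coefficients of `φ x` and `φ ^ 2` are chosen for this: `∂_φ` turns them into `(wt x) x` and
-- `2 φ`, and `φ` has weight two.
theorem lie_pderiv_quasiDerivation :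
    ⁅pderiv (R := ℂ) (none : Option σ), quasiDerivation w p q⁆ = eulerDerivation (optionWt w) := by
  refine derivation_ext fun i => ?_
  rw [Derivation.commutator_apply, eulerDerivation, mkDerivation_X]
  rcases i with _ | i
  · simp [quasiDerivation, pderiv_none_rename, optionWt, Derivation.leibniz_pow, two_smul]
  · have h0 : pderiv (R := ℂ) (none : Option σ) (X (some i)) = 0 :=
      pderiv_X_of_ne (Option.some_ne_none i)
    simp [quasiDerivation, pderiv_none_rename, optionWt, h0]

/-- Nothing is lost in setting `φ = 0`: by `pderiv_polyRankinCohen` the bracket does not involve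
`φ`. Hence associativity restricts to the subring. -/
theorem rename_quasiBracket (n : ℕ) (f g : MvPolynomial σ ℂ) :
    rename some (quasiBracket w p q n f g) =
      polyBracket (optionWt w) (quasiDerivation w p q) n (rename some f) (rename some g) := by
  refine rename_dropNone ?_
  induction f using MvPolynomial.induction_on' with
  | add f f' h h' => simp only [map_add, LinearMap.add_apply, h, h', add_zero]
  | monomial d a =>
    induction g using MvPolynomial.induction_on' with
    | add g g' h h' => simp only [map_add, h, h', add_zero]
    | monomial e b =>
      have hf := isWeightedHomogeneous_rename_iff.2
        (isWeightedHomogeneous_monomial w d a rfl)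
      have hg := isWeightedHomogeneous_rename_iff.2
        (isWeightedHomogeneous_monomial w e b rfl)
      change pderiv none (polyBracket (optionWt w) (quasiDerivation w p q) n
        (rename some (monomial d a)) (rename some (monomial e b))) = 0
      rw [polyBracket_eq hf hg]
      exact pderiv_polyRankinCohen (isWeightedHomogeneous_quasiDerivation hp hq)
        lie_pderiv_quasiDerivation n hf hg (pderiv_none_rename _) (pderiv_none_rename _)

theorem isWeightedHomogeneous_quasiBracket {k l : ℕ} (n : ℕ) {f g : MvPolynomial σ ℂ}
    (hf : IsWeightedHomogeneous w f k) (hg : IsWeightedHomogeneous w g l) :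
    IsWeightedHomogeneous w (quasiBracket w p q n f g) (k + l + 2 * n) := by
  have hf' := isWeightedHomogeneous_rename_iff.2 hf
  have hg' := isWeightedHomogeneous_rename_iff.2 hg
  rw [← isWeightedHomogeneous_rename_iff, rename_quasiBracket hp hq, polyBracket_eq hf' hg']
  exact isWeightedHomogeneous_polyRankinCohen (isWeightedHomogeneous_quasiDerivation hp hq) n hf' hg'

theorem quasiBracket_assoc (n : ℕ) (f g h : MvPolynomial σ ℂ) :
    ∑ a ∈ antidiagonal n, quasiBracket w p q a.1 (quasiBracket w p q a.2 f g) h =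
      ∑ a ∈ antidiagonal n, quasiBracket w p q a.1 f (quasiBracket w p q a.2 g h) := by
  have h1 := polyBracket_assoc (isWeightedHomogeneous_quasiDerivation hp hq) n
    (rename some f) (rename some g) (rename some h)
  simp only [← rename_quasiBracket hp hq, ← map_sum] at h1
  exact rename_injective _ (Option.some_injective σ) h1

omit hp hq in
theorem quasiBracket_zero (f g : MvPolynomial σ ℂ) : quasiBracket w p q 0 f g = f * g := by
  rw [quasiBracket_apply, polyBracket_zero, ← map_mul, dropNone_rename]

variable {X : Type*}

/-- If the evaluation `ev` carries `quasiDerivation w p q` to `δ`, then it carries the brackets of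
homogeneous polynomials to the Rankin–Cohen brackets for `δ`. -/
theorem rankinCohen_eq_quasiBracket {ev : MvPolynomial (Option σ) ℂ →ₐ[ℂ] (X → ℂ)}
    {δ : (X → ℂ) → X → ℂ} (hδ : ∀ F, δ (ev F) = ev (quasiDerivation w p q F)) {k l : ℕ} (n : ℕ)
    {f g : MvPolynomial σ ℂ} (hf : IsWeightedHomogeneous w f k) (hg : IsWeightedHomogeneous w g l) :
    rankinCohen δ k l n (ev (rename some f)) (ev (rename some g)) =
      ev (rename some (quasiBracket w p q n f g)) := by
  have hit : ∀ (r : ℕ) F, δ^[r] (ev F) = ev ((quasiDerivation w p q)^[r] F) := fun r F =>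
    ((Function.Semiconj.iterate_right (f := ev) (ga := quasiDerivation w p q) (gb := δ)
      (fun F => (hδ F).symm) r) F).symm
  rw [rename_quasiBracket hp hq, polyBracket_eq (isWeightedHomogeneous_rename_iff.2 hf)
    (isWeightedHomogeneous_rename_iff.2 hg), polyRankinCohen, map_sum, rankinCohen]
  refine sum_congr rfl fun r _ => ?_
  rw [map_smul, map_mul, hit, hit]

end

/-- The criterion for an evaluation to carry a derivation of polynomials to an operation `δ` that
is a derivation on a subalgebra. -/
theorem map_derivation_eq {σ X : Type*} {ev : MvPolynomial σ ℂ →ₐ[ℂ] (X → ℂ)}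
    {D : Derivation ℂ (MvPolynomial σ ℂ) (MvPolynomial σ ℂ)} {δ : (X → ℂ) → X → ℂ}
    {N : Subalgebra ℂ (X → ℂ)} (hadd : ∀ f ∈ N, ∀ g ∈ N, δ (f + g) = δ f + δ g)
    (hmul : ∀ f ∈ N, ∀ g ∈ N, δ (f * g) = f * δ g + g * δ f)
    (hconst : ∀ c : ℂ, δ (algebraMap ℂ (X → ℂ) c) = 0) (hN : ∀ i, ev (MvPolynomial.X i) ∈ N)
    (hX : ∀ i, δ (ev (MvPolynomial.X i)) = ev (D (MvPolynomial.X i))) (F : MvPolynomial σ ℂ) :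
    δ (ev F) = ev (D F) := by
  have hmem : ∀ F, ev F ∈ N := fun F => by
    induction F using MvPolynomial.induction_on with
    | C a =>
      rw [← MvPolynomial.algebraMap_eq, AlgHom.commutes]
      exact N.algebraMap_mem a
    | add f g hf hg =>
      rw [map_add]
      exact N.add_mem hf hg
    | mul_X f i hf =>
      rw [map_mul]
      exact N.mul_mem hf (hN i)
  induction F using MvPolynomial.induction_on with
  | C a => rw [← MvPolynomial.algebraMap_eq, AlgHom.commutes, hconst, Derivation.map_algebraMap,
      map_zero]
  | add f g hf hg => rw [map_add, hadd _ (hmem f) _ (hmem g), hf, hg, map_add, map_add]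
  | mul_X f i hf => rw [map_mul, hmul _ (hmem f) _ (hN i), hf, hX, Derivation.leibniz, map_add,
      smul_eq_mul, smul_eq_mul, map_mul, map_mul]

end QuasiModel

/-! ### Separating the weighted components of a polynomial by rescaling a point. -/

section WeightedEvaluation

open MvPolynomial

variable {σ : Type*} (w : σ → ℕ)

/-- The one-variable polynomial that collects the values at `x` of the weighted homogeneous
components of a polynomial. -/
noncomputable def componentPoly (x : σ → ℂ) : MvPolynomial σ ℂ →ₐ[ℂ] Polynomial ℂ :=
  aeval fun i => Polynomial.C (x i) * Polynomial.X ^ w i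

theorem eval_componentPoly (x : σ → ℂ) (c : ℂ) (F : MvPolynomial σ ℂ) :
    (componentPoly w x F).eval c = aeval (fun i => c ^ w i * x i) F := by
  have h : (Polynomial.aeval c).comp (componentPoly w x) =
      (aeval (fun i => c ^ w i * x i) : MvPolynomial σ ℂ →ₐ[ℂ] ℂ) := by
    ext i
    simp only [componentPoly, AlgHom.comp_apply, aeval_X, map_mul, map_pow, Polynomial.aeval_C,
      Polynomial.aeval_X, Algebra.algebraMap_self, RingHom.id_apply]
    ring
  rw [← h]
  rfl

theorem coeff_componentPoly (x : σ → ℂ) (k : ℕ) (F : MvPolynomial σ ℂ) :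
    (componentPoly w x F).coeff k = aeval x (weightedHomogeneousComponent w k F) := by
  induction F using MvPolynomial.induction_on' with
  | add f g hf hg => rw [map_add, Polynomial.coeff_add, hf, hg, map_add, map_add]
  | monomial d a =>
    rw [weightedHomogeneousComponent_of_mem
      ((mem_weightedHomogeneousSubmodule ℂ w _ _).2 (isWeightedHomogeneous_monomial w d a rfl))]
    have h : componentPoly w x (monomial d a) =
        Polynomial.C (aeval x (monomial d a)) * Polynomial.X ^ (Finsupp.weight w d) := by
      simp only [componentPoly, aeval_monomial, mul_pow, Finset.prod_mul_distrib, map_mul, Finsupp.prod,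
        Finsupp.weight_apply, Finsupp.sum, ← pow_mul, Finset.prod_pow_eq_pow_sum, map_prod,
        map_pow, Polynomial.algebraMap_eq, smul_eq_mul, mul_comm (w _), mul_assoc,
        Algebra.algebraMap_self, RingHom.id_apply]
    rw [h, Polynomial.coeff_C_mul_X_pow]
    split_ifs <;> simp

/-- If a polynomial vanishes at infinitely many rescalings of a point, then its homogeneous
components vanish at this point. -/
theorem aeval_weightedHomogeneousComponent_eq_zero {x : σ → ℂ} {F : MvPolynomial σ ℂ} {S : Set ℂ}
    (hS : S.Infinite) (h : ∀ c ∈ S, aeval (fun i => c ^ w i * x i) F = 0) (k : ℕ) :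
    aeval x (weightedHomogeneousComponent w k F) = 0 := by
  have h0 : componentPoly w x F = 0 :=
    Polynomial.eq_zero_of_infinite_isRoot _ (hS.mono fun c hc => by
      rw [Set.mem_ofPred_eq, Polynomial.IsRoot, eval_componentPoly]
      exact h c hc)
  rw [← coeff_componentPoly, h0, Polynomial.coeff_zero]

end WeightedEvaluation

/-! ### Homogeneity of `℘`, `℘'` and `G` under scaling of the lattice. -/

section Scaling

/-- The equivalence of two lattices that differ by a complex factor. -/
noncomputable def latticeScale {L L' : PeriodPair} {j : ℂ} (hj : j ≠ 0)
    (h : ∀ x, x ∈ L.lattice ↔ x / j ∈ L'.lattice) : L.lattice ≃ L'.lattice where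
  toFun l := ⟨l / j, (h _).1 l.2⟩
  invFun l := ⟨l * j, (h _).2 (by rw [mul_div_cancel_right₀ _ hj]; exact l.2)⟩
  left_inv l := Subtype.ext (div_mul_cancel₀ _ hj)
  right_inv l := Subtype.ext (mul_div_cancel_right₀ _ hj)

variable {L L' : PeriodPair} {j : ℂ} (hj : j ≠ 0) (h : ∀ x, x ∈ L.lattice ↔ x / j ∈ L'.lattice)

include hj h

theorem weierstrassP_scale (z : ℂ) : L'.weierstrassP (z / j) = j ^ 2 * L.weierstrassP z := by
  rw [PeriodPair.weierstrassP, PeriodPair.weierstrassP, ← (latticeScale hj h).tsum_eq,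
    ← tsum_mul_left]
  refine tsum_congr fun l => ?_
  change 1 / (z / j - l / j) ^ 2 - 1 / (l / j : ℂ) ^ 2 = _
  rw [← sub_div, div_pow, div_pow, one_div_div, one_div_div]
  ring

theorem derivWeierstrassP_scale (z : ℂ) :
    L'.derivWeierstrassP (z / j) = j ^ 3 * L.derivWeierstrassP z := by
  rw [PeriodPair.derivWeierstrassP, PeriodPair.derivWeierstrassP, ← (latticeScale hj h).tsum_eq,
    mul_neg, ← tsum_mul_left]
  congr 1
  refine tsum_congr fun l => ?_
  change 2 / (z / j - l / j) ^ 3 = _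
  rw [← sub_div, div_pow, div_div_eq_mul_div]
  ring

theorem G_scale (n : ℕ) : L'.G n = j ^ n * L.G n := by
  rw [PeriodPair.G, PeriodPair.G, ← (latticeScale hj h).tsum_eq, ← tsum_mul_left]
  refine tsum_congr fun l => ?_
  change ((l / j : ℂ) ^ n)⁻¹ = _
  rw [div_pow, inv_div, div_eq_mul_inv]

end Scaling

/-! ### The substitution `τ ↦ τ / (c τ + 1)`. -/

section Translate

theorem mul_add_one_ne_zero (c : ℕ) (τ : ℍ) : ((c : ℂ) * τ + 1) ≠ 0 := fun h => by
  rcases Nat.eq_zero_or_pos c with rfl | hc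
  · simp at h
  · have := congrArg Complex.im h
    simp [τ.im_pos.ne', hc.ne'] at this

/-- The point `τ / (c τ + 1)` of the upper half-plane. -/
noncomputable def lowerShift (c : ℕ) (τ : ℍ) : ℍ :=
  ⟨τ / (c * τ + 1), by
    have hτ := τ.im_pos
    have h2 := Complex.normSq_pos.2 (mul_add_one_ne_zero c τ)
    rw [Complex.div_im, ← sub_div]
    refine div_pos ?_ h2
    simp only [Complex.add_re, Complex.mul_re, Complex.natCast_re, Complex.natCast_im,
      Complex.add_im, Complex.mul_im, Complex.one_re, Complex.one_im, zero_mul, sub_zero, add_zero]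
    have : (τ : ℂ).im = τ.im := rfl
    nlinarith⟩

/-- `c τ + 1` and `τ` are another basis of `ℤ ⊕ ℤ τ`; division by `c τ + 1` makes it `1` and
`lowerShift c τ`. -/
theorem mem_lattice_lowerShift_iff (c : ℕ) (τ : ℍ) (x : ℂ) :
    x ∈ (periodPair τ).lattice ↔
      x / ((c : ℂ) * τ + 1) ∈ (periodPair (lowerShift c τ)).lattice := by
  have hj := mul_add_one_ne_zero c τ
  have hs : (lowerShift c τ : ℂ) = τ / (c * τ + 1) := rfl
  rw [mem_periodPair_lattice, mem_periodPair_lattice, hs]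
  constructor
  · rintro ⟨m, n, rfl⟩
    refine ⟨m, n - m * c, ?_⟩
    push_cast
    field_simp
    ring
  · rintro ⟨m, n, h⟩
    refine ⟨m, n + m * c, ?_⟩
    rw [eq_div_iff hj] at h
    push_cast
    rw [← h]
    field_simp
    ring

/-- The action of a lower triangular unipotent matrix on the domain. -/
noncomputable def domainShift (c : ℕ) (p : domain) : domain :=
  ⟨(lowerShift c p.1.1, p.1.2 / ((c : ℂ) * p.1.1 + 1)),
    fun h => p.2 ((mem_lattice_lowerShift_iff c p.1.1 p.1.2).2 h)⟩

end Translate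

/-! ### The polynomial model of the derivation `d`. -/

section EllipticModel

open MvPolynomial

/-- The generators `℘`, `∂_z ℘`, `e₄` of the algebra of elliptic forms. -/
noncomputable def ellGen : Fin 3 → Fun := ![wp, dz wp, e4]

/-- The weights of the generators. -/
def ellWt : Fin 3 → ℕ := ![2, 3, 4]

/-- The evaluation of polynomials at the generators. -/
noncomputable def ellEval : MvPolynomial (Fin 3) ℂ →ₐ[ℂ] Fun := aeval ellGen

/-- The derivatives of the generators, up to multiples of `e₂`. -/
noncomputable def ellDeriv : Fin 3 → MvPolynomial (Fin 3) ℂ :=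
  ![C (-1 / 2) * X 0 ^ 2 + C 5 * X 2, C (-3 / 4) * (X 0 * X 1),
    C (-1 / 40) * (C 4 * X 0 ^ 3 - C 60 * (X 2 * X 0) - X 1 ^ 2)]

/-- The inhomogeneous part of the derivative of `e₂ / 4`. -/
noncomputable def ellDerivPhi : MvPolynomial (Fin 3) ℂ := C (-5 / 16) * X 2

/-- The evaluation of polynomials at the generators and at `e₂ / 4`. -/
noncomputable def ellEvalPhi : MvPolynomial (Option (Fin 3)) ℂ →ₐ[ℂ] Fun :=
  aeval fun i => i.elim ((1 / 4 : ℂ) • ofTau e2Fun) ellGen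

theorem ellEvalPhi_rename (f : MvPolynomial (Fin 3) ℂ) :
    ellEvalPhi (rename some f) = ellEval f := by
  rw [ellEvalPhi, aeval_rename]
  rfl

theorem isWeightedHomogeneous_ellDeriv (i : Fin 3) :
    IsWeightedHomogeneous ellWt (ellDeriv i) (ellWt i + 2) := by
  have h0 : IsWeightedHomogeneous ellWt (X 0 : MvPolynomial (Fin 3) ℂ) 2 :=
    isWeightedHomogeneous_X ℂ ellWt 0
  have h1 : IsWeightedHomogeneous ellWt (X 1 : MvPolynomial (Fin 3) ℂ) 3 :=
    isWeightedHomogeneous_X ℂ ellWt 1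
  have h2 : IsWeightedHomogeneous ellWt (X 2 : MvPolynomial (Fin 3) ℂ) 4 :=
    isWeightedHomogeneous_X ℂ ellWt 2
  fin_cases i
  · exact ((h0.pow 2).C_mul _).add (h2.C_mul _)
  · exact (h0.mul h1).C_mul _
  · exact ((((h0.pow 3).C_mul _).sub ((h2.mul h0).C_mul _)).sub (h1.pow 2)).C_mul _

theorem isWeightedHomogeneous_ellDerivPhi : IsWeightedHomogeneous ellWt ellDerivPhi 4 :=
  (isWeightedHomogeneous_X ℂ ellWt 2).C_mul _

/-- The functions with partial derivatives in both variables. -/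
def niceFun : Subalgebra ℂ Fun where
  carrier := {f | ∀ p, ∃ a b, HasPartials f p a b}
  mul_mem' hf hg p := by
    obtain ⟨a, b, h⟩ := hf p
    obtain ⟨a', b', h'⟩ := hg p
    exact ⟨_, _, h.mul h'⟩
  add_mem' hf hg p := by
    obtain ⟨a, b, h⟩ := hf p
    obtain ⟨a', b', h'⟩ := hg p
    exact ⟨_, _, h.add h'⟩
  algebraMap_mem' c p := ⟨_, _, HasPartials.algebraMap p c⟩

/-- On arbitrary functions `deriv` takes default values, and `d` need not be additive; it is used as
a derivation on `niceFun` only. -/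
theorem d_add {f g : Fun} (hf : f ∈ niceFun) (hg : g ∈ niceFun) : d (f + g) = d f + d g := by
  ext p
  obtain ⟨a, b, h⟩ := hf p
  obtain ⟨a', b', h'⟩ := hg p
  rw [(h.add h').d_apply, Pi.add_apply, h.d_apply, h'.d_apply]
  ring

theorem d_mul {f g : Fun} (hf : f ∈ niceFun) (hg : g ∈ niceFun) :
    d (f * g) = f * d g + g * d f := by
  ext p
  obtain ⟨a, b, h⟩ := hf p
  obtain ⟨a', b', h'⟩ := hg p
  rw [(h.mul h').d_apply, Pi.add_apply, Pi.mul_apply, Pi.mul_apply, h.d_apply, h'.d_apply]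
  ring

theorem d_algebraMap (c : ℂ) : d (algebraMap ℂ Fun c) = 0 := by
  ext p
  rw [(HasPartials.algebraMap p c).d_apply]
  simp

theorem ellGen_mem_niceFun (i : Fin 3) : ellGen i ∈ niceFun := by
  intro p
  fin_cases i
  · exact ⟨_, _, hasPartials_wp p⟩
  · exact ⟨_, _, hasPartials_dz_wp p⟩
  · obtain ⟨b, hb⟩ := hasPartials_ofTau_e4Fun p
    exact ⟨_, b, hb⟩

theorem phi_mem_niceFun : (1 / 4 : ℂ) • ofTau e2Fun ∈ niceFun :=
  niceFun.smul_mem (fun p => ⟨0, hasPartials_ofTau_e2Fun p⟩) _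

theorem d_smul (c : ℂ) {f : Fun} (hf : f ∈ niceFun) : d (c • f) = c • d f := by
  rw [Algebra.smul_def, d_mul (niceFun.algebraMap_mem c) hf, d_algebraMap, mul_zero, add_zero,
    Algebra.smul_def]

theorem d_ellEvalPhi (F : MvPolynomial (Option (Fin 3)) ℂ) :
    d (ellEvalPhi F) = ellEvalPhi (quasiDerivation ellWt ellDeriv ellDerivPhi F) := by
  refine map_derivation_eq (N := niceFun) (fun f hf g hg => d_add hf hg)
    (fun f hf g hg => d_mul hf hg) d_algebraMap (fun i => ?_) (fun i => ?_) F
  · rw [ellEvalPhi, aeval_X]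
    rcases i with _ | i
    exacts [phi_mem_niceFun, ellGen_mem_niceFun i]
  · rw [quasiDerivation, mkDerivation_X]
    rcases i with _ | i
    -- For `φ = e₂ / 4` the formula for `∂_τ e₂` reads `d φ = φ ^ 2 - 5 / 16 * e₄`.
    · simp only [Option.elim, map_add, map_pow, ellEvalPhi_rename]
      rw [ellEvalPhi, aeval_X, Option.elim, d_smul _ fun p => ⟨0, hasPartials_ofTau_e2Fun p⟩,
        d_ofTau]
      ext p
      simp [ellDerivPhi, ellEval, ellGen, ofTau, modularDeriv_e2Fun, e4_eq_ofTau]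
      ring
    · simp only [Option.elim, map_add, map_smul, map_mul, ellEvalPhi_rename]
      simp only [ellEvalPhi, aeval_X, Option.elim]
      ext p
      fin_cases i
      · have := d_wp p
        simp [ellDeriv, ellEval, ellGen, e4_eq_ofTau, ellWt, this]
        ring
      · have := d_dz_wp p
        simp [ellDeriv, ellEval, ellGen, ellWt, this]
        ring
      -- The Weierstrass equation replaces `e₆` in `- 7 / 2 * e₆`, whence the factor `- 7 / 2 * 1 /
      -- 140 = - 1 / 40` in `ellDeriv`.
      · have h1 : d e4 p = modularDeriv e4Fun p.1.1 := congrFun (d_ofTau e4Fun) p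
        have h2 := ofTau_e6Fun p
        have h3 := modularDeriv_e4Fun p.1.1
        rw [← h1] at h3
        simp only [ofTau] at h2
        rw [h2] at h3
        simp [ellDeriv, ellEval, ellGen, e4_eq_ofTau, ellWt, ofTau] at h3 ⊢
        rw [h3]
        ring

end EllipticModel

/-! ### The brackets on elliptic forms: existence, uniqueness, associativity. -/

section Brackets

open MvPolynomial

theorem ellEval_apply (F : MvPolynomial (Fin 3) ℂ) (p : domain) :
    ellEval F p = aeval (fun i => ellGen i p) F := by
  have h : (Pi.evalAlgHom ℂ (fun _ : domain => ℂ) p).comp ellEval =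
      aeval fun i => ellGen i p := by
    ext i
    simp [ellEval]
  rw [← h]
  rfl

theorem dz_wp_eq (p : domain) : dz wp p = (periodPair p.1.1).derivWeierstrassP p.1.2 := by
  rw [dz_wp_apply, derivWeierstrassP_eq p.2]

theorem ellGen_domainShift (c : ℕ) (p : domain) (i : Fin 3) :
    ellGen i (domainShift c p) = ((c : ℂ) * p.1.1 + 1) ^ ellWt i * ellGen i p := by
  have hj := mul_add_one_ne_zero c p.1.1
  have h := mem_lattice_lowerShift_iff c p.1.1
  fin_cases i
  · exact weierstrassP_scale hj h _
  · change dz wp _ = _ * dz wp p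
    rw [dz_wp_eq, dz_wp_eq]
    exact derivWeierstrassP_scale hj h _
  · exact G_scale hj h 4

/-- The elliptic forms of different weights are linearly independent. -/
theorem ellEval_weightedHomogeneousComponent_eq_zero {F : MvPolynomial (Fin 3) ℂ}
    (hF : ellEval F = 0) (k : ℕ) : ellEval (weightedHomogeneousComponent ellWt k F) = 0 := by
  ext p
  rw [ellEval_apply]
  refine aeval_weightedHomogeneousComponent_eq_zero ellWt
    (S := Set.range fun c : ℕ => (c : ℂ) * p.1.1 + 1) (Set.infinite_range_of_injective ?_) ?_ k
  -- The factors `c τ + 1` at a fixed point are infinitely many since `τ ≠ 0`.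
  · intro a b hab
    have h1 := mul_right_cancel₀ (UpperHalfPlane.ne_zero p.1.1) (add_right_cancel hab)
    exact_mod_cast h1
  · rintro _ ⟨c, rfl⟩
    have := congrFun hF (domainShift c p)
    rw [ellEval_apply] at this
    simp only [ellGen_domainShift] at this
    exact this

/-- The elliptic forms of weight `k` are the values of the homogeneous polynomials of weight `k`. -/
theorem mem_JSweight_iff {k : ℕ} {f : Fun} :
    f ∈ JSweight k ↔ ∃ F, IsWeightedHomogeneous ellWt F k ∧ ellEval F = f := by
  constructor
  · intro hf
    induction hf using Submodule.span_induction with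
    | mem f hf =>
      obtain ⟨a, b, c, hk, rfl⟩ := hf
      have h0 : IsWeightedHomogeneous ellWt (X 0 : MvPolynomial (Fin 3) ℂ) 2 :=
        isWeightedHomogeneous_X ℂ ellWt 0
      have h1 : IsWeightedHomogeneous ellWt (X 1 : MvPolynomial (Fin 3) ℂ) 3 :=
        isWeightedHomogeneous_X ℂ ellWt 1
      have h2 : IsWeightedHomogeneous ellWt (X 2 : MvPolynomial (Fin 3) ℂ) 4 :=
        isWeightedHomogeneous_X ℂ ellWt 2
      refine ⟨X 0 ^ a * X 1 ^ b * X 2 ^ c, ?_, by simp [ellEval, ellGen]⟩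
      have := ((h0.pow a).mul (h1.pow b)).mul (h2.pow c)
      simp only [smul_eq_mul] at this
      convert this using 1
      omega
    | zero => exact ⟨0, isWeightedHomogeneous_zero ℂ ellWt k, map_zero _⟩
    | add f g _ _ hf hg =>
      obtain ⟨F, hF, rfl⟩ := hf
      obtain ⟨G, hG, rfl⟩ := hg
      exact ⟨F + G, hF.add hG, map_add _ _ _⟩
    | smul c f _ hf =>
      obtain ⟨F, hF, rfl⟩ := hf
      exact ⟨C c * F, hF.C_mul c, by rw [← smul_eq_C_mul, map_smul]⟩
  · rintro ⟨F, hF, rfl⟩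
    induction hF using IsWeightedHomogeneous.induction_on with
    | zero => simp
    | add p q _ _ hp hq =>
      rw [map_add]
      exact add_mem hp hq
    | monomial d r hr =>
      rw [ellEval, aeval_monomial, ← Algebra.smul_def]
      refine Submodule.smul_mem _ _ (Submodule.subset_span ⟨d 0, d 1, d 2, ?_, ?_⟩)
      · rw [← hr, Finsupp.weight_apply, Finsupp.sum_fintype _ _ (by simp), Fin.sum_univ_three]
        simp [ellWt, mul_comm]
      · rw [Finsupp.prod_fintype _ _ (by simp), Fin.prod_univ_three]
        rfl

theorem JS_eq_range : JS = ellEval.range := by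
  rw [JS, ellEval, ← Algebra.adjoin_range_eq_range_aeval]
  congr 1
  ext f
  simp only [Set.mem_insert_iff, Set.mem_singleton_iff, Set.mem_range, Fin.exists_fin_succ]
  simp [ellGen, eq_comm]

theorem ellEval_mem_JS (F : MvPolynomial (Fin 3) ℂ) : ellEval F ∈ JS := by
  rw [JS_eq_range]
  exact ⟨F, rfl⟩

/-- The evaluation of polynomials as a map to the algebra of elliptic forms. -/
noncomputable def toJS : MvPolynomial (Fin 3) ℂ →ₐ[ℂ] JS := ellEval.codRestrict JS ellEval_mem_JS

theorem toJS_surjective : Function.Surjective toJS := by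
  rintro ⟨f, hf⟩
  rw [JS_eq_range] at hf
  obtain ⟨F, rfl⟩ := hf
  exact ⟨F, rfl⟩

/-- The brackets on the polynomials in the generators. -/
noncomputable def ellBracket (n : ℕ) :
    MvPolynomial (Fin 3) ℂ →ₗ[ℂ] MvPolynomial (Fin 3) ℂ →ₗ[ℂ] MvPolynomial (Fin 3) ℂ :=
  quasiBracket ellWt ellDeriv ellDerivPhi n

theorem ellEval_ellBracket {k l : ℕ} (n : ℕ) {F G : MvPolynomial (Fin 3) ℂ}
    (hF : IsWeightedHomogeneous ellWt F k) (hG : IsWeightedHomogeneous ellWt G l) :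
    ellEval (ellBracket n F G) = rankinCohen d k l n (ellEval F) (ellEval G) := by
  rw [← ellEvalPhi_rename, ← ellEvalPhi_rename F, ← ellEvalPhi_rename G]
  exact (rankinCohen_eq_quasiBracket isWeightedHomogeneous_ellDeriv
    isWeightedHomogeneous_ellDerivPhi d_ellEvalPhi n hF hG).symm

/-- Bilinear maps on polynomials are equal if they agree on the homogeneous components. -/
theorem bilin_eq_of_components {σ M : Type*} [AddCommMonoid M] [Module ℂ M] (w : σ → ℕ)
    (b b' : MvPolynomial σ ℂ →ₗ[ℂ] MvPolynomial σ ℂ →ₗ[ℂ] M) (F G : MvPolynomial σ ℂ)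
    (h : ∀ k l, b (weightedHomogeneousComponent w k F) (weightedHomogeneousComponent w l G) =
      b' (weightedHomogeneousComponent w k F) (weightedHomogeneousComponent w l G)) :
    b F G = b' F G := by
  rw [← sum_weightedHomogeneousComponent w F, ← sum_weightedHomogeneousComponent w G,
    finsum_eq_sum _ (weightedHomogeneousComponent_finsupp F),
    finsum_eq_sum _ (weightedHomogeneousComponent_finsupp G)]
  simp only [map_sum, LinearMap.sum_apply, h]

/-- This replaces algebraic independence of the generators. The kernel of the evaluation is
homogeneous, and on homogeneous arguments the value of a bracket depends only on the values of the
arguments, so a component in the kernel may be replaced by the zero polynomial. -/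
theorem toJS_ellBracket_eq_zero (n : ℕ) {F G : MvPolynomial (Fin 3) ℂ}
    (h : toJS F = 0 ∨ toJS G = 0) : toJS (ellBracket n F G) = 0 := by
  refine bilin_eq_of_components ellWt ((ellBracket n).compr₂ toJS.toLinearMap) 0 F G
    fun k l => ?_
  have hk := weightedHomogeneousComponent_isWeightedHomogeneous (w := ellWt) k F
  have hl := weightedHomogeneousComponent_isWeightedHomogeneous (w := ellWt) l G
  refine Subtype.ext ?_
  change ellEval (ellBracket n _ _) = 0
  rw [ellEval_ellBracket n hk hl]
  rcases h with h | h
  · rw [ellEval_weightedHomogeneousComponent_eq_zero (congrArg Subtype.val h) k,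
      ← map_zero ellEval, ← ellEval_ellBracket n (isWeightedHomogeneous_zero ℂ ellWt k) hl]
    simp
  · rw [ellEval_weightedHomogeneousComponent_eq_zero (congrArg Subtype.val h) l,
      ← map_zero ellEval, ← ellEval_ellBracket n hk (isWeightedHomogeneous_zero ℂ ellWt l)]
    simp

/-- The brackets of polynomials descend to the elliptic forms. -/
theorem exists_bracket : ∃ B : ℕ → JS →ₗ[ℂ] JS →ₗ[ℂ] JS,
    ∀ n F G, B n (toJS F) (toJS G) = toJS (ellBracket n F G) := by
  obtain ⟨s, hs⟩ := toJS.toLinearMap.exists_rightInverse_of_surjective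
    (LinearMap.range_eq_top.2 toJS_surjective)
  refine ⟨fun n => ((ellBracket n).compl₁₂ s s).compr₂ toJS.toLinearMap, fun n F G => ?_⟩
  have hs' : ∀ f, toJS (s f) = f := fun f => LinearMap.congr_fun hs f
  change toJS (ellBracket n (s (toJS F)) (s (toJS G))) = _
  have h1 : toJS (ellBracket n (s (toJS F) - F) (s (toJS G))) = 0 :=
    toJS_ellBracket_eq_zero n (.inl (by rw [map_sub, hs', sub_self]))
  have h2 : toJS (ellBracket n F (s (toJS G) - G)) = 0 :=
    toJS_ellBracket_eq_zero n (.inr (by rw [map_sub, hs', sub_self]))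
  rw [map_sub, LinearMap.sub_apply, map_sub, sub_eq_zero] at h1
  rw [map_sub, map_sub, sub_eq_zero] at h2
  rw [h1, h2]

theorem rankinCohen_mem_JS {n k l : ℕ} {f g : Fun} (hf : f ∈ JSweight k) (hg : g ∈ JSweight l) :
    rankinCohen d k l n f g ∈ JS := by
  obtain ⟨F, hF, rfl⟩ := mem_JSweight_iff.1 hf
  obtain ⟨G, hG, rfl⟩ := mem_JSweight_iff.1 hg
  rw [← ellEval_ellBracket n hF hG]
  exact ellEval_mem_JS _

variable {B : ℕ → JS →ₗ[ℂ] JS →ₗ[ℂ] JS}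

theorem isBracketSequence_of_toJS
    (hB : ∀ n F G, B n (toJS F) (toJS G) = toJS (ellBracket n F G)) : IsBracketSequence B := by
  rintro n k l ⟨f, hf⟩ ⟨g, hg⟩ hfk hgl
  obtain ⟨F, hF, rfl⟩ := mem_JSweight_iff.1 hfk
  obtain ⟨G, hG, rfl⟩ := mem_JSweight_iff.1 hgl
  exact (congrArg Subtype.val (hB n F G)).trans (ellEval_ellBracket n hF hG)

theorem IsBracketSequence.unique {B' : ℕ → JS →ₗ[ℂ] JS →ₗ[ℂ] JS} (hB : IsBracketSequence B)
    (hB' : IsBracketSequence B') : B' = B := by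
  ext1 n
  refine LinearMap.ext₂ fun f g => ?_
  obtain ⟨F, rfl⟩ := toJS_surjective f
  obtain ⟨G, rfl⟩ := toJS_surjective g
  refine bilin_eq_of_components ellWt ((B' n).compl₁₂ toJS.toLinearMap toJS.toLinearMap)
    ((B n).compl₁₂ toJS.toLinearMap toJS.toLinearMap) F G fun k l => ?_
  have hk : (toJS (weightedHomogeneousComponent ellWt k F) : Fun) ∈ JSweight k :=
    mem_JSweight_iff.2 ⟨_, weightedHomogeneousComponent_isWeightedHomogeneous k F, rfl⟩
  have hl : (toJS (weightedHomogeneousComponent ellWt l G) : Fun) ∈ JSweight l :=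
    mem_JSweight_iff.2 ⟨_, weightedHomogeneousComponent_isWeightedHomogeneous l G, rfl⟩
  exact Subtype.ext ((hB' n k l _ _ hk hl).trans (hB n k l _ _ hk hl).symm)

theorem isFormalDeformation_of_toJS
    (hB : ∀ n F G, B n (toJS F) (toJS G) = toJS (ellBracket n F G)) : IsFormalDeformation B := by
  refine isFormalDeformation_of_sum_eq (fun f g => ?_) fun n f g h => ?_
  · obtain ⟨F, rfl⟩ := toJS_surjective f
    obtain ⟨G, rfl⟩ := toJS_surjective g
    rw [hB, ellBracket, quasiBracket_zero, map_mul]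
  · obtain ⟨F, rfl⟩ := toJS_surjective f
    obtain ⟨G, rfl⟩ := toJS_surjective g
    obtain ⟨H, rfl⟩ := toJS_surjective h
    simp only [hB, ← map_sum]
    exact congrArg toJS (quasiBracket_assoc isWeightedHomogeneous_ellDeriv
      isWeightedHomogeneous_ellDerivPhi n F G H)

end Brackets

/-! ### Modular forms of level one as polynomials in `e₄` and `e₆`. -/

section ModularModel

open MvPolynomial

theorem G_eq_mul_E {k : ℕ} (hk : 3 ≤ k) (τ : ℍ) :
    (periodPair τ).G k = 2 * riemannZeta k * ModularForm.E hk τ := by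
  have h := tsum_eisSummand_eq_riemannZeta_mul_eisensteinSeries hk τ
  have hE : ModularForm.E hk τ = 1 / 2 * eisensteinSeries (N := 1) 0 k τ := rfl
  -- The coordinates are swapped: the Eisenstein summand is a power of `v 0 * τ + v 1`, while the
  -- period pair is `(1, τ)`.
  rw [hE, PeriodPair.G, ← (((finTwoArrowEquiv ℤ).trans (Equiv.prodComm ℤ ℤ)).trans
    (periodPair τ).latticeEquivProd.symm.toEquiv).tsum_eq]
  trans ∑' v : Fin 2 → ℤ, EisensteinSeries.eisSummand k v τ
  · refine tsum_congr fun v => ?_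
    have h1 := (periodPair τ).latticeEquiv_symm_apply (v 1, v 0)
    change (((periodPair τ).latticeEquivProd.symm (v 1, v 0)).1 ^ k)⁻¹ = _
    rw [h1, EisensteinSeries.eisSummand, zpow_neg, zpow_natCast]
    congr 2
    simp only [periodPair, mul_one]
    ring
  · rw [h]
    ring

theorem riemannZeta_natCast_ne_zero {k : ℕ} (hk : 2 ≤ k) : riemannZeta k ≠ 0 :=
  riemannZeta_ne_zero_of_one_lt_re (by rw [Complex.natCast_re]; exact_mod_cast hk)

theorem e4Fun_eq : e4Fun = (2 * riemannZeta (4 : ℕ)) • (ModularForm.E₄ : ℍ → ℂ) :=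
  funext fun τ => G_eq_mul_E (by norm_num) τ

theorem e6Fun_eq : e6Fun = (2 * riemannZeta (6 : ℕ)) • (ModularForm.E₆ : ℍ → ℂ) :=
  funext fun τ => G_eq_mul_E (by norm_num) τ

/-- The generators `e₄`, `e₆` of the algebra of modular forms. -/
noncomputable def modGen : Fin 2 → ℍ → ℂ := ![e4Fun, e6Fun]

/-- The weights of the generators. -/
def modWt : Fin 2 → ℕ := ![4, 6]

/-- The evaluation of polynomials at the generators. -/
noncomputable def modEval : MvPolynomial (Fin 2) ℂ →ₐ[ℂ] (ℍ → ℂ) := aeval modGen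

theorem isWeightedHomogeneous_modX_zero :
    IsWeightedHomogeneous modWt (X 0 : MvPolynomial (Fin 2) ℂ) 4 :=
  isWeightedHomogeneous_X ℂ modWt 0

theorem isWeightedHomogeneous_modX_one :
    IsWeightedHomogeneous modWt (X 1 : MvPolynomial (Fin 2) ℂ) 6 :=
  isWeightedHomogeneous_X ℂ modWt 1

/-- The polynomial whose value is the normalized Eisenstein series `E₄`. -/
noncomputable def polyE4 : MvPolynomial (Fin 2) ℂ := C (2 * riemannZeta (4 : ℕ))⁻¹ * X 0

/-- The polynomial whose value is the normalized Eisenstein series `E₆`. -/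
noncomputable def polyE6 : MvPolynomial (Fin 2) ℂ := C (2 * riemannZeta (6 : ℕ))⁻¹ * X 1

theorem isWeightedHomogeneous_polyE4 : IsWeightedHomogeneous modWt polyE4 4 :=
  isWeightedHomogeneous_modX_zero.C_mul _

theorem isWeightedHomogeneous_polyE6 : IsWeightedHomogeneous modWt polyE6 6 :=
  isWeightedHomogeneous_modX_one.C_mul _

theorem modEval_polyE4 : modEval polyE4 = ModularForm.E₄ := by
  have h : modGen 0 = e4Fun := rfl
  rw [polyE4, modEval, map_mul, aeval_X, aeval_C, h, e4Fun_eq, ← Algebra.smul_def, smul_smul,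
    inv_mul_cancel₀ (mul_ne_zero two_ne_zero (riemannZeta_natCast_ne_zero (by norm_num))), one_smul]

theorem modEval_polyE6 : modEval polyE6 = ModularForm.E₆ := by
  have h : modGen 1 = e6Fun := rfl
  rw [polyE6, modEval, map_mul, aeval_X, aeval_C, h, e6Fun_eq, ← Algebra.smul_def, smul_smul,
    inv_mul_cancel₀ (mul_ne_zero two_ne_zero (riemannZeta_natCast_ne_zero (by norm_num))), one_smul]

/-- Homogeneous polynomials in `e₄` and `e₆` are modular forms. -/
theorem exists_modularForm_eq_modEval {k : ℕ} {F : MvPolynomial (Fin 2) ℂ}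
    (hF : IsWeightedHomogeneous modWt F k) :
    ∃ f : ModularForm 𝒮ℒ (k : ℤ), (f : ℍ → ℂ) = modEval F := by
  induction hF using IsWeightedHomogeneous.induction_on with
  | zero => exact ⟨0, by rw [map_zero, FunLike.coe_zero]⟩
  | add p q _ _ hp hq =>
    obtain ⟨f, hf⟩ := hp
    obtain ⟨g, hg⟩ := hq
    exact ⟨f + g, by rw [FunLike.coe_add, hf, hg, map_add]⟩
  | monomial e r hr =>
    have hk : ((e 0 : ℕ) : ℤ) * 4 + ((e 1 : ℕ) : ℤ) * 6 = k := by
      rw [← hr, Finsupp.weight_apply, Finsupp.sum_fintype _ _ (by simp), Fin.sum_univ_two]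
      simp [modWt]
    refine ⟨(r * (2 * riemannZeta (4 : ℕ)) ^ e 0 * (2 * riemannZeta (6 : ℕ)) ^ e 1) •
      ModularForm.mcast hk ((ModularForm.E₄.pow (e 0)).mul (ModularForm.E₆.pow (e 1))), ?_⟩
    rw [FunLike.coe_smul, ModularForm.coe_mcast, ModularForm.coe_mul, ModularForm.coe_pow,
      ModularForm.coe_pow, modEval, aeval_monomial, Finsupp.prod_fintype _ _ (by simp),
      Fin.prod_univ_two]
    have h0 : modGen 0 = e4Fun := rfl
    have h1 : modGen 1 = e6Fun := rfl
    rw [h0, h1, e4Fun_eq, e6Fun_eq]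
    ext τ
    simp only [Pi.smul_apply, Pi.mul_apply, Pi.pow_apply, smul_eq_mul, Pi.algebraMap_apply,
      Algebra.algebraMap_self, RingHom.id_apply]
    ring

/-- Every modular form of level one is a homogeneous polynomial in `e₄` and `e₆`. -/
theorem exists_modEval_eq (k : ℕ) (f : ModularForm 𝒮ℒ (k : ℤ)) :
    ∃ F, IsWeightedHomogeneous modWt F k ∧ modEval F = f := by
  induction k using Nat.strong_induction_on with
  | _ k ih =>
    have hzero : f = 0 → ∃ F, IsWeightedHomogeneous modWt F k ∧ modEval F = f := fun h =>
      ⟨0, isWeightedHomogeneous_zero ℂ modWt k, by rw [map_zero, h, FunLike.coe_zero]⟩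
    rcases Nat.even_or_odd k with hk | hk
    swap
    · exact hzero (ModularForm.levelOne_odd_weight_eq_zero (by exact_mod_cast hk) f)
    obtain rfl | rfl | ⟨a, b, hab⟩ : k = 0 ∨ k = 2 ∨ ∃ a b, k = 4 * a + 6 * b := by
      obtain ⟨m, rfl⟩ := hk
      rcases Nat.even_or_odd' m with ⟨c, rfl | rfl⟩
      · exact .inr (.inr ⟨c, 0, by ring⟩)
      · rcases c with _ | c
        · exact .inr (.inl rfl)
        · exact .inr (.inr ⟨c, 1, by ring⟩)
    · obtain ⟨c, hc⟩ := ModularFormClass.levelOne_weight_zero_const f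
      refine ⟨C c, isWeightedHomogeneous_C _ _, ?_⟩
      rw [hc, modEval, aeval_C]
      rfl
    · exact hzero (rank_zero_iff_forall_zero.1 ModularForm.levelOne_weight_two_rank_zero f)
    · have hk' : (a : ℤ) * (4 : ℕ) + (b : ℤ) * (6 : ℕ) = k := by
        rw [hab]
        push_cast
        ring
      -- A monomial in `E₄` and `E₆` of weight `k` has constant term `1`, so subtracting a multiple
      -- of it from `f` leaves a cusp form.
      set g : ModularForm 𝒮ℒ (k : ℤ) :=
        ModularForm.mcast hk' ((ModularForm.E₄.pow a).mul (ModularForm.E₆.pow b)) with hg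
      have hgc : (qExpansion 1 g).coeff 0 = 1 := by
        rw [hg, ModularForm.coe_mcast, ModularForm.qExpansion_mul one_pos one_mem_strictPeriods_SL,
          ModularForm.qExpansion_pow one_pos one_mem_strictPeriods_SL,
          ModularForm.qExpansion_pow one_pos one_mem_strictPeriods_SL,
          PowerSeries.coeff_zero_eq_constantCoeff_apply, map_mul, map_pow, map_pow,
          ← PowerSeries.coeff_zero_eq_constantCoeff_apply,
          ← PowerSeries.coeff_zero_eq_constantCoeff_apply,
          EisensteinSeries.E_qExpansion_coeff_zero _ ⟨2, rfl⟩,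
          EisensteinSeries.E_qExpansion_coeff_zero _ ⟨3, rfl⟩, one_pow, one_pow, one_mul]
      obtain ⟨h, hh⟩ := ModularForm.sub_smul_isCuspForm f g hgc
      set c := (qExpansion 1 f).coeff 0
      have hfg : (f : ℍ → ℂ) = h + c • (g : ℍ → ℂ) := by
        have h1 : (h : ℍ → ℂ) = f - c • (g : ℍ → ℂ) := congrArg DFunLike.coe hh
        rw [h1, sub_add_cancel]
      have hG : ∃ G, IsWeightedHomogeneous modWt G k ∧ modEval G = g := by
        refine ⟨polyE4 ^ a * polyE6 ^ b, ?_, ?_⟩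
        · have h1 := (isWeightedHomogeneous_polyE4.pow a).mul (isWeightedHomogeneous_polyE6.pow b)
          rwa [smul_eq_mul, smul_eq_mul, mul_comm a, mul_comm b, ← hab] at h1
        · rw [map_mul, map_pow, map_pow, modEval_polyE4, modEval_polyE6, hg, ModularForm.coe_mcast,
            ModularForm.coe_mul, ModularForm.coe_pow, ModularForm.coe_pow]
      -- A cusp form is the discriminant, itself a polynomial in `E₄` and `E₆`, times a form of
      -- weight `k - 12`: zero if that weight is negative, covered by induction otherwise.
      have hH : ∃ H, IsWeightedHomogeneous modWt H k ∧ modEval H = h := by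
        have hΔ := ModularForm.discriminant_mul_discriminantEquiv h
        rcases lt_or_ge k 12 with hlt | hge
        · have h0 : (CuspForm.discriminantEquiv h : ℍ → ℂ) = 0 :=
            ModularFormClass.levelOne_neg_weight_eq_zero (k := (k : ℤ) - 12) (by omega) _
          rw [h0, mul_zero] at hΔ
          exact ⟨0, isWeightedHomogeneous_zero ℂ modWt k, by rw [map_zero, hΔ]⟩
        · obtain ⟨m, rfl⟩ := Nat.exists_eq_add_of_le' hge
          obtain ⟨P, hP, hP'⟩ := ih m (by omega)
            (ModularForm.mcast (by push_cast; ring) (CuspForm.discriminantEquiv h))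
          rw [ModularForm.coe_mcast] at hP'
          refine ⟨C (1 / 1728) * (polyE4 ^ 3 - polyE6 ^ 2) * P, ?_, ?_⟩
          · rw [add_comm]
            exact (((isWeightedHomogeneous_polyE4.pow 3).sub
              (isWeightedHomogeneous_polyE6.pow 2)).C_mul _).mul hP
          · rw [← hΔ, map_mul, map_mul, map_sub, map_pow, map_pow, modEval_polyE4, modEval_polyE6,
              hP', modEval, aeval_C]
            ext τ
            simp only [Pi.mul_apply, Pi.sub_apply, Pi.pow_apply, Pi.algebraMap_apply,
              Algebra.algebraMap_self, RingHom.id_apply,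
              ModularForm.discriminant_eq_E₄_cube_sub_E₆_sq]
            ring
      obtain ⟨G, hG, hG'⟩ := hG
      obtain ⟨H, hH, hH'⟩ := hH
      exact ⟨H + C c * G, hH.add (hG.C_mul c), by
        rw [map_add, ← smul_eq_C_mul, map_smul, hG', hH', hfg]⟩

end ModularModel

/-! ### Rankin–Cohen brackets of modular forms. -/

section ModularBrackets

open MvPolynomial

theorem ofTau_injective : Function.Injective ofTau := by
  intro f g h
  ext τ
  obtain ⟨z, hz⟩ := exists_notMem_lattice τ
  exact congrFun h ⟨(τ, z), hz⟩

/-- Functions of `τ` as functions of `(τ, z)`, as a homomorphism of algebras. -/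
def ofTauHom : (ℍ → ℂ) →ₐ[ℂ] Fun where
  toFun := ofTau
  map_one' := rfl
  map_mul' _ _ := rfl
  map_zero' := rfl
  map_add' _ _ := rfl
  commutes' _ := rfl

theorem ofTauHom_apply (f : ℍ → ℂ) : ofTauHom f = ofTau f := rfl

/-- The polynomial that expresses `e₆` by the generators of the algebra of elliptic forms. -/
noncomputable def ellE6 : MvPolynomial (Fin 3) ℂ :=
  C (1 / 140) * (C 4 * X 0 ^ 3 - C 60 * (X 2 * X 0) - X 1 ^ 2)

theorem isWeightedHomogeneous_ellE6 : IsWeightedHomogeneous ellWt ellE6 6 := by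
  have h0 : IsWeightedHomogeneous ellWt (X 0 : MvPolynomial (Fin 3) ℂ) 2 :=
    isWeightedHomogeneous_X ℂ ellWt 0
  have h1 : IsWeightedHomogeneous ellWt (X 1 : MvPolynomial (Fin 3) ℂ) 3 :=
    isWeightedHomogeneous_X ℂ ellWt 1
  have h2 : IsWeightedHomogeneous ellWt (X 2 : MvPolynomial (Fin 3) ℂ) 4 :=
    isWeightedHomogeneous_X ℂ ellWt 2
  exact ((((h0.pow 3).C_mul _).sub ((h2.mul h0).C_mul _)).sub (h1.pow 2)).C_mul _

theorem ellEval_ellE6 : ellEval ellE6 = ofTau e6Fun := by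
  ext p
  rw [ofTau_e6Fun p]
  simp [ellEval, ellE6, ellGen, e4_eq_ofTau]
  ring

/-- Apply `d` to the expression of `e₆` through `℘`, `∂_z ℘` and `e₄`; the result recombines, again
by the Weierstrass equation, into `e₂`, `e₄` and `e₆`. -/
theorem modularDeriv_e6Fun (τ : ℍ) :
    modularDeriv e6Fun τ = -(15 / 7) * e4Fun τ ^ 2 + 3 / 2 * e2Fun τ * e6Fun τ := by
  obtain ⟨z, hz⟩ := exists_notMem_lattice τ
  set p : domain := ⟨(τ, z), hz⟩
  have h1 := congrFun (d_ofTau e6Fun) p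
  rw [← ellEval_ellE6, ← ellEvalPhi_rename, d_ellEvalPhi] at h1
  have h2 := ofTau_e6Fun p
  simp only [ofTau] at h1 h2
  rw [← h1, h2]
  simp [ellE6, quasiDerivation, Derivation.leibniz, Derivation.leibniz_pow, ellEvalPhi, ellDeriv,
    ellGen, ellWt, e4_eq_ofTau, ofTau]
  ring

/-- The derivatives of `e₄` and `e₆`, up to multiples of `e₂`. -/
noncomputable def modPolyDeriv : Fin 2 → MvPolynomial (Fin 2) ℂ :=
  ![C (-7 / 2) * X 1, C (-15 / 7) * X 0 ^ 2]

/-- The inhomogeneous part of the derivative of `e₂ / 4`. -/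
noncomputable def modPolyDerivPhi : MvPolynomial (Fin 2) ℂ := C (-5 / 16) * X 0

/-- The evaluation of polynomials at `e₄`, `e₆` and `e₂ / 4`. -/
noncomputable def modEvalPhi : MvPolynomial (Option (Fin 2)) ℂ →ₐ[ℂ] (ℍ → ℂ) :=
  aeval fun i => i.elim ((1 / 4 : ℂ) • e2Fun) modGen

theorem modEvalPhi_rename (f : MvPolynomial (Fin 2) ℂ) :
    modEvalPhi (rename some f) = modEval f := by
  rw [modEvalPhi, aeval_rename]
  rfl

theorem isWeightedHomogeneous_modPolyDeriv (i : Fin 2) :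
    IsWeightedHomogeneous modWt (modPolyDeriv i) (modWt i + 2) := by
  fin_cases i
  · exact isWeightedHomogeneous_modX_one.C_mul _
  · exact (isWeightedHomogeneous_modX_zero.pow 2).C_mul _

theorem isWeightedHomogeneous_modPolyDerivPhi : IsWeightedHomogeneous modWt modPolyDerivPhi 4 :=
  isWeightedHomogeneous_modX_zero.C_mul _

theorem ofTau_e4Fun_mem_niceFun : ofTau e4Fun ∈ niceFun :=
  fun p => ⟨0, hasPartials_ofTau_e4Fun p⟩

theorem ofTau_e2Fun_mem_niceFun : ofTau e2Fun ∈ niceFun :=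
  fun p => ⟨0, hasPartials_ofTau_e2Fun p⟩

theorem ellEval_mem_niceFun (F : MvPolynomial (Fin 3) ℂ) : ellEval F ∈ niceFun := by
  have h : Algebra.adjoin ℂ (Set.range ellGen) ≤ niceFun :=
    Algebra.adjoin_le (Set.range_subset_iff.2 ellGen_mem_niceFun)
  rw [Algebra.adjoin_range_eq_range_aeval] at h
  exact h ⟨F, rfl⟩

theorem modularDeriv_modEvalPhi (F : MvPolynomial (Option (Fin 2)) ℂ) :
    modularDeriv (modEvalPhi F) =
      modEvalPhi (quasiDerivation modWt modPolyDeriv modPolyDerivPhi F) := by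
  -- The identity is checked for `d` on functions of `(τ, z)`, where the Leibniz rule on `niceFun`
  -- is available.
  refine ofTau_injective ?_
  rw [← d_ofTau]
  refine map_derivation_eq (ev := ofTauHom.comp modEvalPhi) (N := niceFun)
    (fun f hf g hg => d_add hf hg) (fun f hf g hg => d_mul hf hg) d_algebraMap (fun i => ?_)
    (fun i => ?_) F
  · rw [AlgHom.comp_apply, modEvalPhi, aeval_X]
    rcases i with _ | i
    · exact phi_mem_niceFun
    · fin_cases i
      · exact ofTau_e4Fun_mem_niceFun
      · change ofTau e6Fun ∈ niceFun
        rw [← ellEval_ellE6]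
        exact ellEval_mem_niceFun _
  · rw [AlgHom.comp_apply, AlgHom.comp_apply, quasiDerivation, mkDerivation_X]
    rcases i with _ | i
    · simp only [Option.elim, map_add, map_pow, modEvalPhi_rename]
      rw [modEvalPhi, aeval_X, Option.elim, map_smul, ofTauHom_apply, d_smul _
        ofTau_e2Fun_mem_niceFun, d_ofTau]
      ext p
      simp [modPolyDerivPhi, modEval, modGen, ofTauHom_apply, ofTau, modularDeriv_e2Fun]
      ring
    · simp only [Option.elim, map_add, map_smul, map_mul, modEvalPhi_rename]
      simp only [modEvalPhi, aeval_X, Option.elim, ofTauHom_apply, d_ofTau]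
      ext p
      fin_cases i
      · have := modularDeriv_e4Fun p.1.1
        simp [modPolyDeriv, modEval, modGen, modWt, ofTau, this]
        ring
      · have := modularDeriv_e6Fun p.1.1
        simp [modPolyDeriv, modEval, modGen, modWt, ofTau, this]
        ring

/-- Modular forms of weight `k` are elliptic forms of weight `k`. -/
theorem ofTau_mem_JSweight {k : ℕ} (f : ModularForm 𝒮ℒ (k : ℤ)) : ofTau f ∈ JSweight k := by
  obtain ⟨F, hF, hf⟩ := exists_modEval_eq k f
  rw [← hf, mem_JSweight_iff]
  have key : ∀ G, ellEval (aeval ![X 2, ellE6] G) = ofTau (modEval G) := fun G => by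
    have h : ellEval.comp (aeval ![X 2, ellE6]) = ofTauHom.comp modEval := by
      ext1 i
      fin_cases i
      · simp [ellEval, ellGen, modEval, modGen, ofTauHom_apply, e4_eq_ofTau]
      · simp [ellEval_ellE6, modEval, modGen, ofTauHom_apply]
    exact DFunLike.congr_fun h G
  refine ⟨_, ?_, key F⟩
  clear hf
  induction hF using IsWeightedHomogeneous.induction_on with
  | zero => simpa using isWeightedHomogeneous_zero ℂ ellWt k
  | add p q _ _ hp hq =>
    rw [map_add]
    exact hp.add hq
  | monomial e r hr =>
    have h2 : IsWeightedHomogeneous ellWt (X 2 : MvPolynomial (Fin 3) ℂ) 4 :=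
      isWeightedHomogeneous_X ℂ ellWt 2
    rw [aeval_monomial, Finsupp.prod_fintype _ _ (by simp), Fin.prod_univ_two, ← hr,
      Finsupp.weight_apply, Finsupp.sum_fintype _ _ (by simp), Fin.sum_univ_two]
    exact ((h2.pow (e 0)).mul (isWeightedHomogeneous_ellE6.pow (e 1))).C_mul r

theorem rankinCohen_ofTau (k l n : ℕ) (f g : ℍ → ℂ) :
    rankinCohen d k l n (ofTau f) (ofTau g) = ofTau (rankinCohen modularDeriv k l n f g) := by
  have hit : ∀ (r : ℕ) f, d^[r] (ofTau f) = ofTau (modularDeriv^[r] f) := fun r f =>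
    ((Function.Semiconj.iterate_right (f := ofTau) (ga := modularDeriv) (gb := d)
      (fun f => (d_ofTau f).symm) r) f).symm
  rw [← ofTauHom_apply (rankinCohen _ _ _ _ _ _), rankinCohen, rankinCohen, map_sum]
  refine Finset.sum_congr rfl fun r _ => ?_
  rw [map_smul, map_mul, hit, hit, ofTauHom_apply, ofTauHom_apply]

/-- The Rankin–Cohen brackets of modular forms are modular forms. -/
theorem exists_modularForm_eq_rankinCohen {k l : ℕ} (n : ℕ) (f : ModularForm 𝒮ℒ (k : ℤ))
    (g : ModularForm 𝒮ℒ (l : ℤ)) : ∃ h : ModularForm 𝒮ℒ ((k + l + 2 * n : ℕ) : ℤ),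
      (h : ℍ → ℂ) = rankinCohen modularDeriv k l n (f : ℍ → ℂ) (g : ℍ → ℂ) := by
  obtain ⟨F, hF, hf⟩ := exists_modEval_eq k f
  obtain ⟨G, hG, hg⟩ := exists_modEval_eq l g
  obtain ⟨h, hh⟩ := exists_modularForm_eq_modEval (isWeightedHomogeneous_quasiBracket
    isWeightedHomogeneous_modPolyDeriv isWeightedHomogeneous_modPolyDerivPhi n hF hG)
  refine ⟨h, ?_⟩
  rw [hh, ← hf, ← hg, ← modEvalPhi_rename, ← modEvalPhi_rename F, ← modEvalPhi_rename G]
  exact (rankinCohen_eq_quasiBracket isWeightedHomogeneous_modPolyDeriv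
    isWeightedHomogeneous_modPolyDerivPhi modularDeriv_modEvalPhi n hF hG).symm

end ModularBrackets

end EllipticForms

theorem mainTheorem4 :
    -- `JS` is stable under the brackets
    (∀ (n k l : ℕ) (f g : EllipticForms.Fun),
      f ∈ EllipticForms.JSweight k → g ∈ EllipticForms.JSweight l →
        EllipticForms.rankinCohen EllipticForms.d k l n f g ∈ EllipticForms.JS) ∧
    -- the brackets extend to one and only one sequence of bilinear maps on `JS`
    ∃ B : ℕ → EllipticForms.JS →ₗ[ℂ] EllipticForms.JS →ₗ[ℂ] EllipticForms.JS,
      EllipticForms.IsBracketSequence B ∧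
      (∀ B' : ℕ → EllipticForms.JS →ₗ[ℂ] EllipticForms.JS →ₗ[ℂ] EllipticForms.JS,
        EllipticForms.IsBracketSequence B' → B' = B) ∧
      -- this sequence is a formal deformation of `JS`
      EllipticForms.IsFormalDeformation B ∧
      -- it extends the classical Rankin–Cohen brackets on the modular forms of level one
      ∀ (k l : ℕ) (f : ModularForm 𝒮ℒ (k : ℤ)) (g : ModularForm 𝒮ℒ (l : ℤ)),
        ∃ (hf : EllipticForms.ofTau f ∈ EllipticForms.JSweight k)
          (hg : EllipticForms.ofTau g ∈ EllipticForms.JSweight l),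
          ∀ n : ℕ, ∃ h : ModularForm 𝒮ℒ ((k + l + 2 * n : ℕ) : ℤ),
            (h : ℍ → ℂ) =
              EllipticForms.rankinCohen EllipticForms.modularDeriv k l n (f : ℍ → ℂ) (g : ℍ → ℂ) ∧
            (B n ⟨EllipticForms.ofTau f, EllipticForms.mem_JS_of_mem_JSweight hf⟩
                ⟨EllipticForms.ofTau g, EllipticForms.mem_JS_of_mem_JSweight hg⟩ :
              EllipticForms.Fun) = EllipticForms.ofTau h := by
  refine ⟨fun n k l f g hf hg => EllipticForms.rankinCohen_mem_JS hf hg, ?_⟩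
  obtain ⟨B, hB⟩ := EllipticForms.exists_bracket
  have hseq := EllipticForms.isBracketSequence_of_toJS hB
  refine ⟨B, hseq, fun B' hB' => hseq.unique hB', EllipticForms.isFormalDeformation_of_toJS hB,
    fun k l f g => ⟨EllipticForms.ofTau_mem_JSweight f, EllipticForms.ofTau_mem_JSweight g,
      fun n => ?_⟩⟩
  obtain ⟨h, hh⟩ := EllipticForms.exists_modularForm_eq_rankinCohen n f g
  refine ⟨h, hh, ?_⟩
  rw [hseq n k l _ _ (EllipticForms.ofTau_mem_JSweight f) (EllipticForms.ofTau_mem_JSweight g), hh]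
  exact EllipticForms.rankinCohen_ofTau k l n f g
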